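/- Let $g \ge 1$ and let $p$ be a prime. Let $V = \mathbb{F}_p^{2g}$, equipped with its standard symplectic form. Let $\mathcal{T}$ be the Tits building of $V$, that is, the simplicial complex whose $r$-simplices are the flags $0 \subsetneq V_0 \subsetneq \cdots \subsetneq V_r \subsetneq V$ of subspaces, and let $\mathrm{St}_{2g}(\mathbb{F}_p) = \widetilde{H}_{2g-2}(\mathcal{T};\mathbb{Q})$ be the Steinberg module. Let $\mathfrak{X}$ be the simplicial complex whose $r$-simplices are the chains $\emptyset \subsetneq I_0 \subsetneq \cdots \subsetneq I_r \subsetneq \{1,\ldots,2g\}$; it is an oriented $(2g-2)$-sphere. For a sequence $B = (v_1,\ldots,v_{2g})$ of nonzero vectors of $V$, the apartment class $A_B \in \mathrm{St}_{2g}(\mathbb{F}_p)$ is the image of the fundamental class $[\mathfrak{X}]$ under the simplicial map $I \mapsto \langle v_i \mid i \in I\rangle$. Call $A_B$ separated if there is a splitting $V = S_1 \oplus S_2$ into nonzero subspaces that are orthogonal for the symplectic form such that each $v_i$ lies in $S_1$ or in $S_2$. Let $\mathrm{StNS}_{2g}(\mathbb{F}_p)$ be the quotient of $\mathrm{St}_{2g}(\mathbb{F}_p)$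 by the $\mathbb{Q}$-span of the separated apartment classes. Then $$\dim_{\mathbb{Q}} \mathrm{StNS}_{2g}(\mathbb{F}_p) = \frac{|\mathrm{Sp}_{2g}(\mathbb{F}_p)|}{g\,(p^{2g}-1)}.$$ -/

import Mathlib

noncomputable section

/-! ### Simplicial chains and reduced homology of the order complex of a poset -/

section OrderComplex

variable (P : Type*) [PartialOrder P]

/-- Rational simplicial chains of the order complex of `P` on simplices with `m` vertices: the
basis consists of the strictly increasing sequences `x_0 < ⋯ < x_{m-1}` in `P` (every simplex is
oriented by the order of its vertices). For `m = 0` the only basis element is the empty simplex, so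
that these spaces form the augmented chain complex. -/
abbrev OrderChains (m : ℕ) : Type _ := {x : Fin m → P // StrictMono x} →₀ ℚ

/-- The simplicial boundary map `∂ (x_0, …, x_m) = ∑ i, (-1)^i (x_0, …, x̂_i, …, x_m)`; for `m = 0`
it is the augmentation. -/
def orderBoundary (m : ℕ) : OrderChains P (m + 1) →ₗ[ℚ] OrderChains P m :=
  Finsupp.linearCombination ℚ fun x => ∑ i : Fin (m + 1), (-1 : ℚ) ^ (i : ℕ) •
    Finsupp.single ⟨x.1 ∘ i.succAbove, x.2.comp (Fin.strictMono_succAbove i)⟩ 1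

/-- The reduced simplicial homology of the order complex of `P` in degree `r ≥ 0`, with rational
coefficients; `r`-simplices have `r + 1` vertices. -/
abbrev OrderReducedHomology (r : ℕ) : Type _ :=
  LinearMap.ker (orderBoundary P r) ⧸
    (LinearMap.range (orderBoundary P (r + 1))).submoduleOf (LinearMap.ker (orderBoundary P r))

variable {P}

open Classical in
/-- The chain of a sequence of vertices: the basis element if it is strictly increasing, and zero
otherwise. -/
def orderSimplex {m : ℕ} (x : Fin m → P) : OrderChains P m :=
  if h : StrictMono x then Finsupp.single ⟨x, h⟩ 1 else 0

theorem orderSimplex_of_strictMono {m : ℕ} {x : Fin m → P} (h : StrictMono x) :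
    orderSimplex x = Finsupp.single ⟨x, h⟩ 1 := dif_pos h

theorem orderSimplex_of_not {m : ℕ} {x : Fin m → P} (h : ¬ StrictMono x) :
    orderSimplex x = 0 := dif_neg h

theorem orderSimplex_boundary {m : ℕ} (x : Fin (m + 1) → P) (hx : Monotone x) :
    orderBoundary P m (orderSimplex x) =
      ∑ i : Fin (m + 1), (-1 : ℚ) ^ (i : ℕ) • orderSimplex (x ∘ i.succAbove) := by
  by_cases h : StrictMono x
  · rw [orderSimplex_of_strictMono h, orderBoundary, Finsupp.linearCombination_single, one_smul]
    refine Finset.sum_congr rfl fun i _ => ?_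
    rw [orderSimplex_of_strictMono (h.comp (Fin.strictMono_succAbove i))]
  · rw [orderSimplex_of_not h, map_zero]
    cases m with
    | zero => exact absurd (fun a b hab => absurd hab (by omega)) h
    | succ m =>
      rw [Fin.strictMono_iff_lt_succ] at h
      push Not at h
      obtain ⟨i, hi⟩ := h
      have hi' : x i.castSucc = x i.succ :=
        ((hx (Fin.castSucc_lt_succ (i := i)).le).lt_or_eq).resolve_left hi
      rw [Finset.sum_eq_add i.castSucc i.succ (Fin.castSucc_lt_succ (i := i)).ne]
      · have hf : x ∘ i.castSucc.succAbove = x ∘ i.succ.succAbove := by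
          funext k
          simp only [Function.comp]
          by_cases hk : k = i
          · subst hk
            rw [Fin.succAbove_castSucc_self, Fin.succAbove_succ_self, hi']
          · congr 1
            rcases lt_or_gt_of_ne hk with hk | hk
            · rw [Fin.succAbove_of_castSucc_lt _ _ (by simpa using hk),
                Fin.succAbove_of_castSucc_lt _ _
                  (by rw [Fin.lt_def] at hk ⊢; simp; omega)]
            · rw [Fin.succAbove_of_le_castSucc _ _ (by simpa using hk.le),
                Fin.succAbove_of_le_castSucc _ _
                  (by rw [Fin.lt_def] at hk; rw [Fin.le_def]; simp; omega)]
        rw [hf, ← add_smul]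
        simp [pow_succ]
      · rintro j - ⟨h1, h2⟩
        rw [orderSimplex_of_not, smul_zero]
        intro hs
        obtain ⟨a, ha⟩ := Fin.exists_succAbove_eq (x := i.castSucc) (y := j) (Ne.symm h1)
        obtain ⟨b, hb⟩ := Fin.exists_succAbove_eq (x := i.succ) (y := j) (Ne.symm h2)
        have hab : a < b := by
          rw [← (Fin.strictMono_succAbove j).lt_iff_lt, ha, hb]
          exact Fin.castSucc_lt_succ
        have := hs hab
        simp only [Function.comp, ha, hb] at this
        exact hi this
      · simp
      · simp

variable {Q : Type*} [PartialOrder Q]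

/-- The chain map induced by the simplicial map of order complexes given by a monotone map: a
simplex whose image has fewer vertices is sent to zero. -/
def orderChainMap (f : P →o Q) (m : ℕ) : OrderChains P m →ₗ[ℚ] OrderChains Q m :=
  Finsupp.linearCombination ℚ fun x => orderSimplex (f ∘ x.1)

theorem orderChainMap_boundary (f : P →o Q) (m : ℕ) (c : OrderChains P (m + 1)) :
    orderBoundary Q m (orderChainMap f (m + 1) c) =
      orderChainMap f m (orderBoundary P m c) := by
  rw [← LinearMap.comp_apply, ← LinearMap.comp_apply]
  congr 1
  ext1 x
  ext1
  simp only [LinearMap.comp_apply, Finsupp.lsingle_apply, orderChainMap,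
    Finsupp.linearCombination_single, one_smul]
  rw [orderSimplex_boundary _ (f.monotone.comp x.2.monotone)]
  simp [orderBoundary, map_sum, Function.comp_assoc]

/-- The map on reduced homology induced by the simplicial map of order complexes given by a
monotone map. -/
def orderHomologyMap (f : P →o Q) (r : ℕ) :
    OrderReducedHomology P r →ₗ[ℚ] OrderReducedHomology Q r :=
  Submodule.mapQ _ _
    ((orderChainMap f (r + 1)).restrict (p := LinearMap.ker (orderBoundary P r))
      (q := LinearMap.ker (orderBoundary Q r)) fun c hc => by
        rw [LinearMap.mem_ker] at hc ⊢
        rw [orderChainMap_boundary, hc, map_zero])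
    (by
      rintro ⟨c, hc⟩ ⟨d, hd⟩
      exact ⟨orderChainMap f (r + 2) d, by
        rw [orderChainMap_boundary, hd]; rfl⟩)

end OrderComplex

/-! ### The barycentric subdivision of the boundary of a simplex and its fundamental class -/

/-- The poset of nonempty proper subsets of `{0, …, n - 1}`. Its order complex is the barycentric
subdivision of the boundary of an `(n - 1)`-simplex, an `(n - 2)`-sphere. -/
abbrev ProperSubset (n : ℕ) : Type := {I : Set (Fin n) // I.Nonempty ∧ I ≠ Set.univ}

/-- The vertex `{σ 0, …, σ k}` of the maximal flag of subsets determined by a permutation `σ`. -/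
def permVertex {n : ℕ} (hn : 2 ≤ n) (σ : Equiv.Perm (Fin n)) (k : Fin (n - 2 + 1)) :
    ProperSubset n :=
  ⟨σ '' {i : Fin n | (i : ℕ) ≤ k}, by
    have hk := k.isLt
    refine ⟨⟨σ ⟨0, by omega⟩, ⟨0, by omega⟩, by simp, rfl⟩, fun h => ?_⟩
    have h1 : σ ⟨n - 1, by omega⟩ ∈ σ '' {i : Fin n | (i : ℕ) ≤ k} := h ▸ Set.mem_univ _
    obtain ⟨i, hi, hi'⟩ := h1
    have h2 := congrArg Fin.val (σ.injective hi')
    simp only [Set.mem_ofPred_eq] at hi h2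
    omega⟩

/-- The fundamental cycle `∑ σ, sign σ • ({σ 0} ⊂ {σ 0, σ 1} ⊂ ⋯ ⊂ {σ 0, …, σ (n - 2)})`. -/
def sphereCycle {n : ℕ} (hn : 2 ≤ n) : OrderChains (ProperSubset n) (n - 2 + 1) :=
  ∑ σ : Equiv.Perm (Fin n), ((Equiv.Perm.sign σ : ℤ) : ℚ) • orderSimplex (permVertex hn σ)

theorem permVertex_monotone {n : ℕ} (hn : 2 ≤ n) (σ : Equiv.Perm (Fin n)) :
    Monotone (permVertex hn σ) := by
  intro a b hab
  refine Set.image_mono fun i hi => ?_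
  exact le_trans (show (i : ℕ) ≤ a from hi) hab

theorem sphereCycle_boundary {n : ℕ} (hn : 2 ≤ n) :
    orderBoundary (ProperSubset n) (n - 2) (sphereCycle hn) = 0 := by
  simp only [sphereCycle, map_sum, map_smul]
  simp_rw [orderSimplex_boundary _ (permVertex_monotone hn _), Finset.smul_sum]
  rw [Finset.sum_comm]
  refine Finset.sum_eq_zero fun j _ => ?_
  have hj := j.isLt
  let a : Fin n := ⟨j, by omega⟩
  let b : Fin n := ⟨j + 1, by omega⟩
  have hab : a ≠ b := by simp [a, b, Fin.ext_iff]
  have key : ∀ σ : Equiv.Perm (Fin n),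
      permVertex hn (σ * Equiv.swap a b) ∘ j.succAbove = permVertex hn σ ∘ j.succAbove := by
    intro σ
    funext k
    have hne : ((j.succAbove k : Fin _) : ℕ) ≠ j := fun h => Fin.succAbove_ne j k (Fin.ext h)
    apply Subtype.ext
    simp only [Function.comp, permVertex, Equiv.Perm.coe_mul, Set.image_comp]
    congr 1
    ext i
    rw [Equiv.image_eq_preimage_symm, Equiv.symm_swap]
    simp only [Set.mem_preimage, Set.mem_ofPred_eq, Equiv.swap_apply_def]
    split_ifs with h1 h2
    · subst h1; simp only [a, b]; omega
    · subst h2; simp only [a, b]; omega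
    · rfl
  set S := ∑ σ : Equiv.Perm (Fin n), ((Equiv.Perm.sign σ : ℤ) : ℚ) •
    (-1 : ℚ) ^ (j : ℕ) • orderSimplex (permVertex hn σ ∘ j.succAbove) with hS
  have h1 : S = -S := by
    conv_lhs => rw [hS, ← Equiv.sum_comp (Equiv.mulRight (Equiv.swap a b))]
    rw [hS, ← Finset.sum_neg_distrib]
    refine Finset.sum_congr rfl fun σ _ => ?_
    simp [key, Equiv.Perm.sign_mul, Equiv.Perm.sign_swap hab]
  exact self_eq_neg.mp h1

/-- The fundamental class of the sphere in degree `n - 2`. -/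
def sphereClass {n : ℕ} (hn : 2 ≤ n) : OrderReducedHomology (ProperSubset n) (n - 2) :=
  Submodule.Quotient.mk ⟨sphereCycle hn, LinearMap.mem_ker.mpr (sphereCycle_boundary hn)⟩

/-! ### The Tits building, the Steinberg module and apartments -/

section Building

variable (K V : Type*) [Field K] [AddCommGroup V] [Module K V]

/-- The vertices of the Tits building of `SL(V)`: the nonzero proper subspaces of `V`, ordered by
inclusion. The building is the order complex of this poset: its `r`-simplices are the flags
`0 ⊊ V_0 ⊊ ⋯ ⊊ V_r ⊊ V`. -/
abbrev TitsVertex : Type _ := {W : Submodule K V // W ≠ ⊥ ∧ W ≠ ⊤}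

/-- The Steinberg module of an `n`-dimensional vector space `V` (`n ≥ 2`): the reduced rational
homology of the Tits building in degree `n - 2`. -/
abbrev Steinberg (n : ℕ) : Type _ := OrderReducedHomology (TitsVertex K V) (n - 2)

variable {K V}

/-- The vertex map `I ↦ ⟨v_i | i ∈ I⟩` determined by nonzero vectors `v_0, …, v_{n-1}` in an
`n`-dimensional space. The vectors need not be linearly independent. -/
def apartmentMap {n : ℕ} (hV : Module.finrank K V = n) (B : Fin n → V)
    (hB : ∀ i, B i ≠ 0) : ProperSubset n →o TitsVertex K V where
  toFun I := ⟨Submodule.span K (B '' I.1), by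
    obtain ⟨I, ⟨i, hi⟩, hI⟩ := I
    refine ⟨fun h => ?_, fun h => ?_⟩
    · exact hB i ((Submodule.span_eq_bot.mp h) (B i) ⟨i, hi, rfl⟩)
    · classical
      have : Fintype (B '' I : Set V) := Fintype.ofFinite _
      have h1 : (B '' I).finrank K ≤ (B '' I).ncard := by
        have := finrank_span_le_card (R := K) (B '' I)
        rwa [Set.ncard_eq_toFinset_card']
      have h2 : (B '' I).ncard ≤ I.ncard := Set.ncard_image_le I.toFinite
      have h3 : I.ncard < (Set.univ : Set (Fin n)).ncard :=
        Set.ncard_lt_ncard (Set.ssubset_univ_iff.mpr hI) Set.finite_univ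
      have h4 : (B '' I).finrank K = n := by
        rw [Set.finrank, h, finrank_top, hV]
      rw [Set.ncard_univ, Nat.card_fin] at h3
      omega⟩
  monotone' _ _ h := Submodule.span_mono (Set.image_mono h)

/-- The apartment class of a sequence of `n` nonzero vectors in an `n`-dimensional space: the image
of the fundamental class of the sphere. -/
def apartment {n : ℕ} (hn : 2 ≤ n) (hV : Module.finrank K V = n) (B : Fin n → V)
    (hB : ∀ i, B i ≠ 0) : Steinberg K V n :=
  orderHomologyMap (apartmentMap hV B hB) (n - 2) (sphereClass hn)

/-- A sequence of vectors is separated for the form `ω` if there is a nontrivial `ω`-orthogonal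
splitting `V = S₁ ⊕ S₂` such that each vector lies in `S₁` or in `S₂`. -/
def IsSeparated (ω : LinearMap.BilinForm K V) {n : ℕ} (B : Fin n → V) : Prop :=
  ∃ S₁ S₂ : Submodule K V, S₁ ≠ ⊥ ∧ S₂ ≠ ⊥ ∧ IsCompl S₁ S₂ ∧
    (∀ x ∈ S₁, ∀ y ∈ S₂, ω x y = 0) ∧ ∀ i, B i ∈ S₁ ∨ B i ∈ S₂

/-- The separated subspace: the span of the separated apartments. -/
def separatedSubspace (ω : LinearMap.BilinForm K V) {n : ℕ} (hn : 2 ≤ n)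
    (hV : Module.finrank K V = n) : Submodule ℚ (Steinberg K V n) :=
  Submodule.span ℚ {a | ∃ (B : Fin n → V) (hB : ∀ i, B i ≠ 0),
    IsSeparated ω B ∧ a = apartment hn hV B hB}

/-- The quotient of the Steinberg module by the separated subspace. -/
abbrev NonseparatedSteinberg (ω : LinearMap.BilinForm K V) {n : ℕ} (hn : 2 ≤ n)
    (hV : Module.finrank K V = n) : Type _ :=
  Steinberg K V n ⧸ separatedSubspace ω hn hV

end Building

/-! ### The standard symplectic space of dimension `2g` over the field with `p` elements -/

/-- The standard symplectic form, whose isometry group is `Matrix.symplecticGroup`. -/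
def standardSymplecticForm (p g : ℕ) [Fact p.Prime] :
    LinearMap.BilinForm (ZMod p) (Fin g ⊕ Fin g → ZMod p) :=
  Matrix.toBilin' (Matrix.J (Fin g) (ZMod p))

theorem finrank_standard (p g : ℕ) [Fact p.Prime] :
    Module.finrank (ZMod p) (Fin g ⊕ Fin g → ZMod p) = 2 * g := by
  simp [two_mul]

/-- `StNS_{2g}(F_p)`. -/
abbrev StNS (p g : ℕ) [Fact p.Prime] (hg : 1 ≤ g) : Type :=
  NonseparatedSteinberg (standardSymplecticForm p g) (n := 2 * g) (by omega)
    (finrank_standard p g)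

end

/-!
Apartments have determinants as coefficients: for nonzero vectors `B_1, …, B_n` in an
`n`-dimensional space, the coefficient of the complete flag `F` in the cycle of the apartment of `B` is
`det [B_j ∈ F_i]` (`chamberFun_apartmentCycle`). This expression makes sense for an arbitrary family of
pairwise comparable subspaces, and vanishes if the vectors are linearly dependent
(`frameFun_eq_zero_of_finrank_lt`). By the Solomon–Tits theorem (`flagCycles_eq_span_and_finrank`) the
Steinberg module of a subspace `S` of dimension `n` becomes the span `frameSpan` of these functions
(`exists_steinbergEquiv`), and has dimension `q ^ (n.choose 2)`.

For a decomposition `S = S₁ ⊕ S₂`, juxtaposition of bases is a product `St (S₁) ⊗ St (S₂) → St (S)`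
(`shuffle`, `joinMap`), and there is a coproduct in the opposite direction, whose components are the
maps `residue`. Orthogonal splittings turn the Steinberg modules of the symplectic subspaces into a
commutative bialgebra of a twisted kind, and the quotient in question is its space of
indecomposables. For a symplectic subspace `U` of `S`, coproduct followed by product is the
projection of the basis vectors along `S ∩ U^⊥` to `U` (`exists_isFrameProj`). As for graded
commutative bialgebras in characteristic zero, the *Dynkin operator*, the convolution of the antipode
with the grading operator, annihilates the products (`dynkinOp_frameFun_eq_zero`) and is
multiplication by `dim V` modulo products. So `dim V` times the required dimension is the trace of
the Dynkin operator (`finrank_mul_finrank_quotient`).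

Since the convolution of the identity with the Dynkin operator is the grading operator, these
traces `τ (U)` satisfy the recursion
`∑ U ≤ X, q ^ ((dim X - dim U).choose 2) * τ (U) = dim X * q ^ ((dim X).choose 2)`, summed over nonzero
symplectic subspaces (`sum_dynkinTrace`). Together with the number of symplectic subspaces of given
dimension (`natCard_symplecticIn_mul`) and an identity of generating functions
(`sum_div_pow_sub_one`) this gives `τ (V) = 2 |Sp (V)| / (q ^ (2 g) - 1)`
(`dynkinTrace_eq_symplecticOrder_div`), and division by `dim V = 2 g` is the claim.
-/

/-! ### Apartment functions on chains of subspaces -/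

noncomputable section ApartmentFunctions

variable {K V : Type*} [Field K] [AddCommGroup V] [Module K V]
variable {ι κ l : Type*}

variable (K V) in
/-- Families of pairwise comparable subspaces of `V`. The index type carries no order: this makes
sums and permutations of index types available without any bookkeeping of positions. -/
abbrev SubspaceChain (ι : Type*) : Type _ :=
  {F : ι → Submodule K V // ∀ i j, F i ≤ F j ∨ F j ≤ F i}

/-- The reindexing of a chain along a map of index types. -/
def SubspaceChain.reindex (F : SubspaceChain K V ι) (u : κ → ι) : SubspaceChain K V κ :=
  ⟨F.1 ∘ u, fun _ _ => F.2 _ _⟩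

/-- The chain `F i ⊓ S`. -/
def SubspaceChain.inf (F : SubspaceChain K V ι) (S : Submodule K V) : SubspaceChain K V ι :=
  ⟨fun i => F.1 i ⊓ S, fun i j => (F.2 i j).imp (inf_le_inf_right S) (inf_le_inf_right S)⟩

open Classical in
/-- The incidence matrix with entry `1` at `(i, j)` if `B j ∈ F i`, and `0` otherwise. -/
def incidence (F : ι → Submodule K V) (B : κ → V) : Matrix ι κ ℚ :=
  Matrix.of fun i j => if B j ∈ F i then 1 else 0

theorem incidence_apply_of_mem {F : ι → Submodule K V} {B : κ → V} {i : ι} {j : κ}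
    (h : B j ∈ F i) : incidence F B i j = 1 := if_pos h

theorem incidence_apply_of_notMem {F : ι → Submodule K V} {B : κ → V} {i : ι} {j : κ}
    (h : B j ∉ F i) : incidence F B i j = 0 := if_neg h

theorem incidence_congr {ι' κ' : Type*} {F : ι → Submodule K V} {B : κ → V}
    {F' : ι' → Submodule K V} {B' : κ' → V} {i : ι} {j : κ} {i' : ι'} {j' : κ'}
    (h : B j ∈ F i ↔ B' j' ∈ F' i') : incidence F B i j = incidence F' B' i' j' := by
  classical
  simp only [incidence, Matrix.of_apply, h]

/-- The apartment function of a family of vectors `B`: the value at a chain `F` is the determinant of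
the incidence matrix of `F` and `B`. If `B` is a basis and `F` is a complete flag, this is the
coefficient of `F` in the apartment of `B`. -/
def frameFun [Fintype ι] [DecidableEq ι] (B : ι → V) : SubspaceChain K V ι → ℚ :=
  fun F => (incidence F.1 B).det

theorem SubspaceChain.inf_eq_of_finrank_eq [FiniteDimensional K V] (F : SubspaceChain K V ι)
    (S : Submodule K V) {i j : ι}
    (h : Module.finrank K ↥(F.1 i ⊓ S) = Module.finrank K ↥(F.1 j ⊓ S)) :
    F.1 i ⊓ S = F.1 j ⊓ S := by
  rcases F.2 i j with hle | hle
  · exact Submodule.eq_of_le_of_finrank_eq (inf_le_inf_right S hle) h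
  · exact (Submodule.eq_of_le_of_finrank_eq (inf_le_inf_right S hle) h.symm).symm

variable [Fintype ι] [DecidableEq ι] [Fintype κ] [DecidableEq κ] [Fintype l] [DecidableEq l]

theorem frameFun_perm (B : ι → V) (F : SubspaceChain K V ι) (σ : Equiv.Perm ι) :
    frameFun B (F.reindex σ) = ((Equiv.Perm.sign σ : ℤ) : ℚ) * frameFun B F :=
  Matrix.det_permute σ (incidence F.1 B)

theorem frameFun_comp_perm (B : ι → V) (σ : Equiv.Perm ι) :
    (frameFun (B ∘ σ) : SubspaceChain K V ι → ℚ) =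
      ((Equiv.Perm.sign σ : ℤ) : ℚ) • frameFun B := by
  funext F
  exact Matrix.det_permute' σ (incidence F.1 B)

theorem frameFun_reindex (B : κ → V) (e : κ ≃ ι) (F : SubspaceChain K V ι) :
    frameFun B (F.reindex e) = frameFun (B ∘ e.symm) F := by
  have := Matrix.det_submatrix_equiv_self e (incidence F.1 (B ∘ e.symm))
  rw [frameFun, frameFun, ← this]
  congr 1
  ext i j
  exact incidence_congr (by simp [SubspaceChain.reindex])

theorem frameFun_inf (B : ι → V) {S : Submodule K V} (hB : ∀ j, B j ∈ S)
    (F : SubspaceChain K V ι) : frameFun B (F.inf S) = frameFun B F := by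
  unfold frameFun
  congr 1
  ext i j
  exact incidence_congr (by simp [SubspaceChain.inf, hB j])

theorem frameFun_eq_zero_of_inf_eq {B : ι → V} {S : Submodule K V} (hB : ∀ j, B j ∈ S)
    {F : SubspaceChain K V ι} {i j : ι} (hij : i ≠ j) (h : F.1 i ⊓ S = F.1 j ⊓ S) :
    frameFun B F = 0 := by
  refine Matrix.det_zero_of_row_eq hij (funext fun k => incidence_congr ?_)
  have h1 : B k ∈ F.1 i ↔ B k ∈ F.1 i ⊓ S := by simp [hB k]
  have h2 : B k ∈ F.1 j ↔ B k ∈ F.1 j ⊓ S := by simp [hB k]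
  rw [h1, h2, h]

theorem frameFun_eq_zero_of_inf_eq_bot {B : ι → V} {S : Submodule K V} (hB : ∀ j, B j ∈ S)
    (hB0 : ∀ j, B j ≠ 0) {F : SubspaceChain K V ι} {i : ι} (h : F.1 i ⊓ S = ⊥) :
    frameFun B F = 0 := by
  refine Matrix.det_eq_zero_of_row_eq_zero i fun k => incidence_apply_of_notMem fun hk => hB0 k ?_
  have : B k ∈ F.1 i ⊓ S := ⟨hk, hB k⟩
  rwa [h, Submodule.mem_bot] at this

/-- A family of nonzero vectors spanning too small a space has zero apartment function: intersecting
a chain with that space produces a zero row or two equal rows. -/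
theorem frameFun_eq_zero_of_finrank_lt [FiniteDimensional K V] {B : ι → V} {S : Submodule K V}
    (hB : ∀ j, B j ∈ S) (hB0 : ∀ j, B j ≠ 0) (hS : Module.finrank K S < Fintype.card ι) :
    (frameFun B : SubspaceChain K V ι → ℚ) = 0 := by
  funext F
  by_cases h0 : ∃ i, F.1 i ⊓ S = ⊥
  · obtain ⟨i, hi⟩ := h0
    exact frameFun_eq_zero_of_inf_eq_bot hB hB0 hi
  · push Not at h0
    obtain ⟨i, -, j, -, hij, h⟩ := Finset.exists_ne_map_eq_of_card_lt_of_maps_to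
      (s := (Finset.univ : Finset ι)) (t := Finset.Icc 1 (Module.finrank K S))
      (f := fun i => Module.finrank K ↥(F.1 i ⊓ S)) (by simpa using hS) (by
        intro i _
        simp only [Finset.coe_Icc, Set.mem_Icc]
        exact ⟨Submodule.one_le_finrank_iff.mpr (h0 i), Submodule.finrank_mono inf_le_right⟩)
    exact frameFun_eq_zero_of_inf_eq hB hij (F.inf_eq_of_finrank_eq S h)

/-! ### The shuffle product -/

/-- The shuffle product of functions on chains: the sum over all ways to distribute the members of a
chain indexed by `κ ⊕ l` to the two factors, with signs. Summing over all permutations counts each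
distribution `|κ|! |l|!` times on alternating functions, which the normalisation removes. -/
def shuffle : (SubspaceChain K V κ → ℚ) →ₗ[ℚ] (SubspaceChain K V l → ℚ) →ₗ[ℚ]
    (SubspaceChain K V (κ ⊕ l) → ℚ) :=
  LinearMap.mk₂ ℚ (fun a h F =>
    (((Fintype.card κ).factorial * (Fintype.card l).factorial : ℕ) : ℚ)⁻¹ *
      ∑ σ : Equiv.Perm (κ ⊕ l), ((Equiv.Perm.sign σ : ℤ) : ℚ) *
        (a (F.reindex (σ ∘ Sum.inl)) * h (F.reindex (σ ∘ Sum.inr))))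
    (by intro a b h; funext F; simp [add_mul, mul_add, Finset.sum_add_distrib])
    (by intro c a h; funext F; simp [Finset.mul_sum, mul_assoc, mul_left_comm])
    (by intro a b h; funext F; simp [mul_add, Finset.sum_add_distrib])
    (by intro c a h; funext F; simp [Finset.mul_sum, mul_left_comm])

theorem shuffle_frameFun (B : κ → V) (C : l → V) :
    shuffle (frameFun B) (frameFun C) =
      (frameFun (Sum.elim B C) : SubspaceChain K V (κ ⊕ l) → ℚ) := by
  funext F
  have key : ∀ (τ : Equiv.Perm κ) (υ : Equiv.Perm l),
      ∑ σ : Equiv.Perm (κ ⊕ l), ((Equiv.Perm.sign σ : ℤ) : ℚ) *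
        ((((Equiv.Perm.sign τ : ℤ) : ℚ) * ∏ j, incidence F.1 B (σ (Sum.inl (τ j))) j) *
        (((Equiv.Perm.sign υ : ℤ) : ℚ) * ∏ j, incidence F.1 C (σ (Sum.inr (υ j))) j)) =
      frameFun (Sum.elim B C) F := by
    intro τ υ
    rw [frameFun, Matrix.det_apply']
    conv_rhs => rw [← Equiv.sum_comp (Equiv.mulRight (Equiv.Perm.sumCongr τ υ))]
    refine Finset.sum_congr rfl fun σ _ => ?_
    rw [Fintype.prod_sum_type, Equiv.coe_mulRight, Equiv.Perm.sign_mul,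
      Equiv.Perm.sign_sumCongr]
    have h1 : ∀ j, incidence F.1 (Sum.elim B C) ((σ * τ.sumCongr υ) (Sum.inl j)) (Sum.inl j) =
        incidence F.1 B (σ (Sum.inl (τ j))) j := fun j => incidence_congr (by simp)
    have h2 : ∀ j, incidence F.1 (Sum.elim B C) ((σ * τ.sumCongr υ) (Sum.inr j)) (Sum.inr j) =
        incidence F.1 C (σ (Sum.inr (υ j))) j := fun j => incidence_congr (by simp)
    simp only [h1, h2]
    push_cast
    ring
  have hB : ∀ σ : Equiv.Perm (κ ⊕ l), frameFun B (F.reindex (σ ∘ Sum.inl)) =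
      ∑ τ : Equiv.Perm κ, ((Equiv.Perm.sign τ : ℤ) : ℚ) *
        ∏ j, incidence F.1 B (σ (Sum.inl (τ j))) j := fun σ => Matrix.det_apply' _
  have hC : ∀ σ : Equiv.Perm (κ ⊕ l), frameFun C (F.reindex (σ ∘ Sum.inr)) =
      ∑ υ : Equiv.Perm l, ((Equiv.Perm.sign υ : ℤ) : ℚ) *
        ∏ j, incidence F.1 C (σ (Sum.inr (υ j))) j := fun σ => Matrix.det_apply' _
  simp only [shuffle, LinearMap.mk₂_apply, hB, hC]
  simp_rw [Finset.sum_mul_sum, Finset.mul_sum]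
  rw [Finset.sum_comm]
  simp_rw [Finset.sum_comm (s := (Finset.univ : Finset (Equiv.Perm (κ ⊕ l))))]
  simp_rw [← Finset.mul_sum, key]
  simp only [Finset.sum_const, Finset.card_univ, Fintype.card_perm, nsmul_eq_mul]
  have h1 : ((Fintype.card κ).factorial : ℚ) ≠ 0 := by positivity
  have h2 : ((Fintype.card l).factorial : ℚ) ≠ 0 := by positivity
  push_cast
  field_simp

/-! ### Contraction along a flag -/

/-- The concatenation of a chain in `S₁` with a chain in the complement `S₂`, made a chain of
subspaces containing `S₁`. -/
def SubspaceChain.join (S₁ S₂ : Submodule K V) (F : SubspaceChain K V κ)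
    (G : SubspaceChain K V l) : SubspaceChain K V (κ ⊕ l) :=
  ⟨Sum.elim (fun i => F.1 i ⊓ S₁) (fun j => S₁ ⊔ (G.1 j ⊓ S₂)), by
    rintro (i | i) (j | j)
    · exact (F.2 i j).imp (inf_le_inf_right _) (inf_le_inf_right _)
    · exact Or.inl (inf_le_right.trans le_sup_left)
    · exact Or.inr (inf_le_right.trans le_sup_left)
    · exact (G.2 i j).imp (fun h => sup_le_sup_left (inf_le_inf_right _ h) _)
        (fun h => sup_le_sup_left (inf_le_inf_right _ h) _)⟩

/-- The contraction along a chain `F` of `S₁`: the residue of a function on chains at the simplex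
`F` of the building, viewed as a function on chains of a complement `S₂` of `S₁`. -/
def contract (S₁ S₂ : Submodule K V) (F : SubspaceChain K V κ) :
    (SubspaceChain K V (κ ⊕ l) → ℚ) →ₗ[ℚ] (SubspaceChain K V l → ℚ) :=
  LinearMap.funLeft ℚ ℚ (SubspaceChain.join S₁ S₂ F)

theorem contract_frameFun {S₁ S₂ : Submodule K V} (hS : Disjoint S₁ S₂)
    (F : SubspaceChain K V κ) {B : κ ⊕ l → V} {C : l → V} (h1 : ∀ i, B (Sum.inl i) ∈ S₁)
    (h2 : ∀ j, B (Sum.inr j) ∉ S₁) (hC : ∀ j, C j ∈ S₂) (hBC : ∀ j, B (Sum.inr j) - C j ∈ S₁) :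
    contract S₁ S₂ F (frameFun B) = frameFun (fun i => B (Sum.inl i)) F • frameFun C := by
  funext G
  have hM : incidence (SubspaceChain.join S₁ S₂ F G).1 B =
      Matrix.fromBlocks (incidence F.1 fun i => B (Sum.inl i)) 0
        (incidence (fun j : l => S₁ ⊔ (G.1 j ⊓ S₂)) fun i => B (Sum.inl i))
        (incidence G.1 C) := by
    ext (i | i) (j | j)
    · exact incidence_congr (by simp [SubspaceChain.join, h1])
    · exact incidence_apply_of_notMem fun h => h2 j h.2
    · exact incidence_congr (by simp [SubspaceChain.join])
    · refine incidence_congr ?_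
      simp only [SubspaceChain.join, Sum.elim_inr]
      have e : B (Sum.inr j) = (B (Sum.inr j) - C j) + C j := by abel
      constructor
      · intro h
        obtain ⟨s, hs, t, ht, hst⟩ := Submodule.mem_sup.mp h
        have h3 : C j - t ∈ S₁ ⊓ S₂ := by
          refine ⟨?_, S₂.sub_mem (hC j) ht.2⟩
          have : C j - t = s - (B (Sum.inr j) - C j) := by rw [← hst]; abel
          rw [this]
          exact S₁.sub_mem hs (hBC j)
        rw [hS.eq_bot, Submodule.mem_bot, sub_eq_zero] at h3
        rw [h3]
        exact ht.1
      · intro h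
        rw [e]
        exact Submodule.add_mem_sup (hBC j) ⟨h, hC j⟩
  simp only [contract, LinearMap.funLeft_apply, frameFun, hM, Matrix.det_fromBlocks_zero₁₂,
    Pi.smul_apply, smul_eq_mul]

open Classical in
theorem contract_frameFun_eq_zero {S₁ S₂ : Submodule K V} (F : SubspaceChain K V κ)
    {B : κ ⊕ l → V} (hB : (Finset.univ.filter fun j => B j ∈ S₁).card < Fintype.card κ) :
    contract S₁ S₂ F (frameFun B) = 0 := by
  funext G
  change (incidence (SubspaceChain.join S₁ S₂ F G).1 B).det = 0
  rw [← Matrix.det_transpose, Matrix.det_apply']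
  refine Finset.sum_eq_zero fun σ _ => mul_eq_zero_of_right _ ?_
  obtain ⟨i, hi⟩ : ∃ i : κ, B (σ (Sum.inl i)) ∉ S₁ := by
    by_contra! h
    refine hB.not_ge ?_
    rw [← Finset.card_univ]
    exact Finset.card_le_card_of_injOn (fun i => σ (Sum.inl i)) (by simp [h])
      (fun a _ b _ hab => by simpa using hab)
  refine Finset.prod_eq_zero (Finset.mem_univ (Sum.inl i)) ?_
  exact incidence_apply_of_notMem fun h => hi h.2

/-! ### The span of the apartment functions of a subspace -/

variable (ι) in
/-- The span of the apartment functions of the frames of `S`. If the dimension of `S` is the size of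
the index type, this is a model for the Steinberg module of `S`. -/
def frameSpan (S : Submodule K V) : Submodule ℚ (SubspaceChain K V ι → ℚ) :=
  Submodule.span ℚ {f | ∃ B : ι → V, LinearIndependent K B ∧ (∀ j, B j ∈ S) ∧ f = frameFun B}

theorem frameFun_mem_frameSpan {S : Submodule K V} {B : ι → V} (hB : LinearIndependent K B)
    (hS : ∀ j, B j ∈ S) : frameFun B ∈ frameSpan ι S :=
  Submodule.subset_span ⟨B, hB, hS, rfl⟩

/-- Linear maps agreeing on apartment functions agree on their span. -/
theorem eqOn_frameSpan {M : Type*} [AddCommGroup M] [Module ℚ M] {S : Submodule K V}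
    {f g : (SubspaceChain K V ι → ℚ) →ₗ[ℚ] M}
    (h : ∀ B : ι → V, LinearIndependent K B → (∀ j, B j ∈ S) → f (frameFun B) = g (frameFun B))
    {x : SubspaceChain K V ι → ℚ} (hx : x ∈ frameSpan ι S) : f x = g x := by
  refine LinearMap.eqOn_span (s := {f | ∃ B : ι → V, LinearIndependent K B ∧ (∀ j, B j ∈ S) ∧
    f = frameFun B}) ?_ hx
  rintro _ ⟨B, hB, hS, rfl⟩
  exact h B hB hS

theorem map_mem_of_frameSpan {M : Type*} [AddCommGroup M] [Module ℚ M] {S : Submodule K V}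
    {f : (SubspaceChain K V ι → ℚ) →ₗ[ℚ] M} {N : Submodule ℚ M}
    (h : ∀ B : ι → V, LinearIndependent K B → (∀ j, B j ∈ S) → f (frameFun B) ∈ N)
    {x : SubspaceChain K V ι → ℚ} (hx : x ∈ frameSpan ι S) : f x ∈ N := by
  have : frameSpan ι S ≤ N.comap f := Submodule.span_le.mpr (by
    rintro _ ⟨B, hB, hS, rfl⟩
    exact h B hB hS)
  exact this hx

end ApartmentFunctions

/-! ### Cycles on complete flags -/

noncomputable section FlagCycles

open Module

variable {K V : Type*} [Field K] [AddCommGroup V] [Module K V]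

/-- The complete flags of `S`, without the zero subspace: the `i`-th member has dimension `i + 1`. -/
def IsFullFlag (S : Submodule K V) {n : ℕ} (F : Fin n → Submodule K V) : Prop :=
  Monotone F ∧ (∀ i, finrank K (F i) = i + 1) ∧ ∀ i, F i ≤ S

open Classical in
/-- The apartment function of `B` as a function on complete flags of `S`. -/
def flagFun (S : Submodule K V) {n : ℕ} (B : Fin n → V) : (Fin n → Submodule K V) → ℚ :=
  fun F => if IsFullFlag S F then (incidence F B).det else 0

theorem flagFun_of_isFullFlag {S : Submodule K V} {n : ℕ} (B : Fin n → V)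
    {F : Fin n → Submodule K V} (hF : IsFullFlag S F) : flagFun S B F = (incidence F B).det :=
  if_pos hF

theorem flagFun_of_not {S : Submodule K V} {n : ℕ} (B : Fin n → V)
    {F : Fin n → Submodule K V} (hF : ¬ IsFullFlag S F) : flagFun S B F = 0 :=
  if_neg hF

/-- The member of a flag preceding the `i`-th one, which is zero for `i = 0`. -/
def flagPred {n : ℕ} (F : Fin n → Submodule K V) (i : Fin n) : Submodule K V :=
  if (i : ℕ) = 0 then ⊥ else F ⟨i - 1, by omega⟩

theorem flagPred_of_eq_zero {n : ℕ} (F : Fin n → Submodule K V) {i : Fin n} (h : (i : ℕ) = 0) :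
    flagPred F i = ⊥ := if_pos h

theorem flagPred_of_ne_zero {n : ℕ} (F : Fin n → Submodule K V) {i : Fin n} (h : (i : ℕ) ≠ 0) :
    flagPred F i = F ⟨i - 1, by omega⟩ := if_neg h

theorem IsFullFlag.finrank_flagPred {S : Submodule K V} {n : ℕ} {F : Fin n → Submodule K V}
    (hF : IsFullFlag S F) (i : Fin n) : finrank K (flagPred F i) = i := by
  by_cases h : (i : ℕ) = 0
  · rw [flagPred_of_eq_zero F h, finrank_bot, h]
  · rw [flagPred_of_ne_zero F h, hF.2.1]
    exact Nat.succ_pred h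

theorem IsFullFlag.flagPred_le {S : Submodule K V} {n : ℕ} {F : Fin n → Submodule K V}
    (hF : IsFullFlag S F) {i j : Fin n} (hij : i ≤ j) : flagPred F i ≤ F j := by
  unfold flagPred
  split_ifs with h
  · exact bot_le
  · exact hF.1 (by rw [Fin.le_def] at hij ⊢; simp only; omega)

theorem IsFullFlag.le_flagPred {S : Submodule K V} {n : ℕ} {F : Fin n → Submodule K V}
    (hF : IsFullFlag S F) {i j : Fin n} (hij : j < i) : F j ≤ flagPred F i := by
  unfold flagPred
  split_ifs with h
  · rw [Fin.lt_def] at hij; omega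
  · exact hF.1 (by rw [Fin.lt_def] at hij; rw [Fin.le_def]; simp only; omega)

theorem IsFullFlag.update_iff {S : Submodule K V} {n : ℕ} {F : Fin n → Submodule K V}
    (hF : IsFullFlag S F) {i k : Fin n} (hk : (i : ℕ) + 1 = k) (W : Submodule K V) :
    IsFullFlag S (Function.update F i W) ↔
      finrank K W = i + 1 ∧ flagPred F i ≤ W ∧ W ≤ F k := by
  have hik : i < k := by rw [Fin.lt_def]; omega
  constructor
  · intro h
    refine ⟨by rw [← h.2.1 i, Function.update_self], ?_, ?_⟩
    · have h1 := h.flagPred_le (le_refl i)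
      rw [Function.update_self] at h1
      refine le_trans (le_of_eq ?_) h1
      unfold flagPred
      split_ifs with h0
      · rfl
      · rw [Function.update_of_ne]
        rw [Ne, Fin.ext_iff]; simp only; omega
    · simpa [Function.update_of_ne hik.ne'] using h.1 hik.le
  · rintro ⟨h1, h2, h3⟩
    refine ⟨fun a b hab => ?_, fun a => ?_, fun a => ?_⟩
    · by_cases ha : a = i <;> by_cases hb : b = i
      · rw [ha, hb]
      · subst ha
        rw [Function.update_self, Function.update_of_ne hb]
        refine h3.trans (hF.1 ?_)
        rw [Fin.le_def] at hab ⊢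
        have := Fin.val_ne_of_ne hb
        omega
      · subst hb
        rw [Function.update_self, Function.update_of_ne ha]
        exact (hF.le_flagPred (lt_of_le_of_ne hab ha)).trans h2
      · rw [Function.update_of_ne ha, Function.update_of_ne hb]
        exact hF.1 hab
    · rcases eq_or_ne a i with rfl | ha
      · rwa [Function.update_self]
      · rw [Function.update_of_ne ha, hF.2.1]
    · rcases eq_or_ne a i with rfl | ha
      · rw [Function.update_self]
        exact h3.trans (hF.2.2 k)
      · rw [Function.update_of_ne ha]
        exact hF.2.2 a

variable [Finite V]

instance : Fintype (Submodule K V) := Fintype.ofFinite _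

/-- The functions on complete flags of `S` whose sum over each panel vanishes. If `S` has dimension
`n`, these are the top-dimensional cycles of the building of `S`. -/
def flagCycles (S : Submodule K V) (n : ℕ) : Submodule ℚ ((Fin n → Submodule K V) → ℚ) where
  carrier := {f | (∀ F, ¬ IsFullFlag S F → f F = 0) ∧ ∀ F, IsFullFlag S F → ∀ i : Fin n,
    (i : ℕ) + 1 < n → ∑ W, f (Function.update F i W) = 0}
  zero_mem' := by simp
  add_mem' := by
    rintro f g ⟨hf, hf'⟩ ⟨hg, hg'⟩
    refine ⟨fun F hF => by simp [hf F hF, hg F hF], fun F hF i hi => ?_⟩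
    simp [Finset.sum_add_distrib, hf' F hF i hi, hg' F hF i hi]
  smul_mem' := by
    rintro c f ⟨hf, hf'⟩
    refine ⟨fun F hF => by simp [hf F hF], fun F hF i hi => ?_⟩
    simp [← Finset.mul_sum, hf' F hF i hi]

theorem eq_sup_span_singleton_of_finrank {A W : Submodule K V} {b : V} (hAW : A ≤ W)
    (hW : finrank K W = finrank K A + 1) (hbW : b ∈ W) (hbA : b ∉ A) :
    A ⊔ Submodule.span K {b} = W := by
  refine Submodule.eq_of_le_of_finrank_le
    (sup_le hAW ((Submodule.span_singleton_le_iff_mem _ _).mpr hbW)) ?_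
  rw [hW]
  refine Submodule.finrank_lt_finrank_of_lt (lt_of_le_of_ne le_sup_left fun h => hbA ?_)
  rw [h]
  exact Submodule.mem_sup_right (Submodule.mem_span_singleton_self b)

theorem finrank_sup_span_singleton {A : Submodule K V} {b : V} (hbA : b ∉ A) :
    finrank K ↥(A ⊔ Submodule.span K {b}) = finrank K A + 1 := by
  apply le_antisymm
  · refine (Submodule.finrank_add_le_finrank_add_finrank _ _).trans ?_
    exact Nat.add_le_add_left (finrank_span_le_card (R := K) ({b} : Set V) |>.trans (by simp)) _
  · refine Submodule.finrank_lt_finrank_of_lt (lt_of_le_of_ne le_sup_left fun h => hbA ?_)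
    rw [h]
    exact Submodule.mem_sup_right (Submodule.mem_span_singleton_self b)

open Classical in
/-- Summing the incidence rows over a panel gives a combination of the two neighbouring rows: a
vector of the lower neighbour lies in all subspaces of the panel, and a further vector of the upper
neighbour in exactly one. -/
theorem sum_incidence_panel (A C : Submodule K V) (k : ℕ) (hA : finrank K A = k)
    (hAC : A ≤ C) (b : V) :
    (∑ W ∈ Finset.univ.filter fun W : Submodule K V => finrank K W = k + 1 ∧ A ≤ W ∧ W ≤ C,
      (if b ∈ W then 1 else 0 : ℚ)) =
      (((Finset.univ.filter fun W : Submodule K V =>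
        finrank K W = k + 1 ∧ A ≤ W ∧ W ≤ C).card : ℚ) - 1) * (if b ∈ A then 1 else 0) +
      (if b ∈ C then 1 else 0) := by
  by_cases hbA : b ∈ A
  · rw [if_pos hbA, if_pos (hAC hbA), Finset.sum_congr rfl fun W hW =>
      if_pos ((Finset.mem_filter.mp hW).2.2.1 hbA)]
    simp
  · rw [if_neg hbA, mul_zero, zero_add]
    by_cases hbC : b ∈ C
    · rw [if_pos hbC, Finset.sum_eq_single (A ⊔ Submodule.span K {b})]
      · exact if_pos (Submodule.mem_sup_right (Submodule.mem_span_singleton_self b))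
      · intro W hW hne
        obtain ⟨h1, h2, -⟩ := (Finset.mem_filter.mp hW).2
        refine if_neg fun hb => hne ?_
        exact (eq_sup_span_singleton_of_finrank h2 (by rw [h1, hA]) hb hbA).symm
      · intro h
        refine absurd (Finset.mem_filter.mpr ⟨Finset.mem_univ _, ?_, le_sup_left, ?_⟩) h
        · rw [finrank_sup_span_singleton hbA, hA]
        · exact sup_le hAC ((Submodule.span_singleton_le_iff_mem _ _).mpr hbC)
    · rw [if_neg hbC]
      exact Finset.sum_eq_zero fun W hW =>
        if_neg fun hb => hbC ((Finset.mem_filter.mp hW).2.2.2 hb)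

theorem flagFun_mem_flagCycles (S : Submodule K V) {n : ℕ} {B : Fin n → V} (hB : ∀ j, B j ≠ 0) :
    flagFun S B ∈ flagCycles S n := by
  classical
  refine ⟨fun F hF => flagFun_of_not B hF, fun F hF i hi => ?_⟩
  let k : Fin n := ⟨i + 1, hi⟩
  set M := incidence F B
  have hrow : ∀ W, incidence (Function.update F i W) B =
      M.updateRow i (fun j => if B j ∈ W then 1 else 0) := by
    intro W
    ext a j
    rcases eq_or_ne a i with rfl | ha
    · simp [incidence]
    · rw [Matrix.updateRow_ne ha]
      exact incidence_congr (by rw [Function.update_of_ne ha])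
  have h1 : ∀ W, flagFun S B (Function.update F i W) =
      if finrank K W = i + 1 ∧ flagPred F i ≤ W ∧ W ≤ F k then
        M.transpose.cramer (fun j => if B j ∈ W then 1 else 0) i else 0 := by
    intro W
    rw [Matrix.cramer_transpose_apply, ← hrow, flagFun]
    exact if_congr (hF.update_iff (k := k) rfl W) rfl rfl
  simp_rw [h1]
  rw [← Finset.sum_filter, ← Finset.sum_apply, ← map_sum]
  have hik : i < k := by rw [Fin.lt_def]; simp [k]
  have h2 : (∑ W ∈ Finset.univ.filter fun W : Submodule K V =>
        finrank K W = i + 1 ∧ flagPred F i ≤ W ∧ W ≤ F k, fun j => (if B j ∈ W then 1 else 0 : ℚ)) =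
      (((Finset.univ.filter fun W : Submodule K V =>
        finrank K W = i + 1 ∧ flagPred F i ≤ W ∧ W ≤ F k).card : ℚ) - 1) •
        (fun j => if B j ∈ flagPred F i then 1 else 0) + M k := by
    funext j
    rw [Finset.sum_apply, sum_incidence_panel _ _ _ (hF.finrank_flagPred i)
      (hF.flagPred_le hik.le)]
    rfl
  rw [h2, map_add, map_smul, Pi.add_apply, Pi.smul_apply, Matrix.cramer_transpose_apply,
    Matrix.cramer_transpose_apply, Matrix.det_updateRow_eq_zero hik.ne']
  rcases eq_or_ne (i : ℕ) 0 with h0 | h0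
  · have : (fun j => if B j ∈ flagPred F i then (1 : ℚ) else 0) = 0 := by
      funext j
      simp [flagPred, h0, hB j]
    rw [this, Matrix.det_eq_zero_of_row_eq_zero i (by simp)]
    simp
  · have : (fun j => if B j ∈ flagPred F i then (1 : ℚ) else 0) = M ⟨i - 1, by omega⟩ := by
      funext j
      simp [flagPred, h0, M, incidence]
    rw [this, Matrix.det_updateRow_eq_zero]
    · simp
    · rw [Ne, Fin.ext_iff]; simp only; omega

/-- A cycle is determined by its values on the flags whose hyperplane avoids a given nonzero vector:
if `F i` is the first member containing the vector, all other flags in the `i`-th panel contain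
it only later. -/
theorem flagCycles_eq_zero {S : Submodule K V} {n : ℕ} {f : (Fin n → Submodule K V) → ℚ}
    (hf : f ∈ flagCycles S n) {v : V} (hv : v ≠ 0)
    (h : ∀ F, IsFullFlag S F → (∀ i : Fin n, (i : ℕ) + 1 < n → v ∉ F i) → f F = 0) : f = 0 := by
  classical
  -- descending induction on the index of the first member that contains `v`
  have key : ∀ t : ℕ, ∀ F, IsFullFlag S F → (∀ i : Fin n, (i : ℕ) + 1 + t < n → v ∉ F i) →
      f F = 0 := by
    intro t
    induction t with
    | zero => exact h
    | succ t ih =>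
      intro F hF hv'
      by_cases hex : ∃ i : Fin n, (i : ℕ) + 1 + t + 1 = n ∧ v ∈ F i
      · obtain ⟨i, hi, hvi⟩ := hex
        have h1 := hf.2 F hF i (by omega)
        rw [← Finset.add_sum_erase _ _ (Finset.mem_univ (F i)), Function.update_eq_self,
          Finset.sum_eq_zero, add_zero] at h1
        · exact h1
        · intro W hW
          by_cases hfull : IsFullFlag S (Function.update F i W)
          · refine ih _ hfull fun j hj => ?_
            rcases eq_or_ne j i with rfl | hji
            · rw [Function.update_self]
              intro hvW
              obtain ⟨h2, h3, -⟩ := (hF.update_iff (k := ⟨j + 1, by omega⟩) rfl W).mp hfull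
              have h4 : v ∉ flagPred F j := by
                unfold flagPred
                split_ifs with h0
                · simpa using hv
                · exact hv' _ (by simp only; omega)
              refine Finset.ne_of_mem_erase hW ?_
              rw [← eq_sup_span_singleton_of_finrank h3
                (by rw [h2, hF.finrank_flagPred]) hvW h4]
              exact eq_sup_span_singleton_of_finrank (hF.flagPred_le le_rfl)
                (by rw [hF.2.1, hF.finrank_flagPred]) hvi h4
            · rw [Function.update_of_ne hji]
              refine hv' j ?_
              have := Fin.val_ne_of_ne hji
              omega
          · exact hf.1 _ hfull
      · push Not at hex
        refine ih F hF fun i hi => ?_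
        by_cases h1 : (i : ℕ) + 1 + t + 1 = n
        · exact hex i h1
        · exact hv' i (by omega)
  funext F
  by_cases hF : IsFullFlag S F
  · exact key n F hF fun i hi => absurd hi (by omega)
  · exact hf.1 F hF

end FlagCycles

/-! ### The dimension of the space of cycles and its generation by apartments -/

noncomputable section SolomonTits

open Module

section Counting

variable {K M : Type*} [Field K] [AddCommGroup M] [Module K M] [Finite M]

theorem natCard_setOf_dual_eq_one {n : ℕ} (hM : finrank K M = n + 1) {φ : Dual K M} (hφ : φ ≠ 0) :
    Nat.card {x : M // φ x = 1} = Nat.card K ^ n := by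
  obtain ⟨y, hy⟩ : ∃ y, φ y ≠ 0 := by
    by_contra! h
    exact hφ (LinearMap.ext h)
  have hx : φ ((φ y)⁻¹ • y) = 1 := by simp [hy]
  set x := (φ y)⁻¹ • y
  have e : {x : M // φ x = 1} ≃ LinearMap.ker φ :=
    { toFun := fun z => ⟨z.1 - x, by simp [z.2, hx]⟩
      invFun := fun z => ⟨z.1 + x, by simp [hx]⟩
      left_inv := fun z => by simp
      right_inv := fun z => by simp }
  rw [Nat.card_congr e, natCard_eq_pow_finrank (K := K)]
  congr 1
  have := Dual.finrank_ker_add_one_of_ne_zero hφ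
  omega

end Counting

variable {K V : Type*} [Field K] [AddCommGroup V] [Module K V]

theorem IsFullFlag.snoc {H S : Submodule K V} {n : ℕ} {F : Fin n → Submodule K V}
    (hF : IsFullFlag H F) (hHS : H ≤ S) (hS : finrank K S = n + 1) :
    IsFullFlag S (Fin.snoc F S : Fin (n + 1) → Submodule K V) := by
  have h : ∀ i, (Fin.snoc F S : Fin (n + 1) → Submodule K V) i ≤ S := by
    intro i
    induction i using Fin.lastCases with
    | last => simp
    | cast i => simpa using (hF.2.2 i).trans hHS
  refine ⟨fun a b hab => ?_, fun a => ?_, h⟩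
  · induction b using Fin.lastCases with
    | last => simpa using h a
    | cast b =>
      induction a using Fin.lastCases with
      | last => exact absurd hab (Fin.castSucc_lt_last b).not_ge
      | cast a => simpa using hF.1 (by simpa using hab)
  · induction a using Fin.lastCases with
    | last => rw [Fin.snoc_last]; simpa using hS
    | cast a => rw [Fin.snoc_castSucc]; simpa using hF.2.1 a

open Classical in
/-- The restriction of a function on flags of `S` to the flags whose hyperplane is `H`. -/
def hyperplaneRes (H S : Submodule K V) (n : ℕ) :
    ((Fin (n + 1) → Submodule K V) → ℚ) →ₗ[ℚ] ((Fin n → Submodule K V) → ℚ) where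
  toFun f F := if IsFullFlag H F then f (Fin.snoc F S : Fin (n + 1) → Submodule K V) else 0
  map_add' f g := by
    funext F
    simp only [Pi.add_apply]
    split_ifs <;> simp
  map_smul' c f := by
    funext F
    simp

theorem hyperplaneRes_of_isFullFlag {H S : Submodule K V} {n : ℕ}
    (f : (Fin (n + 1) → Submodule K V) → ℚ) {F : Fin n → Submodule K V} (hF : IsFullFlag H F) :
    hyperplaneRes H S n f F = f (Fin.snoc F S : Fin (n + 1) → Submodule K V) := if_pos hF

open Classical in
/-- The restriction of a function on chains to the complete flags of `S`. -/
def flagRes (S : Submodule K V) (n : ℕ) :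
    (SubspaceChain K V (Fin n) → ℚ) →ₗ[ℚ] ((Fin n → Submodule K V) → ℚ) where
  toFun f F := if h : IsFullFlag S F then
    f ⟨F, fun i j => (le_total i j).imp (fun hij => h.1 hij) (fun hij => h.1 hij)⟩ else 0
  map_add' f g := by
    funext F
    simp only [Pi.add_apply]
    split_ifs <;> simp
  map_smul' c f := by
    funext F
    simp

theorem flagRes_frameFun (S : Submodule K V) {n : ℕ} (B : Fin n → V) :
    flagRes S n (frameFun B) = flagFun S B := by
  funext F
  by_cases hF : IsFullFlag S F
  · rw [flagFun_of_isFullFlag _ hF]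
    exact dif_pos hF
  · rw [flagFun_of_not _ hF]
    exact dif_neg hF

/-- The apartment functions of the bases of `S` on complete flags. -/
def flagFuns (S : Submodule K V) (n : ℕ) : Set ((Fin n → Submodule K V) → ℚ) :=
  {f | ∃ B : Fin n → V, LinearIndependent K B ∧ (∀ j, B j ∈ S) ∧ f = flagFun S B}

theorem map_flagRes_frameSpan (S : Submodule K V) (n : ℕ) :
    (frameSpan (Fin n) S).map (flagRes S n) = Submodule.span ℚ (flagFuns S n) := by
  rw [frameSpan, Submodule.map_span]
  congr 1
  ext f
  constructor
  · rintro ⟨_, ⟨B, hB, hBS, rfl⟩, rfl⟩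
    exact ⟨B, hB, hBS, flagRes_frameFun S B⟩
  · rintro ⟨B, hB, hBS, rfl⟩
    exact ⟨_, ⟨B, hB, hBS, rfl⟩, flagRes_frameFun S B⟩

variable [Finite V]

/-- The hyperplanes of `S` (of dimension `n`) that do not contain `v`. -/
abbrev AvoidingHyperplane (S : Submodule K V) (v : V) (n : ℕ) : Type _ :=
  {H : Submodule K V // H ≤ S ∧ finrank K H = n ∧ v ∉ H}

/-- Hyperplanes avoiding `v` are the kernels of the functionals with value `1` at `v`. -/
theorem natCard_avoidingHyperplane [Finite K] {S : Submodule K V} {n : ℕ} (hS : finrank K S = n + 1) {v : V}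
    (hv : v ≠ 0) (hvS : v ∈ S) : Nat.card (AvoidingHyperplane S v n) = Nat.card K ^ n := by
  have hv' : (⟨v, hvS⟩ : S) ≠ 0 := fun h => hv (congrArg Subtype.val h)
  have h1 : Dual.eval K S ⟨v, hvS⟩ ≠ 0 := by
    rw [Ne, eval_apply_eq_zero_iff]
    exact hv'
  have h2 : finrank K (Dual K S) = n + 1 := by rw [Subspace.dual_finrank_eq, hS]
  have : Finite (Dual K S) := Module.finite_of_finite K
  rw [← natCard_setOf_dual_eq_one h2 h1]
  symm
  have hker : ∀ φ : {φ : Dual K S // Dual.eval K S ⟨v, hvS⟩ φ = 1},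
      finrank K (LinearMap.ker φ.1) = n := by
    intro φ
    have h3 : φ.1 ≠ 0 := by
      intro h
      have := φ.2
      rw [h] at this
      simp at this
    have := Dual.finrank_ker_add_one_of_ne_zero h3
    omega
  let g : {φ : Dual K S // Dual.eval K S ⟨v, hvS⟩ φ = 1} → AvoidingHyperplane S v n := fun φ =>
    ⟨(LinearMap.ker φ.1).map S.subtype, Submodule.map_subtype_le _ _, by
      rw [← hker φ]
      exact Submodule.finrank_map_subtype_eq S _, by
      rintro ⟨x, hx, hxv⟩
      have : x = ⟨v, hvS⟩ := Subtype.ext hxv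
      subst this
      have h4 : φ.1 ⟨v, hvS⟩ = 1 := φ.2
      have h5 : φ.1 ⟨v, hvS⟩ = 0 := hx
      rw [h4] at h5
      exact one_ne_zero h5⟩
  refine Nat.card_congr (Equiv.ofBijective g ⟨fun φ ψ h => ?_, fun H => ?_⟩)
  · have h3 : LinearMap.ker φ.1 = LinearMap.ker ψ.1 :=
      Submodule.map_injective_of_injective (Submodule.injective_subtype S) (congrArg Subtype.val h)
    refine Subtype.ext (LinearMap.ext fun x => ?_)
    have h4 : φ.1 ⟨v, hvS⟩ = 1 := φ.2
    have h5 : ψ.1 ⟨v, hvS⟩ = 1 := ψ.2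
    have h6 : x - φ.1 x • ⟨v, hvS⟩ ∈ LinearMap.ker φ.1 := by
      rw [LinearMap.mem_ker, map_sub, map_smul, h4, smul_eq_mul, mul_one, sub_self]
    rw [h3, LinearMap.mem_ker, map_sub, map_smul, h5, smul_eq_mul, mul_one, sub_eq_zero] at h6
    exact h6.symm
  · obtain ⟨H, hHS, hH, hvH⟩ := H
    have h3 : (⟨v, hvS⟩ : S) ∉ H.submoduleOf S := hvH
    obtain ⟨f, hf, hf'⟩ := Submodule.exists_dual_map_eq_bot_of_notMem h3 inferInstance
    refine ⟨⟨(f ⟨v, hvS⟩)⁻¹ • f, by simp [hf]⟩, Subtype.ext ?_⟩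
    have h4 := hker ⟨(f ⟨v, hvS⟩)⁻¹ • f, by simp [hf]⟩
    symm
    refine Submodule.eq_of_le_of_finrank_eq (fun x hx => ?_) ?_
    · refine ⟨⟨x, hHS hx⟩, ?_, rfl⟩
      have : f ⟨x, hHS hx⟩ ∈ Submodule.map f (H.submoduleOf S) := ⟨_, hx, rfl⟩
      rw [hf'] at this
      simp only [Submodule.mem_bot] at this
      simp [this]
    · exact hH.trans (h4.symm.trans (Submodule.finrank_map_subtype_eq S _).symm)

theorem IsFullFlag.eq_of_finrank {S : Submodule K V} {n : ℕ} {F : Fin n → Submodule K V}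
    (hF : IsFullFlag S F) (hS : finrank K S = n) {i : Fin n} (hi : (i : ℕ) + 1 = n) : F i = S :=
  Submodule.eq_of_le_of_finrank_eq (hF.2.2 i) (by rw [hF.2.1, hS, hi])

theorem hyperplaneRes_mem {H S : Submodule K V} {n : ℕ} (hHS : H ≤ S) (hS : finrank K S = n + 1)
    {f : (Fin (n + 1) → Submodule K V) → ℚ} (hf : f ∈ flagCycles S (n + 1)) :
    hyperplaneRes H S n f ∈ flagCycles H n := by
  refine ⟨fun F hF => if_neg hF, fun F hF i hi => ?_⟩
  have hF' := hF.snoc hHS hS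
  rw [← hf.2 _ hF' i.castSucc (by simp only [Fin.val_castSucc]; omega)]
  refine Finset.sum_congr rfl fun W _ => ?_
  rw [← Fin.snoc_update]
  by_cases hW : IsFullFlag H (Function.update F i W)
  · rw [hyperplaneRes_of_isFullFlag _ hW]
  · rw [hf.1 _ fun h => hW ?_]
    · exact if_neg hW
    · rw [Fin.snoc_update, hF'.update_iff (k := (⟨i + 1, hi⟩ : Fin n).castSucc) (by simp)] at h
      rw [hF.update_iff (k := ⟨i + 1, hi⟩) rfl]
      refine ⟨by simpa using h.1, ?_, by simpa [-Fin.castSucc_mk] using h.2.2⟩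
      refine le_trans (le_of_eq ?_) h.2.1
      by_cases h0 : (i : ℕ) = 0
      · rw [flagPred_of_eq_zero _ h0, flagPred_of_eq_zero _ (by simpa using h0)]
      · rw [flagPred_of_ne_zero _ h0, flagPred_of_ne_zero _ (by simpa using h0)]
        have : (⟨(i.castSucc : ℕ) - 1, by omega⟩ : Fin (n + 1)) =
          (⟨i - 1, by omega⟩ : Fin n).castSucc := rfl
        rw [this, Fin.snoc_castSucc]

/-- The apartment of a basis of `H` and a further vector `v` restricts to the apartment of the basis
at `H`, and to zero at all other hyperplanes avoiding `v`. -/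
theorem hyperplaneRes_flagFun {H H' S : Submodule K V} {n : ℕ} (hS : finrank K S = n + 1)
    (hH : finrank K H = n) (hH' : finrank K H' = n) (hH'S : H' ≤ S) {v : V} (hvS : v ∈ S)
    (hvH' : v ∉ H') {B : Fin n → V} (hB : LinearIndependent K B) (hBH : ∀ j, B j ∈ H) :
    hyperplaneRes H' S n (flagFun S (Fin.snoc B v : Fin (n + 1) → V)) =
      if H' = H then flagFun H B else 0 := by
  funext F
  by_cases hF : IsFullFlag H' F
  swap
  · rw [show hyperplaneRes H' S n (flagFun S (Fin.snoc B v : Fin (n + 1) → V)) F = 0 from if_neg hF]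
    split_ifs with h
    · rw [flagFun_of_not]
      rwa [← h]
    · rfl
  rw [hyperplaneRes_of_isFullFlag _ hF, flagFun_of_isFullFlag _ (hF.snoc hH'S hS),
    Matrix.det_succ_column _ (Fin.last n), Finset.sum_eq_single (Fin.last n)]
  · have h1 : incidence (Fin.snoc F S : Fin (n + 1) → Submodule K V) (Fin.snoc B v) (Fin.last n)
        (Fin.last n) = 1 := incidence_apply_of_mem (by simpa using hvS)
    have h2 : ((incidence (Fin.snoc F S : Fin (n + 1) → Submodule K V)
        (Fin.snoc B v : Fin (n + 1) → V)).submatrix (Fin.last n).succAbove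
        (Fin.last n).succAbove) = incidence F B := by
      ext a b
      exact incidence_congr (by simp)
    rw [h1, h2, mul_one, Even.neg_one_pow ⟨_, rfl⟩, one_mul]
    split_ifs with h
    · rw [flagFun_of_isFullFlag]
      rwa [← h]
    · obtain ⟨j, hj⟩ : ∃ j, B j ∉ H' := by
        by_contra! hall
        refine h ?_
        have h3 : Submodule.span K (Set.range B) ≤ H' ⊓ H :=
          Submodule.span_le.mpr (by rintro _ ⟨j, rfl⟩; exact ⟨hall j, hBH j⟩)
        have h4 : finrank K (Submodule.span K (Set.range B)) = n := by
          rw [finrank_span_eq_card hB, Fintype.card_fin]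
        exact (Submodule.eq_of_le_of_finrank_eq (h3.trans inf_le_left) (by rw [h4, hH'])).symm.trans
          (Submodule.eq_of_le_of_finrank_eq (h3.trans inf_le_right) (by rw [h4, hH]))
      rw [Pi.zero_apply]
      exact Matrix.det_eq_zero_of_column_eq_zero j fun i =>
        incidence_apply_of_notMem fun hi => hj (hF.2.2 i hi)
  · intro i _ hi
    obtain ⟨i, rfl⟩ := Fin.exists_castSucc_eq.mpr hi
    rw [incidence_apply_of_notMem (by simpa using fun h => hvH' (hF.2.2 i h))]
    simp
  · simp

theorem span_flagFuns_le (S : Submodule K V) (n : ℕ) :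
    Submodule.span ℚ (flagFuns S n) ≤ flagCycles S n :=
  Submodule.span_le.mpr (by
    rintro _ ⟨B, hB, -, rfl⟩
    exact flagFun_mem_flagCycles S hB.ne_zero)

theorem eq_zero_of_hyperplaneRes {S : Submodule K V} {n : ℕ} (hS : finrank K S = n + 1) {v : V}
    (hv : v ≠ 0) {f : (Fin (n + 1) → Submodule K V) → ℚ} (hf : f ∈ flagCycles S (n + 1))
    (h : ∀ H : AvoidingHyperplane S v n, hyperplaneRes H.1 S n f = 0) : f = 0 := by
  refine flagCycles_eq_zero hf hv fun F hF hvF => ?_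
  have hlast : F (Fin.last n) = S := hF.eq_of_finrank hS (by simp)
  obtain ⟨H, hHS, hH, hvH, hFH⟩ : ∃ H : Submodule K V, H ≤ S ∧ finrank K H = n ∧ v ∉ H ∧
      ∀ i : Fin n, F i.castSucc ≤ H := by
    cases n with
    | zero => exact ⟨⊥, bot_le, finrank_bot K V, by simpa using hv, fun i => i.elim0⟩
    | succ m =>
      refine ⟨F (Fin.last m).castSucc, hF.2.2 _, by simp [hF.2.1], hvF _ (by simp), fun i => ?_⟩
      exact hF.1 (Fin.castSucc_le_castSucc_iff.mpr (Fin.le_last i))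
  have hinit : IsFullFlag H (Fin.init F) :=
    ⟨fun a b hab => hF.1 (Fin.castSucc_le_castSucc_iff.mpr hab),
      fun i => hF.2.1 i.castSucc, fun i => hFH i⟩
  have h1 := congrFun (h ⟨H, hHS, hH, hvH⟩) (Fin.init F)
  rw [hyperplaneRes_of_isFullFlag _ hinit] at h1
  rwa [← Fin.snoc_init_self F, hlast]

/-- **Solomon–Tits theorem.** The cycles on complete flags are spanned by the apartments, and they
form a space of dimension `q ^ (n.choose 2)`. Restriction to the hyperplanes avoiding a fixed vector
identifies them with a direct sum of `q ^ (n - 1)` spaces of cycles in dimension `n - 1`. -/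
theorem flagCycles_eq_span_and_finrank [Finite K] (n : ℕ) : ∀ S : Submodule K V, finrank K S = n →
    flagCycles S n = Submodule.span ℚ (flagFuns S n) ∧
      finrank ℚ (flagCycles S n) = Nat.card K ^ n.choose 2 := by
  classical
  induction n with
  | zero =>
    intro S hS
    have hfull : ∀ F : Fin 0 → Submodule K V, IsFullFlag S F := fun F =>
      ⟨fun a => a.elim0, fun a => a.elim0, fun a => a.elim0⟩
    have htop : flagCycles S 0 = ⊤ := by
      rw [eq_top_iff]
      exact fun f _ => ⟨fun F hF => absurd (hfull F) hF, fun F _ i => i.elim0⟩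
    constructor
    · refine le_antisymm (fun f _ => ?_) (span_flagFuns_le S 0)
      have h1 : f = f Fin.elim0 • flagFun S (Fin.elim0 : Fin 0 → V) := by
        funext F
        rw [Pi.smul_apply, flagFun_of_isFullFlag _ (hfull F), Matrix.det_isEmpty, smul_eq_mul,
          mul_one, Subsingleton.elim F Fin.elim0]
      rw [h1]
      exact Submodule.smul_mem _ _ (Submodule.subset_span
        ⟨_, linearIndependent_empty_type, fun j => j.elim0, rfl⟩)
    · rw [htop, finrank_top]
      simp
  | succ n ih =>
    intro S hS
    have hSne : S ≠ ⊥ := by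
      rintro rfl
      simp at hS
    obtain ⟨v, hvS, hv⟩ := Submodule.exists_mem_ne_zero_of_ne_bot hSne
    let R : flagCycles S (n + 1) →ₗ[ℚ] (∀ H : AvoidingHyperplane S v n, flagCycles H.1 n) :=
      LinearMap.pi fun H => (hyperplaneRes H.1 S n).restrict fun f hf =>
        hyperplaneRes_mem H.2.1 hS hf
    have hRinj : Function.Injective R := by
      rw [injective_iff_map_eq_zero]
      rintro ⟨f, hf⟩ h
      refine Subtype.ext (eq_zero_of_hyperplaneRes hS hv hf fun H => ?_)
      exact congrArg Subtype.val (congrFun h H)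
    let W := (Submodule.span ℚ (flagFuns S (n + 1))).submoduleOf (flagCycles S (n + 1))
    -- the span of the apartments already surjects, since each summand is reached by the apartments
    -- of the bases of `H` extended by `v`
    have hmem : ∀ H : AvoidingHyperplane S v n, ∀ c : flagCycles H.1 n,
        Pi.single H c ∈ W.map R := by
      rintro H ⟨c, hc⟩
      have hc' := hc
      rw [(ih H.1 H.2.2.1).1] at hc
      induction hc using Submodule.span_induction with
      | mem c hcB =>
        obtain ⟨B, hB, hBH, rfl⟩ := hcB
        have hB' : LinearIndependent K (Fin.snoc B v : Fin (n + 1) → V) := by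
          rw [linearIndependent_finSnoc]
          refine ⟨hB, fun h => H.2.2.2 ?_⟩
          exact (Submodule.span_le.mpr (by rintro _ ⟨j, rfl⟩; exact hBH j)) h
        have hBS : ∀ j, (Fin.snoc B v : Fin (n + 1) → V) j ∈ S := by
          intro j
          induction j using Fin.lastCases with
          | last => simpa using hvS
          | cast j => simpa using H.2.1 (hBH j)
        refine ⟨⟨_, flagFun_mem_flagCycles S hB'.ne_zero⟩,
          Submodule.subset_span ⟨_, hB', hBS, rfl⟩, ?_⟩
        funext H'
        refine Subtype.ext ?_
        have h1 := hyperplaneRes_flagFun hS H.2.2.1 H'.2.2.1 H'.2.1 hvS H'.2.2.2 hB hBH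
        refine h1.trans ?_
        split_ifs with h
        · obtain rfl := Subtype.ext h
          simp
        · rw [Pi.single_eq_of_ne fun h' => h (congrArg Subtype.val h')]
          rfl
      | zero =>
        have : (⟨0, hc'⟩ : flagCycles H.1 n) = 0 := rfl
        rw [this, Pi.single_zero]
        exact Submodule.zero_mem _
      | add x y hx hy hx' hy' =>
        rw [← (ih H.1 H.2.2.1).1] at hx hy
        have : (⟨x + y, hc'⟩ : flagCycles H.1 n) = ⟨x, hx⟩ + ⟨y, hy⟩ := rfl
        rw [this, Pi.single_add]
        exact Submodule.add_mem _ (hx' hx hx) (hy' hy hy)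
      | smul a x hx hx' =>
        rw [← (ih H.1 H.2.2.1).1] at hx
        have : (⟨a • x, hc'⟩ : flagCycles H.1 n) = a • ⟨x, hx⟩ := rfl
        rw [this, Pi.single_smul]
        exact Submodule.smul_mem _ _ (hx' hx hx)
    have hW : W.map R = ⊤ := by
      rw [eq_top_iff]
      intro c _
      rw [← Finset.univ_sum_single c]
      exact Submodule.sum_mem _ fun H _ => hmem H _
    have hRsurj : Function.Surjective R := by
      rw [← LinearMap.range_eq_top, eq_top_iff, ← hW]
      exact LinearMap.map_le_range
    constructor
    · refine le_antisymm (fun f hf => ?_) (span_flagFuns_le S (n + 1))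
      have h1 : R ⟨f, hf⟩ ∈ W.map R := by rw [hW]; trivial
      obtain ⟨g, hg, hgf⟩ := h1
      rw [hRinj hgf] at hg
      exact hg
    · rw [(LinearEquiv.ofBijective R ⟨hRinj, hRsurj⟩).finrank_eq, finrank_pi_fintype,
        Finset.sum_congr rfl fun H _ => (ih H.1 H.2.2.1).2, Finset.sum_const, Finset.card_univ,
        ← Nat.card_eq_fintype_card, natCard_avoidingHyperplane hS hv hvS, smul_eq_mul, ← pow_add,
        Nat.choose_succ_succ' n 1, Nat.choose_one_right]

/-! ### Comparison of functions on chains and functions on complete flags -/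

/-- Apartment functions of `S` depend only on the intersection with `S`, vanish on chains with a
repetition, and change by the sign under permutations. So their values on complete flags determine
them. -/
theorem flagRes_injOn {S : Submodule K V} {n : ℕ} (hS : finrank K S = n)
    {f : SubspaceChain K V (Fin n) → ℚ} (hf : f ∈ frameSpan (Fin n) S) (h : flagRes S n f = 0) :
    f = 0 := by
  have hinf : ∀ F : SubspaceChain K V (Fin n), f (F.inf S) = f F := fun F =>
    eqOn_frameSpan (f := LinearMap.proj (F.inf S)) (g := LinearMap.proj F)
      (fun B _ hBS => frameFun_inf B hBS F) hf
  have hperm : ∀ (F : SubspaceChain K V (Fin n)) (σ : Equiv.Perm (Fin n)),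
      f (F.reindex σ) = ((Equiv.Perm.sign σ : ℤ) : ℚ) * f F := fun F σ =>
    eqOn_frameSpan (f := LinearMap.proj (F.reindex σ))
      (g := LinearMap.lsmul ℚ ℚ ((Equiv.Perm.sign σ : ℤ) : ℚ) ∘ₗ LinearMap.proj F)
      (fun B _ _ => frameFun_perm B F σ) hf
  funext F
  by_cases h0 : ∃ i, F.1 i ⊓ S = ⊥
  · obtain ⟨i, hi⟩ := h0
    exact eqOn_frameSpan (f := LinearMap.proj F) (g := 0)
      (fun B hB hBS => frameFun_eq_zero_of_inf_eq_bot hBS hB.ne_zero hi) hf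
  by_cases hinj : ∃ i j, i ≠ j ∧ F.1 i ⊓ S = F.1 j ⊓ S
  · obtain ⟨i, j, hij, hi⟩ := hinj
    exact eqOn_frameSpan (f := LinearMap.proj F) (g := 0)
      (fun B hB hBS => frameFun_eq_zero_of_inf_eq hBS hij hi) hf
  push Not at h0 hinj
  have hpos : ∀ i, 1 ≤ finrank K ↥(F.1 i ⊓ S) := fun i =>
    Submodule.one_le_finrank_iff.mpr (h0 i)
  have hle : ∀ i, finrank K ↥(F.1 i ⊓ S) ≤ n := fun i =>
    (Submodule.finrank_mono inf_le_right).trans hS.le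
  let d : Fin n → Fin n := fun i => ⟨finrank K ↥(F.1 i ⊓ S) - 1, by
    have := hpos i
    have := hle i
    omega⟩
  have hd : Function.Injective d := by
    intro i j hij
    by_contra hne
    refine hinj i j hne (F.inf_eq_of_finrank_eq S ?_)
    have h1 : finrank K ↥(F.1 i ⊓ S) - 1 = finrank K ↥(F.1 j ⊓ S) - 1 := congrArg Fin.val hij
    have := hpos i
    have := hpos j
    omega
  let e : Equiv.Perm (Fin n) := Equiv.ofBijective d (Finite.injective_iff_bijective.mp hd)
  have hfull : IsFullFlag S ((F.inf S).reindex e.symm).1 := by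
    have hdim : ∀ i, finrank K (((F.inf S).reindex e.symm).1 i) = i + 1 := by
      intro i
      have h1 : d (e.symm i) = i := e.apply_symm_apply i
      have h2 : finrank K ↥(F.1 (e.symm i) ⊓ S) - 1 = i := congrArg Fin.val h1
      have := hpos (e.symm i)
      change finrank K ↥(F.1 (e.symm i) ⊓ S) = i + 1
      omega
    refine ⟨fun i j hij => ?_, hdim, fun i => inf_le_right⟩
    rcases ((F.inf S).reindex e.symm).2 i j with h1 | h1
    · exact h1
    · refine (Submodule.eq_of_le_of_finrank_le h1 ?_).ge
      rw [hdim, hdim]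
      exact Nat.succ_le_succ hij
  have h1 : f ((F.inf S).reindex e.symm) = 0 :=
    (dif_pos hfull).symm.trans (congrFun h ((F.inf S).reindex e.symm).1)
  rw [hperm, hinf] at h1
  refine (mul_eq_zero.mp h1).resolve_left ?_
  exact_mod_cast (Equiv.Perm.sign e.symm).ne_zero

/-- The span of the apartment functions of `S` as the space of cycles on complete flags. -/
def frameSpanEquiv [Finite K] {S : Submodule K V} {n : ℕ} (hS : finrank K S = n) :
    frameSpan (Fin n) S ≃ₗ[ℚ] flagCycles S n :=
  LinearEquiv.ofBijective
    ((flagRes S n).restrict fun f hf => by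
      rw [(flagCycles_eq_span_and_finrank n S hS).1, ← map_flagRes_frameSpan]
      exact ⟨f, hf, rfl⟩)
    ⟨by
      rw [injective_iff_map_eq_zero]
      rintro ⟨f, hf⟩ h
      exact Subtype.ext (flagRes_injOn hS hf (congrArg Subtype.val h)), by
      rintro ⟨f, hf⟩
      have hf' := hf
      rw [(flagCycles_eq_span_and_finrank n S hS).1, ← map_flagRes_frameSpan] at hf'
      obtain ⟨g, hg, rfl⟩ := hf'
      exact ⟨⟨g, hg⟩, rfl⟩⟩

theorem finrank_frameSpan [Finite K] {S : Submodule K V} {n : ℕ} (hS : finrank K S = n) :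
    finrank ℚ (frameSpan (Fin n) S) = Nat.card K ^ n.choose 2 := by
  rw [(frameSpanEquiv hS).finrank_eq, (flagCycles_eq_span_and_finrank n S hS).2]

end SolomonTits

/-! ### Projections of frames -/

noncomputable section FrameProjections

open Module

variable {K V : Type*} [Field K] [AddCommGroup V] [Module K V]
variable {ι κ l : Type*}

/-- `C` is obtained from `B` by keeping the vectors in `S₁` and replacing the other ones by their
components in the complement `S₂` of `S₁`. -/
def IsProjFrame (S₁ S₂ : Submodule K V) (B C : ι → V) : Prop :=
  ∀ j, (B j ∈ S₁ ∧ C j = B j) ∨ (B j ∉ S₁ ∧ C j ∈ S₂ ∧ B j - C j ∈ S₁)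

theorem exists_isProjFrame {S₁ S₂ : Submodule K V} {B : ι → V} (hB : ∀ j, B j ∈ S₁ ⊔ S₂) :
    ∃ C, IsProjFrame S₁ S₂ B C := by
  have : ∀ j, ∃ c, (B j ∈ S₁ ∧ c = B j) ∨ (B j ∉ S₁ ∧ c ∈ S₂ ∧ B j - c ∈ S₁) := by
    intro j
    by_cases h : B j ∈ S₁
    · exact ⟨_, Or.inl ⟨h, rfl⟩⟩
    · obtain ⟨s, hs, t, ht, hst⟩ := Submodule.mem_sup.mp (hB j)
      refine ⟨t, Or.inr ⟨h, ht, ?_⟩⟩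
      rwa [← hst, add_sub_cancel_right]
  choose C hC using this
  exact ⟨C, hC⟩

theorem IsProjFrame.sub_mem {S₁ S₂ : Submodule K V} {B C : ι → V} (h : IsProjFrame S₁ S₂ B C)
    (j : ι) : B j - C j ∈ S₁ := by
  rcases h j with ⟨-, h2⟩ | ⟨-, -, h3⟩
  · rw [h2, sub_self]
    exact S₁.zero_mem
  · exact h3

theorem IsProjFrame.mem_or_mem {S₁ S₂ : Submodule K V} {B C : ι → V} (h : IsProjFrame S₁ S₂ B C)
    (j : ι) : C j ∈ S₁ ∨ C j ∈ S₂ := by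
  rcases h j with ⟨h1, h2⟩ | ⟨-, h2, -⟩
  · exact Or.inl (h2 ▸ h1)
  · exact Or.inr h2

theorem IsProjFrame.mem_sup {S₁ S₂ : Submodule K V} {B C : ι → V} (h : IsProjFrame S₁ S₂ B C)
    (j : ι) : C j ∈ S₁ ⊔ S₂ :=
  (h.mem_or_mem j).elim (fun h => Submodule.mem_sup_left h) (fun h => Submodule.mem_sup_right h)

theorem IsProjFrame.mem_left_iff {S₁ S₂ : Submodule K V} {B C : ι → V}
    (h : IsProjFrame S₁ S₂ B C) (j : ι) : C j ∈ S₁ ↔ B j ∈ S₁ := by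
  rw [← sub_add_cancel (B j) (C j), Submodule.add_mem_iff_right _ (h.sub_mem j)]

/-- Frames contained in `S₁ ∪ S₂` are their own projections. -/
theorem isProjFrame_self {S₁ S₂ : Submodule K V} {B : ι → V} (h : ∀ j, B j ∈ S₁ ∨ B j ∈ S₂) :
    IsProjFrame S₁ S₂ B B := by
  intro j
  by_cases h1 : B j ∈ S₁
  · exact Or.inl ⟨h1, rfl⟩
  · exact Or.inr ⟨h1, (h j).resolve_left h1, by rw [sub_self]; exact S₁.zero_mem⟩

theorem IsProjFrame.self {S₁ S₂ : Submodule K V} {B C : ι → V} (h : IsProjFrame S₁ S₂ B C) :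
    IsProjFrame S₁ S₂ C C := isProjFrame_self h.mem_or_mem

theorem span_mem_le (B : ι → V) (S : Submodule K V) :
    Submodule.span K (Set.range fun j : {j // B j ∈ S} => B j) ≤ S :=
  Submodule.span_le.mpr (by rintro _ ⟨j, rfl⟩; exact j.2)

variable [Fintype ι]

open Classical in
/-- The number of members of a family of vectors in a subspace. -/
def memCount (B : ι → V) (S : Submodule K V) : ℕ := (Finset.univ.filter fun j => B j ∈ S).card

theorem memCount_congr {B C : ι → V} {S T : Submodule K V} (h : ∀ j, B j ∈ S ↔ C j ∈ T) :
    memCount B S = memCount C T := by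
  classical
  simp only [memCount, h]

theorem memCount_eq_finrank_span {B : ι → V} (hB : LinearIndependent K B) (S : Submodule K V) :
    memCount B S = finrank K (Submodule.span K (Set.range fun j : {j // B j ∈ S} => B j)) := by
  classical
  have h := finrank_span_eq_card (hB.comp (Subtype.val : {j // B j ∈ S} → ι)
    Subtype.val_injective)
  rw [Fintype.card_subtype] at h
  exact h.symm

theorem memCount_le_finrank [FiniteDimensional K V] {B : ι → V} (hB : LinearIndependent K B)
    (S : Submodule K V) : memCount B S ≤ finrank K S := by
  rw [memCount_eq_finrank_span hB]
  exact Submodule.finrank_mono (span_mem_le B S)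

theorem span_mem_eq_of_memCount [FiniteDimensional K V] {B : ι → V} (hB : LinearIndependent K B)
    {S : Submodule K V} (h : memCount B S = finrank K S) :
    Submodule.span K (Set.range fun j : {j // B j ∈ S} => B j) = S :=
  Submodule.eq_of_le_of_finrank_eq (span_mem_le B S) (by rw [← memCount_eq_finrank_span hB, h])

/-- If `S₁` is spanned by members of a basis `B`, the projection of `B` is again a basis. -/
theorem IsProjFrame.linearIndependent [FiniteDimensional K V] {S₁ S₂ : Submodule K V} {B C : ι → V}
    (h : IsProjFrame S₁ S₂ B C) (hB : LinearIndependent K B)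
    (hc : memCount B S₁ = finrank K S₁) : LinearIndependent K C := by
  rw [linearIndependent_iff_card_le_finrank_span]
  have h1 : S₁ ≤ Submodule.span K (Set.range C) := by
    conv_lhs => rw [← span_mem_eq_of_memCount hB hc]
    refine Submodule.span_le.mpr ?_
    rintro _ ⟨⟨j, hj⟩, rfl⟩
    refine Submodule.subset_span ⟨j, ?_⟩
    exact ((h j).resolve_right fun h2 => h2.1 hj).2
  have h2 : Submodule.span K (Set.range B) ≤ Submodule.span K (Set.range C) := by
    refine Submodule.span_le.mpr ?_
    rintro _ ⟨j, rfl⟩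
    rw [← sub_add_cancel (B j) (C j)]
    exact Submodule.add_mem _ (h1 (h.sub_mem j)) (Submodule.subset_span ⟨j, rfl⟩)
  have := Submodule.finrank_mono h2
  rwa [finrank_span_eq_card hB] at this

variable [Fintype κ] [Fintype l]

/-- If a family has exactly as many members in `S` as `κ` has elements, its index set can be permuted
so that these members are the ones indexed by `κ`. -/
theorem exists_perm_of_memCount {B : κ ⊕ l → V} {S : Submodule K V}
    (h : memCount B S = Fintype.card κ) : ∃ σ : Equiv.Perm (κ ⊕ l),
      (∀ i, B (σ (Sum.inl i)) ∈ S) ∧ ∀ j, B (σ (Sum.inr j)) ∉ S := by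
  classical
  have h1 : Fintype.card κ = Fintype.card {x // B x ∈ S} := by
    rw [Fintype.card_subtype, ← h]
    rfl
  have h2 : Fintype.card l = Fintype.card {x // ¬ B x ∈ S} := by
    rw [Fintype.card_subtype_compl, ← h1, Fintype.card_sum]
    omega
  let σ : Equiv.Perm (κ ⊕ l) := ((Fintype.equivOfCardEq h1).sumCongr
    (Fintype.equivOfCardEq h2)).trans (Equiv.sumCompl fun x => B x ∈ S)
  exact ⟨σ, fun i => (Fintype.equivOfCardEq h1 i).2, fun j => (Fintype.equivOfCardEq h2 j).2⟩

variable [DecidableEq ι] [DecidableEq κ] [DecidableEq l]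

/-- The operator on functions on chains that sends the apartment of a basis `B` of `S₁ ⊔ S₂` to the
apartment of the projection of `B` if `S₁` is spanned by members of `B`, and to zero otherwise. It is
the coproduct component along `S₁` followed by the product of `S₁` and `S₂`. -/
def IsFrameProj (S₁ S₂ : Submodule K V)
    (P : Module.End ℚ (SubspaceChain K V ι → ℚ)) : Prop :=
  ∀ B : ι → V, LinearIndependent K B → (∀ j, B j ∈ S₁ ⊔ S₂) →
    (memCount B S₁ = finrank K S₁ → ∀ C, IsProjFrame S₁ S₂ B C → P (frameFun B) = frameFun C) ∧
    (memCount B S₁ ≠ finrank K S₁ → P (frameFun B) = 0)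

/-- The product with a fixed function `a` on chains indexed by `κ`. -/
def joinMap (e : κ ⊕ l ≃ ι) :
    (SubspaceChain K V κ → ℚ) →ₗ[ℚ] (SubspaceChain K V l → ℚ) →ₗ[ℚ] (SubspaceChain K V ι → ℚ) :=
  shuffle.compr₂ (LinearMap.funLeft ℚ ℚ fun F : SubspaceChain K V ι => F.reindex e)

theorem joinMap_frameFun (e : κ ⊕ l ≃ ι) (B : κ → V) (C : l → V) :
    joinMap e (frameFun B : SubspaceChain K V κ → ℚ) (frameFun C) =
      frameFun (Sum.elim B C ∘ e.symm) := by
  funext F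
  rw [← frameFun_reindex, ← shuffle_frameFun]
  rfl

/-- The residue along a chain `F` of `S₁`, on functions on chains indexed by `ι`. -/
def residue (e : κ ⊕ l ≃ ι) (S₁ S₂ : Submodule K V) (F : SubspaceChain K V κ) :
    (SubspaceChain K V ι → ℚ) →ₗ[ℚ] (SubspaceChain K V l → ℚ) :=
  contract S₁ S₂ F ∘ₗ LinearMap.funLeft ℚ ℚ fun F : SubspaceChain K V (κ ⊕ l) => F.reindex e.symm

theorem residue_frameFun (e : κ ⊕ l ≃ ι) (S₁ S₂ : Submodule K V) (F : SubspaceChain K V κ)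
    (B : ι → V) : residue e S₁ S₂ F (frameFun B) = contract S₁ S₂ F (frameFun (B ∘ e)) := by
  unfold residue
  rw [LinearMap.comp_apply]
  congr 1
  funext G
  exact frameFun_reindex B e.symm G

theorem residue_joinMap (e : κ ⊕ l ≃ ι) {S₁ S₂ : Submodule K V} (hS : Disjoint S₁ S₂)
    (F : SubspaceChain K V κ) {a : SubspaceChain K V κ → ℚ} (ha : a ∈ frameSpan κ S₁)
    {h : SubspaceChain K V l → ℚ} (hh : h ∈ frameSpan l S₂) :
    residue e S₁ S₂ F (joinMap e a h) = a F • h := by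
  refine eqOn_frameSpan (f := residue e S₁ S₂ F ∘ₗ joinMap e a) (g := a F • LinearMap.id)
    (fun C hC hCS => ?_) hh
  refine eqOn_frameSpan (f := residue e S₁ S₂ F ∘ₗ (joinMap e).flip (frameFun C))
    (g := (LinearMap.proj F).smulRight (frameFun C)) (fun B hB hBS => ?_) ha
  rw [LinearMap.comp_apply, LinearMap.flip_apply, joinMap_frameFun, residue_frameFun,
    Function.comp_assoc, Equiv.symm_comp_self, Function.comp_id,
    contract_frameFun hS F (C := C) hBS (fun j hj => ?_) hCS (fun j => by simp)]
  · rfl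
  · exact hC.ne_zero j (Submodule.disjoint_def.mp hS _ hj (hCS j))

/-- The residue of an apartment is a multiple of an apartment, or zero; up to a sign, which is the
same for the projected basis, the basis can be permuted to begin with its members in `S₁`. -/
theorem residue_frameFun_eq (e : κ ⊕ l ≃ ι) {S₁ S₂ : Submodule K V} (hS : Disjoint S₁ S₂)
    {B C : ι → V} (hc : memCount B S₁ = Fintype.card κ) (hBC : IsProjFrame S₁ S₂ B C) :
    ∃ (σ : Equiv.Perm (κ ⊕ l)), (∀ i, B (e (σ (Sum.inl i))) ∈ S₁) ∧
      (∀ j, B (e (σ (Sum.inr j))) ∉ S₁) ∧ ∀ F : SubspaceChain K V κ,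
      residue e S₁ S₂ F (frameFun B) = (((Equiv.Perm.sign σ : ℤ) : ℚ) *
        frameFun (fun i => B (e (σ (Sum.inl i)))) F) •
        frameFun fun j => C (e (σ (Sum.inr j))) := by
  classical
  have h1 : memCount (B ∘ e) S₁ = Fintype.card κ := by
    rw [← hc]
    exact Finset.card_bij (fun i _ => e i) (by simp) (by simp)
      fun j hj => ⟨e.symm j, by simpa using hj, by simp⟩
  obtain ⟨σ, hσ1, hσ2⟩ := exists_perm_of_memCount h1
  refine ⟨σ, hσ1, hσ2, fun F => ?_⟩
  have h2 : (frameFun (B ∘ e) : SubspaceChain K V (κ ⊕ l) → ℚ) =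
      ((Equiv.Perm.sign σ : ℤ) : ℚ) • frameFun ((B ∘ e) ∘ σ) := by
    rw [frameFun_comp_perm, smul_smul, ← Int.cast_mul, ← Units.val_mul, Int.units_mul_self]
    simp
  rw [residue_frameFun, h2, map_smul, contract_frameFun hS F
    (C := fun j => C (e (σ (Sum.inr j)))) hσ1 hσ2, smul_smul]
  · rfl
  · exact fun j => ((hBC _).resolve_left fun h => hσ2 j h.1).2.1
  · exact fun j => hBC.sub_mem _

theorem residue_frameFun_eq_zero [FiniteDimensional K V] (e : κ ⊕ l ≃ ι) {S₁ S₂ : Submodule K V}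
    (hκ : finrank K S₁ = Fintype.card κ) {B : ι → V} (hB : LinearIndependent K B)
    (hc : memCount B S₁ ≠ finrank K S₁) (F : SubspaceChain K V κ) :
    residue e S₁ S₂ F (frameFun B) = 0 := by
  classical
  rw [residue_frameFun]
  refine contract_frameFun_eq_zero F ?_
  have h1 := lt_of_le_of_ne (memCount_le_finrank (hB.comp e e.injective) S₁) (by
    refine fun h => hc (Eq.trans ?_ h)
    exact Finset.card_bij (fun i _ => e.symm i) (by simp) (by simp)
      fun j hj => ⟨e j, by simpa using hj, by simp⟩)
  rw [hκ] at h1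
  exact h1

theorem residue_mem [FiniteDimensional K V] (e : κ ⊕ l ≃ ι) {S₁ S₂ : Submodule K V}
    (hS : Disjoint S₁ S₂) (hκ : finrank K S₁ = Fintype.card κ) (F : SubspaceChain K V κ)
    {x : SubspaceChain K V ι → ℚ} (hx : x ∈ frameSpan ι (S₁ ⊔ S₂)) :
    residue e S₁ S₂ F x ∈ frameSpan l S₂ := by
  refine map_mem_of_frameSpan (fun B hB hBS => ?_) hx
  by_cases hc : memCount B S₁ = finrank K S₁
  · obtain ⟨C, hC⟩ := exists_isProjFrame hBS
    obtain ⟨σ, -, h2, h3⟩ := residue_frameFun_eq e hS (hc.trans hκ) hC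
    rw [h3]
    refine Submodule.smul_mem _ _ (frameFun_mem_frameSpan ?_ fun j => ?_)
    · exact (hC.linearIndependent hB hc).comp (fun j => e (σ (Sum.inr j)))
        (e.injective.comp (σ.injective.comp Sum.inr_injective))
    · exact ((hC _).resolve_left fun h => h2 j h.1).2.1
  · rw [residue_frameFun_eq_zero e hκ hB hc]
    exact Submodule.zero_mem _

/-- A finite-dimensional space of functions has a basis dual to evaluations at points. -/
theorem exists_dual_points {X : Type*} [Finite X] (E : Submodule ℚ (X → ℚ)) :
    ∃ (x : Fin (finrank ℚ E) → X) (a : Fin (finrank ℚ E) → (X → ℚ)), (∀ i, a i ∈ E) ∧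
      (∀ i, a i (x i) = 1) ∧ ∀ f ∈ E, f = ∑ i, f (x i) • a i := by
  classical
  let ev : X → Dual ℚ E := fun x => LinearMap.proj x ∘ₗ E.subtype
  have hspan : Submodule.span ℚ (Set.range ev) = ⊤ := by
    by_contra h
    obtain ⟨φ, hφ, hφ'⟩ := Submodule.exists_dual_map_eq_bot_of_lt_top (lt_top_iff_ne_top.mpr h)
      inferInstance
    obtain ⟨f, rfl⟩ := (Module.evalEquiv ℚ E).surjective φ
    refine hφ ?_
    have hf : f = 0 := by
      refine Subtype.ext (funext fun x => ?_)
      have : (Module.evalEquiv ℚ E f) (ev x) ∈ Submodule.map (Module.evalEquiv ℚ E f)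
        (Submodule.span ℚ (Set.range ev)) := ⟨_, Submodule.subset_span ⟨x, rfl⟩, rfl⟩
      rw [hφ'] at this
      exact this
    rw [hf, map_zero]
  -- the evaluations span the dual space, so they contain a basis of it
  obtain ⟨b, hb⟩ : ∃ b : Basis (Fin (finrank ℚ E)) ℚ (Dual ℚ E), ∀ i, ∃ x, b i = ev x := by
    let b0 := Basis.ofSpan hspan.ge
    have hfin := Module.Finite.finite_basis b0
    have hcard : Nat.card _ = finrank ℚ (Dual ℚ E) := (finrank_eq_nat_card_basis b0).symm
    rw [Subspace.dual_finrank_eq] at hcard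
    refine ⟨b0.reindex (Finite.equivFinOfCardEq hcard), fun i => ?_⟩
    rw [Basis.reindex_apply]
    obtain ⟨x, hx⟩ := Basis.ofSpan_subset hspan.ge ⟨((Finite.equivFinOfCardEq hcard).symm i), rfl⟩
    exact ⟨x, hx.symm⟩
  choose x hx using hb
  let a := b.dualBasis.map (Module.evalEquiv ℚ E).symm
  have ha : ∀ i φ, φ (a i) = b.repr φ i := by
    intro i φ
    have h1 : Module.evalEquiv ℚ E (a i) = b.dualBasis i := by simp [a]
    have h2 : φ (a i) = Module.evalEquiv ℚ E (a i) φ := rfl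
    rw [h2, h1, Basis.dualBasis_apply]
  refine ⟨x, fun i => (a i).1, fun i => (a i).2, fun i => ?_, fun f hf => ?_⟩
  · have := ha i (b i)
    rw [Basis.repr_self, Finsupp.single_eq_same, hx] at this
    exact this
  · have h3 : ∀ i, a.repr ⟨f, hf⟩ i = f (x i) := by
      intro i
      have h4 : b i ⟨f, hf⟩ = f (x i) := by rw [hx]; rfl
      rw [← h4]
      conv_rhs => rw [← a.sum_repr ⟨f, hf⟩]
      simp only [map_sum, map_smul, ha, Basis.repr_self, smul_eq_mul]
      rw [Finset.sum_eq_single i] <;> simp +contextual [eq_comm]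
    have h5 := congrArg Subtype.val (a.sum_repr ⟨f, hf⟩)
    simp only [h3] at h5
    rw [AddSubmonoidClass.coe_finsetSum] at h5
    exact h5.symm

/-- The projection operator factors as `∑ i, m i ∘ r i` through the functions on chains of `S₂`,
where `m i` is the product with the `i`-th member of a basis of the apartment functions of `S₁`, and
`r i` the residue along a chain dual to it. -/
theorem exists_isFrameProj [Finite V] {S₁ S₂ : Submodule K V} (hS : Disjoint S₁ S₂)
    (hκ : finrank K S₁ = Fintype.card κ) (e : κ ⊕ l ≃ ι) :
    ∃ (F : Fin (finrank ℚ (frameSpan κ S₁)) → SubspaceChain K V κ)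
      (a : Fin (finrank ℚ (frameSpan κ S₁)) → (SubspaceChain K V κ → ℚ)),
      (∀ i, a i ∈ frameSpan κ S₁) ∧ (∀ i, a i (F i) = 1) ∧
      IsFrameProj (ι := ι) S₁ S₂ (∑ i, joinMap e (a i) ∘ₗ residue e S₁ S₂ (F i)) := by
  obtain ⟨F, a, ha, haF, hf⟩ := exists_dual_points (frameSpan κ S₁)
  refine ⟨F, a, ha, haF, fun B hB hBS => ⟨fun hc C hBC => ?_, fun hc => ?_⟩⟩
  · obtain ⟨σ, h1, h2, h3⟩ := residue_frameFun_eq e hS (hc.trans hκ) hBC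
    have h4 : frameFun (fun i => B (e (σ (Sum.inl i)))) ∈ frameSpan κ S₁ :=
      frameFun_mem_frameSpan (hB.comp (fun i => e (σ (Sum.inl i)))
        (e.injective.comp (σ.injective.comp Sum.inl_injective))) h1
    have h5 : Sum.elim (fun i => B (e (σ (Sum.inl i)))) (fun j => C (e (σ (Sum.inr j)))) =
        (C ∘ e) ∘ σ := by
      funext x
      rcases x with i | j
      · exact ((hBC _).resolve_right fun h => h.1 (h1 i)).2.symm
      · rfl
    calc (∑ i, joinMap e (a i) ∘ₗ residue e S₁ S₂ (F i)) (frameFun B)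
        = ((Equiv.Perm.sign σ : ℤ) : ℚ) • joinMap e
            (∑ i, frameFun (fun i => B (e (σ (Sum.inl i)))) (F i) • a i)
            (frameFun fun j => C (e (σ (Sum.inr j)))) := by
          simp only [LinearMap.sum_apply, LinearMap.comp_apply, h3, map_smul, map_sum,
            LinearMap.smul_apply, Finset.smul_sum, smul_smul]
      _ = frameFun C := by
          rw [← hf _ h4, joinMap_frameFun, h5]
          funext G
          have h6 : ((C ∘ e) ∘ σ) ∘ e.symm = C ∘ (e.symm.trans (σ.trans e)) := rfl
          rw [h6, frameFun_comp_perm, smul_smul]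
          have h7 : Equiv.Perm.sign (e.symm.trans (σ.trans e)) = Equiv.Perm.sign σ :=
            Equiv.Perm.sign_symm_trans_trans σ e
          rw [h7, ← Int.cast_mul, ← Units.val_mul, Int.units_mul_self]
          simp
  · rw [LinearMap.sum_apply]
    refine Finset.sum_eq_zero fun i _ => ?_
    rw [LinearMap.comp_apply, residue_frameFun_eq_zero e hκ hB hc, map_zero]

end FrameProjections

/-! ### The Dynkin operators of the symplectic subspaces -/

noncomputable section DynkinOperators

open Module

section Recursion

variable {X R : Type*} [PartialOrder X] [Fintype X] [Ring R] [Algebra ℚ R]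

open Classical in
/-- The solution `T` of the recursion `T U = c U • P U - (∑ U' < U, T U') * P U` on a finite poset. -/
def recursiveOp (c : X → ℚ) (P : X → R) : X → R :=
  WellFounded.fix (wellFounded_lt (α := X)) fun U T =>
    c U • P U - (∑ W : {W // W < U}, T W.1 W.2) * P U

open Classical in
theorem recursiveOp_eq (c : X → ℚ) (P : X → R) (U : X) : recursiveOp c P U =
    c U • P U - (∑ W ∈ Finset.univ.filter (· < U), recursiveOp c P W) * P U := by
  rw [recursiveOp, WellFounded.fix_eq, ← recursiveOp,
    ← Finset.sum_subtype_eq_sum_filter (s := Finset.univ) (p := fun W => W < U),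
    Finset.subtype_univ]

end Recursion

variable {K V : Type*} [Field K] [AddCommGroup V] [Module K V]

/-- The nonzero subspaces on which the form is nondegenerate. -/
abbrev SymplecticSubspace (ω : LinearMap.BilinForm K V) : Type _ :=
  {U : Submodule K V // U ≠ ⊥ ∧ Disjoint U (ω.orthogonal U)}

section Projections

variable {ι : Type*} [Fintype ι] [DecidableEq ι]

theorem IsFrameProj.eq_of_mem {S₁ S₂ : Submodule K V}
    {P Q : Module.End ℚ (SubspaceChain K V ι → ℚ)} (hP : IsFrameProj S₁ S₂ P)
    (hQ : IsFrameProj S₁ S₂ Q) {x : SubspaceChain K V ι → ℚ} (hx : x ∈ frameSpan ι (S₁ ⊔ S₂)) :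
    P x = Q x := by
  refine eqOn_frameSpan (fun B hB hBS => ?_) hx
  by_cases hc : memCount B S₁ = finrank K S₁
  · obtain ⟨C, hC⟩ := exists_isProjFrame hBS
    rw [(hP B hB hBS).1 hc C hC, (hQ B hB hBS).1 hc C hC]
  · rw [(hP B hB hBS).2 hc, (hQ B hB hBS).2 hc]

theorem IsFrameProj.mem [FiniteDimensional K V] {S₁ S₂ : Submodule K V}
    {P : Module.End ℚ (SubspaceChain K V ι → ℚ)} (hP : IsFrameProj S₁ S₂ P)
    {x : SubspaceChain K V ι → ℚ} (hx : x ∈ frameSpan ι (S₁ ⊔ S₂)) :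
    P x ∈ frameSpan ι (S₁ ⊔ S₂) := by
  refine map_mem_of_frameSpan (fun B hB hBS => ?_) hx
  by_cases hc : memCount B S₁ = finrank K S₁
  · obtain ⟨C, hC⟩ := exists_isProjFrame hBS
    rw [(hP B hB hBS).1 hc C hC]
    exact frameFun_mem_frameSpan (hC.linearIndependent hB hc) hC.mem_sup
  · rw [(hP B hB hBS).2 hc]
    exact Submodule.zero_mem _

theorem IsFrameProj.idem [FiniteDimensional K V] {S₁ S₂ : Submodule K V}
    {P : Module.End ℚ (SubspaceChain K V ι → ℚ)} (hP : IsFrameProj S₁ S₂ P)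
    {x : SubspaceChain K V ι → ℚ} (hx : x ∈ frameSpan ι (S₁ ⊔ S₂)) : P (P x) = P x := by
  refine eqOn_frameSpan (f := P ∘ₗ P) (g := P) (fun B hB hBS => ?_) hx
  rw [LinearMap.comp_apply]
  by_cases hc : memCount B S₁ = finrank K S₁
  · obtain ⟨C, hC⟩ := exists_isProjFrame hBS
    rw [(hP B hB hBS).1 hc C hC]
    exact (hP C (hC.linearIndependent hB hc) hC.mem_sup).1
      (by rw [← hc]; exact memCount_congr hC.mem_left_iff) C hC.self
  · rw [(hP B hB hBS).2 hc, map_zero]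

end Projections

variable {ω : LinearMap.BilinForm K V}

theorem disjoint_inf_orthogonal {S U : Submodule K V}
    (hU : Disjoint U (ω.orthogonal U)) : Disjoint (S ⊓ ω.orthogonal U) U :=
  hU.symm.mono_left inf_le_right

theorem mem_orthogonal_sup {T₁ T₂ : Submodule K V} {x : V} (h1 : x ∈ ω.orthogonal T₁)
    (h2 : x ∈ ω.orthogonal T₂) : x ∈ ω.orthogonal (T₁ ⊔ T₂) := by
  intro y hy
  obtain ⟨s, hs, t, ht, rfl⟩ := Submodule.mem_sup.mp hy
  have h3 : ω s x = 0 := h1 s hs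
  have h4 : ω t x = 0 := h2 t ht
  change ω (s + t) x = 0
  rw [map_add, LinearMap.add_apply, h3, h4, add_zero]

theorem disjoint_orthogonal_of_sup {U T₁ T₂ : Submodule K V}
    (hU : Disjoint U (ω.orthogonal U)) (hT : T₁ ⊔ T₂ = U)
    (hort : ∀ x ∈ T₂, ∀ y ∈ T₁, ω x y = 0) : Disjoint T₁ (ω.orthogonal T₁) := by
  rw [Submodule.disjoint_def] at hU ⊢
  intro x hx hx'
  refine hU x (hT ▸ Submodule.mem_sup_left hx) ?_
  rw [← hT]
  exact mem_orthogonal_sup hx' fun y hy => hort y hy x hx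

theorem disjoint_of_sup {U T₁ T₂ : Submodule K V} (hU : Disjoint U (ω.orthogonal U))
    (hT : T₁ ⊔ T₂ = U) (hort : ∀ x ∈ T₁, ∀ y ∈ T₂, ω x y = 0)
    (hort' : ∀ x ∈ T₂, ∀ y ∈ T₁, ω x y = 0) : Disjoint T₁ T₂ := by
  rw [Submodule.disjoint_def] at hU ⊢
  intro x hx hx'
  refine hU x (hT ▸ Submodule.mem_sup_left hx) ?_
  rw [← hT]
  exact mem_orthogonal_sup (fun y hy => hort y hy x hx') fun y hy => hort' y hy x hx

/-- The components in `W` of the vectors in `T₁` lie in `W ⊓ T₁`, if `W` is split by `T₁ ⊥ T₂`. -/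
theorem component_mem {W T₁ T₂ : Submodule K V} (hW : Disjoint W (ω.orthogonal W))
    (hWT : W ⊓ T₁ ⊔ W ⊓ T₂ = W) (hort : ∀ x ∈ T₁, ∀ y ∈ T₂, ω x y = 0)
    (hort' : ∀ x ∈ T₂, ∀ y ∈ T₁, ω x y = 0) {b c : V} (hb : b ∈ T₁) (hc : c ∈ W)
    (hbc : b - c ∈ ω.orthogonal W) : c ∈ W ⊓ T₁ := by
  obtain ⟨s, hs, t, ht, rfl⟩ := Submodule.mem_sup.mp (hWT.symm ▸ hc)
  have h1 : t ∈ ω.orthogonal W := by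
    rw [← hWT]
    refine mem_orthogonal_sup (fun y hy => hort y hy.2 t ht.2) fun y hy => ?_
    have h2 : ω y (b - (s + t)) = 0 := hbc y hy.1
    rw [map_sub, map_add, hort' y hy.2 b hb, hort' y hy.2 s hs.2] at h2
    change ω y t = 0
    simpa using h2
  rw [Submodule.disjoint_def.mp hW t ht.1 h1, add_zero]
  exact hs

variable (ω) in
/-- The span of the apartment functions of the separated bases of `V`. -/
def separatedSpan (n : ℕ) : Submodule ℚ (SubspaceChain K V (Fin n) → ℚ) :=
  Submodule.span ℚ {f | ∃ B : Fin n → V, LinearIndependent K B ∧ IsSeparated ω B ∧ f = frameFun B}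

theorem separatedSpan_le (n : ℕ) : separatedSpan ω n ≤ frameSpan (Fin n) (⊤ : Submodule K V) :=
  Submodule.span_le.mpr (by
    rintro _ ⟨B, hB, -, rfl⟩
    exact frameFun_mem_frameSpan hB fun _ => trivial)

variable [Finite V]

theorem isCompl_orthogonal (hω : ω.IsAlt) {U : Submodule K V}
    (hU : Disjoint U (ω.orthogonal U)) : IsCompl U (ω.orthogonal U) :=
  (LinearMap.BilinForm.isCompl_orthogonal_iff_disjoint hω.isRefl).mpr hU

theorem inf_orthogonal_sup_eq (hω : ω.IsAlt) {S U : Submodule K V}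
    (hU : Disjoint U (ω.orthogonal U)) (hUS : U ≤ S) : S ⊓ ω.orthogonal U ⊔ U = S := by
  rw [inf_sup_assoc_of_le _ hUS, sup_comm, (isCompl_orthogonal hω hU).sup_eq_top, inf_top_eq]

theorem finrank_inf_orthogonal_add (hω : ω.IsAlt) {S U : Submodule K V}
    (hU : Disjoint U (ω.orthogonal U)) (hUS : U ≤ S) :
    finrank K ↥(S ⊓ ω.orthogonal U) + finrank K U = finrank K S := by
  have h := Submodule.finrank_sup_add_finrank_inf_eq (S ⊓ ω.orthogonal U) U
  rw [inf_orthogonal_sup_eq hω hU hUS, (disjoint_inf_orthogonal hU).eq_bot, finrank_bot] at h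
  omega

/-- The index equivalence for the splitting `S = (S ⊓ Uᗮ) ⊕ U`. -/
def splitEquiv (hω : ω.IsAlt) {S U : Submodule K V} (hU : Disjoint U (ω.orthogonal U))
    (hUS : U ≤ S) {n : ℕ} (hS : finrank K S = n) :
    Fin (finrank K ↥(S ⊓ ω.orthogonal U)) ⊕ Fin (finrank K U) ≃ Fin n :=
  finSumFinEquiv.trans (finCongr ((finrank_inf_orthogonal_add hω hU hUS).trans hS))

open Classical in
variable (ω) in
/-- The projection of frames of `S` for the splitting `S = (S ⊓ Uᗮ) ⊕ U`; zero unless `U ≤ S` and `S`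
has dimension `n`. -/
def symplProj (S : Submodule K V) (n : ℕ) (U : SymplecticSubspace ω) :
    Module.End ℚ (SubspaceChain K V (Fin n) → ℚ) :=
  if h : ∃ P : Module.End ℚ (SubspaceChain K V (Fin n) → ℚ),
    IsFrameProj (S ⊓ ω.orthogonal U.1) U.1 P then h.choose else 0

theorem symplProj_spec (hω : ω.IsAlt) {S : Submodule K V} {n : ℕ} (hS : finrank K S = n)
    {U : SymplecticSubspace ω} (hUS : U.1 ≤ S) :
    IsFrameProj (S ⊓ ω.orthogonal U.1) U.1 (symplProj ω S n U) := by
  obtain ⟨F, a, -, -, h⟩ := exists_isFrameProj (disjoint_inf_orthogonal (S := S) U.2.2)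
    (Fintype.card_fin _).symm (splitEquiv hω U.2.2 hUS hS)
  have h' : ∃ P : Module.End ℚ (SubspaceChain K V (Fin n) → ℚ),
    IsFrameProj (S ⊓ ω.orthogonal U.1) U.1 P := ⟨_, h⟩
  rw [symplProj, dif_pos h']
  exact h'.choose_spec

theorem symplProj_mem (hω : ω.IsAlt) {S : Submodule K V} {n : ℕ} (hS : finrank K S = n)
    {U : SymplecticSubspace ω} (hUS : U.1 ≤ S) {x : SubspaceChain K V (Fin n) → ℚ}
    (hx : x ∈ frameSpan (Fin n) S) : symplProj ω S n U x ∈ frameSpan (Fin n) S := by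
  rw [← inf_orthogonal_sup_eq hω U.2.2 hUS] at hx
  have := (symplProj_spec hω hS hUS).mem hx
  rwa [inf_orthogonal_sup_eq hω U.2.2 hUS] at this

theorem symplProj_idem (hω : ω.IsAlt) {S : Submodule K V} {n : ℕ} (hS : finrank K S = n)
    {U : SymplecticSubspace ω} (hUS : U.1 ≤ S) {x : SubspaceChain K V (Fin n) → ℚ}
    (hx : x ∈ frameSpan (Fin n) S) :
    symplProj ω S n U (symplProj ω S n U x) = symplProj ω S n U x := by
  rw [← inf_orthogonal_sup_eq hω U.2.2 hUS] at hx
  exact (symplProj_spec hω hS hUS).idem hx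

instance : Fintype (SymplecticSubspace ω) := Fintype.ofFinite _

variable (ω) in
/-- The Dynkin operator of `U` on the apartment functions of `S`: it is the identity on the factor
`S ⊓ Uᗮ` and the convolution of the antipode with the dimension grading on the factor `U`. The
recursion expresses that the convolution of the identity with the Dynkin operator is the grading. -/
def dynkinOp (S : Submodule K V) (n : ℕ) :
    SymplecticSubspace ω → Module.End ℚ (SubspaceChain K V (Fin n) → ℚ) :=
  recursiveOp (fun U => (finrank K U.1 : ℚ)) (symplProj ω S n)

open Classical in
theorem dynkinOp_apply (S : Submodule K V) (n : ℕ) (U : SymplecticSubspace ω)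
    (x : SubspaceChain K V (Fin n) → ℚ) :
    dynkinOp ω S n U x = (finrank K U.1 : ℚ) • symplProj ω S n U x -
      ∑ W ∈ Finset.univ.filter (· < U), dynkinOp ω S n W (symplProj ω S n U x) := by
  rw [dynkinOp, recursiveOp_eq, LinearMap.sub_apply, LinearMap.smul_apply, Module.End.mul_apply,
    LinearMap.sum_apply]

theorem dynkinOp_mem (hω : ω.IsAlt) {S : Submodule K V} {n : ℕ} (hS : finrank K S = n)
    {U : SymplecticSubspace ω} (hUS : U.1 ≤ S) {x : SubspaceChain K V (Fin n) → ℚ}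
    (hx : x ∈ frameSpan (Fin n) S) : dynkinOp ω S n U x ∈ frameSpan (Fin n) S := by
  classical
  induction U using WellFoundedLT.induction generalizing x with
  | ind U ih =>
    rw [dynkinOp_apply]
    have h := symplProj_mem hω hS hUS hx
    refine Submodule.sub_mem _ (Submodule.smul_mem _ _ h) (Submodule.sum_mem _ fun W hW => ?_)
    have hWU := (Finset.mem_filter.mp hW).2
    exact ih W hWU (le_trans (show W.1 ≤ U.1 from hWU.le) hUS) h

theorem dynkinOp_symplProj (hω : ω.IsAlt) {S : Submodule K V} {n : ℕ} (hS : finrank K S = n)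
    {U : SymplecticSubspace ω} (hUS : U.1 ≤ S) {x : SubspaceChain K V (Fin n) → ℚ}
    (hx : x ∈ frameSpan (Fin n) S) :
    dynkinOp ω S n U (symplProj ω S n U x) = dynkinOp ω S n U x := by
  classical
  rw [dynkinOp_apply, symplProj_idem hω hS hUS hx, ← dynkinOp_apply]

open Classical in
theorem sum_dynkinOp {S : Submodule K V} {n : ℕ} {U : SymplecticSubspace ω}
    {x : SubspaceChain K V (Fin n) → ℚ} (hxU : symplProj ω S n U x = x) :
    ∑ W ∈ Finset.univ.filter (· ≤ U), dynkinOp ω S n W x = (finrank K U.1 : ℚ) • x := by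
  have h1 : (Finset.univ.filter (· ≤ U) : Finset (SymplecticSubspace ω)) =
      insert U (Finset.univ.filter (· < U)) := by
    ext W
    simp [le_iff_eq_or_lt]
  rw [h1, Finset.sum_insert (by simp), dynkinOp_apply, hxU]
  simp

/-! ### The Dynkin operator annihilates products -/

theorem memCount_orthogonal (hω : ω.IsAlt) {n : ℕ} (hV : finrank K V = n)
    {U : Submodule K V} (hU : Disjoint U (ω.orthogonal U)) {B : Fin n → V}
    (hB : LinearIndependent K B) (h : ∀ j, B j ∈ ω.orthogonal U ∨ B j ∈ U) :
    memCount B (ω.orthogonal U) = finrank K (ω.orthogonal U) := by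
  classical
  have h1 := memCount_le_finrank hB (ω.orthogonal U)
  have h2 := memCount_le_finrank hB U
  have h3 := Submodule.finrank_add_eq_of_isCompl (isCompl_orthogonal hω hU)
  have h4 : n ≤ memCount B (ω.orthogonal U) + memCount B U := by
    have := Finset.card_union_le (Finset.univ.filter fun j => B j ∈ ω.orthogonal U)
      (Finset.univ.filter fun j => B j ∈ U)
    rw [← Finset.filter_or, Finset.filter_true_of_mem fun j _ => h j, Finset.card_univ,
      Fintype.card_fin] at this
    exact this
  omega

theorem symplProj_top_spec (hω : ω.IsAlt) {n : ℕ} (hV : finrank K V = n)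
    (U : SymplecticSubspace ω) :
    IsFrameProj (ω.orthogonal U.1) U.1 (symplProj ω ⊤ n U) := by
  have := symplProj_spec hω (S := ⊤) (by rw [finrank_top, hV]) (U := U) le_top
  rwa [top_inf_eq] at this

theorem symplProj_frameFun_self (hω : ω.IsAlt) {n : ℕ} (hV : finrank K V = n)
    (U : SymplecticSubspace ω) {B : Fin n → V} (hB : LinearIndependent K B)
    (h : ∀ j, B j ∈ ω.orthogonal U.1 ∨ B j ∈ U.1) :
    symplProj ω ⊤ n U (frameFun B) = frameFun B :=
  (symplProj_top_spec hω hV U B hB fun j => (h j).elim (fun h => Submodule.mem_sup_left h)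
    (fun h => Submodule.mem_sup_right h)).1 (memCount_orthogonal hω hV U.2.2 hB h) B
    (isProjFrame_self h)

/-- The vectors of a basis spanning the orthogonal complement of a symplectic subspace `W` of
`T₁ ⊥ T₂`, the splitting of the basis induces a splitting of `W`. -/
theorem inf_sup_inf_eq_of_memCount (hω : ω.IsAlt) (hnd : ω.Nondegenerate)
    {U T₁ T₂ W : Submodule K V} (hT : T₁ ⊔ T₂ = U) (hort : ∀ x ∈ T₁, ∀ y ∈ T₂, ω x y = 0)
    (hW : W ≤ U) {n : ℕ} {B : Fin n → V} (hB : LinearIndependent K B)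
    (hBT : ∀ j, B j ∈ ω.orthogonal U ∨ B j ∈ T₁ ∨ B j ∈ T₂)
    (hc : memCount B (ω.orthogonal W) = finrank K (ω.orthogonal W)) :
    W ⊓ T₁ ⊔ W ⊓ T₂ = W := by
  have hort' : ∀ x ∈ T₂, ∀ y ∈ T₁, ω x y = 0 := fun x hx y hy => hω.isRefl _ _ (hort y hy x hx)
  have key : ∀ A A' : Submodule K V, A ≤ U → (∀ x ∈ A, ∀ y ∈ A', ω x y = 0) →
      (∀ x ∈ A', ∀ y ∈ A, ω x y = 0) → (∀ j, B j ∈ ω.orthogonal U ∨ B j ∈ A ∨ B j ∈ A') →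
      ∀ s ∈ A, ∀ t ∈ A', s + t ∈ W → s ∈ W := by
    intro A A' hAU h1 h2 h3 s hs t ht hst
    rw [← LinearMap.BilinForm.orthogonal_orthogonal hnd hω.isRefl W]
    rw [← span_mem_eq_of_memCount hB hc]
    intro y hy
    change ω y s = 0
    induction hy using Submodule.span_induction with
    | mem y hy =>
      obtain ⟨⟨j, hj⟩, rfl⟩ := hy
      change ω (B j) s = 0
      rcases h3 j with h | h | h
      · exact hω.isRefl _ _ (h s (hAU hs))
      · have h4 : ω (s + t) (B j) = 0 := hj _ hst
        rw [map_add, LinearMap.add_apply, h2 t ht _ h, add_zero] at h4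
        exact hω.isRefl _ _ h4
      · exact h2 _ h s hs
    | zero => simp
    | add y z _ _ hy hz => rw [map_add, LinearMap.add_apply, hy, hz, add_zero]
    | smul c y _ hy => rw [map_smul, LinearMap.smul_apply, hy, smul_zero]
  refine le_antisymm (sup_le inf_le_left inf_le_left) fun x hx => ?_
  obtain ⟨s, hs, t, ht, rfl⟩ := Submodule.mem_sup.mp (hT ▸ hW hx : x ∈ T₁ ⊔ T₂)
  refine Submodule.add_mem_sup ⟨?_, hs⟩ ⟨?_, ht⟩
  · exact key T₁ T₂ (hT ▸ le_sup_left) hort hort' hBT s hs t ht hx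
  · exact key T₂ T₁ (hT ▸ le_sup_right) hort' hort (fun j => (hBT j).imp_right Or.symm) t ht s hs
      (by rwa [add_comm])

/-- The Dynkin operator annihilates products. The proper subspaces contributing to the recursion are
those split by the factors; by induction only those inside one of the two factors matter, and they
contribute the dimensions of the factors, which add up to the dimension of `U`. -/
theorem dynkinOp_frameFun_eq_zero (hω : ω.IsAlt) (hnd : ω.Nondegenerate) {n : ℕ}
    (hV : finrank K V = n) (U : SymplecticSubspace ω) : ∀ {T₁ T₂ : Submodule K V}, T₁ ≠ ⊥ →
    T₂ ≠ ⊥ → T₁ ⊔ T₂ = U.1 → (∀ x ∈ T₁, ∀ y ∈ T₂, ω x y = 0) → ∀ {B : Fin n → V},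
    LinearIndependent K B → (∀ j, B j ∈ ω.orthogonal U.1 ∨ B j ∈ T₁ ∨ B j ∈ T₂) →
    dynkinOp ω ⊤ n U (frameFun B) = 0 := by
  classical
  have htop : finrank K (⊤ : Submodule K V) = n := by rw [finrank_top, hV]
  induction U using WellFoundedLT.induction with
  | ind U ih =>
    intro T₁ T₂ hT₁ hT₂ hT hort B hB hBT
    have hort' : ∀ x ∈ T₂, ∀ y ∈ T₁, ω x y = 0 := fun x hx y hy => hω.isRefl _ _ (hort y hy x hx)
    have hmem : frameFun B ∈ frameSpan (Fin n) (⊤ : Submodule K V) :=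
      frameFun_mem_frameSpan hB fun _ => trivial
    have hdisj := disjoint_of_sup U.2.2 hT hort hort'
    have hT₁U : T₁ ≤ U.1 := hT ▸ le_sup_left
    have hT₂U : T₂ ≤ U.1 := hT ▸ le_sup_right
    let X₁ : SymplecticSubspace ω := ⟨T₁, hT₁, disjoint_orthogonal_of_sup U.2.2 hT hort'⟩
    let X₂ : SymplecticSubspace ω :=
      ⟨T₂, hT₂, disjoint_orthogonal_of_sup U.2.2 (sup_comm T₁ T₂ ▸ hT) hort⟩
    have hself : ∀ X : SymplecticSubspace ω, (∀ j, B j ∈ ω.orthogonal X.1 ∨ B j ∈ X.1) →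
        ∑ W ∈ Finset.univ.filter (· ≤ X), dynkinOp ω ⊤ n W (frameFun B) =
          (finrank K X.1 : ℚ) • frameFun B := fun X hX =>
      sum_dynkinOp (symplProj_frameFun_self hω hV X hB hX)
    have hs₁ := hself X₁ fun j => by
      rcases hBT j with h | h | h
      · exact Or.inl (LinearMap.BilinForm.orthogonal_le hT₁U h)
      · exact Or.inr h
      · exact Or.inl fun y hy => hort y hy _ h
    have hs₂ := hself X₂ fun j => by
      rcases hBT j with h | h | h
      · exact Or.inl (LinearMap.BilinForm.orthogonal_le hT₂U h)
      · exact Or.inl fun y hy => hort' y hy _ h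
      · exact Or.inr h
    have hUB : symplProj ω ⊤ n U (frameFun B) = frameFun B :=
      symplProj_frameFun_self hω hV U hB fun j =>
        (hBT j).imp_right fun h => h.elim (fun h => hT₁U h) (fun h => hT₂U h)
    -- if `W` is not in a factor, its operator either vanishes because the frame is not adapted to
    -- `W`, or annihilates the projected frame, which is again a product for the induced splitting
    have hrest : ∀ W : SymplecticSubspace ω, W < U → ¬ W ≤ X₁ → ¬ W ≤ X₂ →
        dynkinOp ω ⊤ n W (frameFun B) = 0 := by
      intro W hWU hW₁ hW₂
      rw [← dynkinOp_symplProj hω htop le_top hmem]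
      have hcompl := (isCompl_orthogonal hω W.2.2).symm.sup_eq_top
      have hspec := symplProj_top_spec hω hV W B hB fun j => by rw [hcompl]; trivial
      by_cases hc : memCount B (ω.orthogonal W.1) = finrank K (ω.orthogonal W.1)
      · obtain ⟨C, hC⟩ := exists_isProjFrame (S₁ := ω.orthogonal W.1) (S₂ := W.1) (B := B)
          fun j => by rw [hcompl]; trivial
        rw [hspec.1 hc C hC]
        have hsplit := inf_sup_inf_eq_of_memCount hω hnd hT hort hWU.le hB hBT hc
        refine ih W hWU (T₁ := W.1 ⊓ T₁) (T₂ := W.1 ⊓ T₂) (fun h => hW₂ ?_) (fun h => hW₁ ?_)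
          hsplit (fun x hx y hy => hort x hx.2 y hy.2) (hC.linearIndependent hB hc) fun j => ?_
        · rw [h, bot_sup_eq] at hsplit
          exact inf_eq_left.mp hsplit
        · rw [h, sup_bot_eq] at hsplit
          exact inf_eq_left.mp hsplit
        · rcases hC j with ⟨h1, h2⟩ | ⟨h1, h2, h3⟩
          · exact Or.inl (h2 ▸ h1)
          · rcases hBT j with h | h | h
            · exact absurd (LinearMap.BilinForm.orthogonal_le hWU.le h) h1
            · exact Or.inr (Or.inl (component_mem W.2.2 hsplit hort hort' h h2 h3))
            · exact Or.inr (Or.inr (component_mem W.2.2 (sup_comm (W.1 ⊓ T₁) _ ▸ hsplit)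
                hort' hort h h2 h3))
      · rw [hspec.2 hc, map_zero]
    have hX₁ : X₁ < U := lt_of_le_of_ne hT₁U fun h => hT₂ (by
      have h1 : T₁ = U.1 := congrArg Subtype.val h
      exact hdisj.eq_bot_of_ge (h1 ▸ hT₂U))
    have hX₂ : X₂ < U := lt_of_le_of_ne hT₂U fun h => hT₁ (by
      have h1 : T₂ = U.1 := congrArg Subtype.val h
      exact hdisj.eq_bot_of_le (h1 ▸ hT₁U))
    -- the operators of the subspaces of `T₁` add up to multiplication by `dim T₁`, likewise for `T₂`
    have hsum : ∑ W ∈ Finset.univ.filter (· < U), dynkinOp ω ⊤ n W (frameFun B) =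
        (finrank K T₁ : ℚ) • frameFun B + (finrank K T₂ : ℚ) • frameFun B := by
      rw [← hs₁, ← hs₂, ← Finset.sum_union]
      · symm
        refine Finset.sum_subset (fun W hW => ?_) fun W hW hW' => ?_
        · simp only [Finset.mem_union, Finset.mem_filter, Finset.mem_univ, true_and] at hW ⊢
          exact hW.elim (fun h => h.trans_lt hX₁) (fun h => h.trans_lt hX₂)
        · simp only [Finset.mem_union, Finset.mem_filter, Finset.mem_univ, true_and, not_or]
            at hW hW'
          exact hrest W hW hW'.1 hW'.2
      · rw [Finset.disjoint_left]
        intro W hW hW'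
        simp only [Finset.mem_filter, Finset.mem_univ, true_and] at hW hW'
        exact W.2.1 (le_bot_iff.mp (hdisj hW hW'))
    have hdim : finrank K U.1 = finrank K T₁ + finrank K T₂ := by
      have := Submodule.finrank_sup_add_finrank_inf_eq T₁ T₂
      rw [hT, hdisj.eq_bot, finrank_bot] at this
      omega
    rw [dynkinOp_apply, hUB, hsum, hdim, Nat.cast_add, add_smul, sub_self]

/-! ### The quotient by the products -/

theorem symplProj_mem_separatedSpan (hω : ω.IsAlt) {n : ℕ} (hV : finrank K V = n)
    {U : SymplecticSubspace ω} (hU : U.1 ≠ ⊤) {x : SubspaceChain K V (Fin n) → ℚ}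
    (hx : x ∈ frameSpan (Fin n) (⊤ : Submodule K V)) :
    symplProj ω ⊤ n U x ∈ separatedSpan ω n := by
  have hcompl := isCompl_orthogonal hω U.2.2
  have hBtop : ∀ (B : Fin n → V) j, B j ∈ ω.orthogonal U.1 ⊔ U.1 := fun B j => by
    rw [hcompl.symm.sup_eq_top]; trivial
  refine map_mem_of_frameSpan (fun B hB _ => ?_) hx
  have hspec := symplProj_top_spec hω hV U B hB (hBtop B)
  by_cases hc : memCount B (ω.orthogonal U.1) = finrank K (ω.orthogonal U.1)
  · obtain ⟨C, hC⟩ := exists_isProjFrame (hBtop B)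
    rw [hspec.1 hc C hC]
    refine Submodule.subset_span ⟨C, hC.linearIndependent hB hc, ⟨ω.orthogonal U.1, U.1,
      fun h => hU ?_, U.2.1, hcompl.symm, fun x hx y hy => hω.isRefl _ _ (hx y hy),
      hC.mem_or_mem⟩, rfl⟩
    have := hcompl.sup_eq_top
    rwa [h, sup_bot_eq] at this
  · rw [hspec.2 hc]
    exact Submodule.zero_mem _

theorem dynkinOp_mem_separatedSpan (hω : ω.IsAlt) {n : ℕ} (hV : finrank K V = n)
    {U : SymplecticSubspace ω} (hU : U.1 ≠ ⊤) {x : SubspaceChain K V (Fin n) → ℚ}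
    (hx : x ∈ frameSpan (Fin n) (⊤ : Submodule K V)) :
    dynkinOp ω ⊤ n U x ∈ separatedSpan ω n := by
  classical
  induction U using WellFoundedLT.induction generalizing x with
  | ind U ih =>
    rw [dynkinOp_apply]
    have h := symplProj_mem_separatedSpan hω hV hU hx
    refine Submodule.sub_mem _ (Submodule.smul_mem _ _ h) (Submodule.sum_mem _ fun W hW => ?_)
    have hWU := (Finset.mem_filter.mp hW).2
    exact ih W hWU (fun h' => hU (top_le_iff.mp (h' ▸ hWU.le))) (separatedSpan_le n h)

end DynkinOperators

/-! ### Traces of the Dynkin operators -/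

noncomputable section DynkinTraces

open Module

theorem trace_eq_finrank_quotient_ker {M : Type*} [AddCommGroup M] [Module ℚ M]
    [FiniteDimensional ℚ M] {f : Module.End ℚ M} (hf : IsIdempotentElem f) :
    LinearMap.trace ℚ M f = finrank ℚ (M ⧸ LinearMap.ker f) := by
  rw [(LinearMap.quotKerEquivRange f).finrank_eq]
  exact (LinearMap.IsIdempotentElem.isProj_range f hf).trace

variable {K V : Type*} [Field K] [AddCommGroup V] [Module K V]

theorem linearIndependent_sumElim {ι κ l : Type*} (e : κ ⊕ l ≃ ι) {S₁ S₂ : Submodule K V}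
    (hS : Disjoint S₁ S₂) {B : κ → V} {C : l → V} (hB : LinearIndependent K B)
    (hC : LinearIndependent K C) (hBS : ∀ j, B j ∈ S₁) (hCS : ∀ j, C j ∈ S₂) :
    LinearIndependent K (Sum.elim B C ∘ e.symm) :=
  (hB.sum_type hC (hS.mono (Submodule.span_le.mpr (by rintro _ ⟨j, rfl⟩; exact hBS j))
    (Submodule.span_le.mpr (by rintro _ ⟨j, rfl⟩; exact hCS j)))).comp _ e.symm.injective

theorem joinMap_mem {ι κ l : Type*} [Fintype ι] [DecidableEq ι] [Fintype κ] [DecidableEq κ]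
    [Fintype l] [DecidableEq l]
    (e : κ ⊕ l ≃ ι) {S₁ S₂ : Submodule K V} (hS : Disjoint S₁ S₂)
    {a : SubspaceChain K V κ → ℚ} (ha : a ∈ frameSpan κ S₁)
    {h : SubspaceChain K V l → ℚ} (hh : h ∈ frameSpan l S₂) :
    joinMap e a h ∈ frameSpan ι (S₁ ⊔ S₂) := by
  refine map_mem_of_frameSpan (f := joinMap e a) (fun C hC hCS => ?_) hh
  refine map_mem_of_frameSpan (f := (joinMap e).flip (frameFun C)) (fun B hB hBS => ?_) ha
  rw [LinearMap.flip_apply, joinMap_frameFun]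
  refine frameFun_mem_frameSpan (linearIndependent_sumElim e hS hB hC hBS hCS) fun j => ?_
  rcases h1 : e.symm j with i | i
  · simpa [h1] using Submodule.mem_sup_left (hBS i)
  · simpa [h1] using Submodule.mem_sup_right (hCS i)
variable [Finite V] {ω : LinearMap.BilinForm K V}

/-- The trace of the Dynkin operator of `U` on the span of the apartment functions of `S`. -/
def dynkinTrace (hω : ω.IsAlt) {S : Submodule K V} {n : ℕ} (hS : finrank K S = n)
    (U : SymplecticSubspace ω) (hUS : U.1 ≤ S) : ℚ :=
  LinearMap.trace ℚ (frameSpan (Fin n) S)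
    ((dynkinOp ω S n U).restrict fun _ hx => dynkinOp_mem hω hS hUS hx)

/-- The Dynkin operator of `V` annihilates the products and is multiplication by the dimension modulo
products. Hence its trace is the product of the dimension of `V` and the dimension of the quotient. -/
theorem finrank_mul_finrank_quotient (hω : ω.IsAlt) (hnd : ω.Nondegenerate) {n : ℕ}
    (hV : finrank K (⊤ : Submodule K V) = n) (hn : n ≠ 0) (X : SymplecticSubspace ω)
    (hX : X.1 = ⊤) :
    (n : ℚ) * finrank ℚ (frameSpan (Fin n) (⊤ : Submodule K V) ⧸
      (separatedSpan ω n).submoduleOf (frameSpan (Fin n) (⊤ : Submodule K V))) =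
      dynkinTrace hω hV X le_top := by
  classical
  have hV' : finrank K V = n := by rw [← hV, finrank_top]
  have hn' : (n : ℚ) ≠ 0 := by exact_mod_cast hn
  set E := frameSpan (Fin n) (⊤ : Submodule K V)
  have hproj : ∀ x ∈ E, symplProj ω ⊤ n X x = x := fun x hx =>
    eqOn_frameSpan (g := LinearMap.id) (fun B hB _ =>
      symplProj_frameFun_self hω hV' X hB fun j => Or.inr (by rw [hX]; trivial)) hx
  have hmod : ∀ x ∈ E, (n : ℚ) • x - dynkinOp ω ⊤ n X x ∈ separatedSpan ω n := by
    intro x hx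
    rw [dynkinOp_apply, hproj x hx, hX, hV, sub_sub_cancel]
    refine Submodule.sum_mem _ fun W hW => ?_
    have hWX := (Finset.mem_filter.mp hW).2
    exact dynkinOp_mem_separatedSpan hω hV' (fun h => hWX.not_ge (by
      change X.1 ≤ W.1
      rw [h]
      exact le_top)) hx
  have hkill : ∀ x ∈ separatedSpan ω n, dynkinOp ω ⊤ n X x = 0 := by
    intro x hx
    have : separatedSpan ω n ≤ LinearMap.ker (dynkinOp ω ⊤ n X) := Submodule.span_le.mpr (by
      rintro _ ⟨B, hB, ⟨S₁, S₂, h1, h2, h3, h4, h5⟩, rfl⟩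
      exact dynkinOp_frameFun_eq_zero hω hnd hV' X h1 h2 (by rw [hX, h3.sup_eq_top]) h4 hB
        fun j => Or.inr (h5 j))
    exact this hx
  let N : Module.End ℚ E :=
    (dynkinOp ω ⊤ n X).restrict fun _ hx => dynkinOp_mem hω hV le_top hx
  -- divided by the dimension, the operator is a projection whose kernel consists of the products
  let N' : Module.End ℚ E := (n : ℚ)⁻¹ • N
  have hker : LinearMap.ker N' = (separatedSpan ω n).submoduleOf E := by
    ext ⟨x, hx⟩
    constructor
    · intro h
      have h1 : (n : ℚ)⁻¹ • dynkinOp ω ⊤ n X x = 0 := congrArg Subtype.val h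
      have h2 : dynkinOp ω ⊤ n X x = 0 :=
        (smul_eq_zero.mp h1).resolve_left (inv_ne_zero hn')
      have h3 := hmod x hx
      rw [h2, sub_zero] at h3
      change x ∈ separatedSpan ω n
      have := Submodule.smul_mem _ (n : ℚ)⁻¹ h3
      rwa [inv_smul_smul₀ hn'] at this
    · intro h
      refine Subtype.ext ?_
      change (n : ℚ)⁻¹ • dynkinOp ω ⊤ n X x = 0
      rw [hkill x h, smul_zero]
  have hidem : IsIdempotentElem N' := by
    refine LinearMap.ext fun x => ?_
    rw [Module.End.mul_apply]
    have h1 : x - N' x ∈ LinearMap.ker N' := by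
      rw [hker]
      change x.1 - (n : ℚ)⁻¹ • dynkinOp ω ⊤ n X x.1 ∈ separatedSpan ω n
      have := Submodule.smul_mem _ (n : ℚ)⁻¹ (hmod x.1 x.2)
      rwa [smul_sub, inv_smul_smul₀ hn'] at this
    rw [LinearMap.mem_ker, map_sub, sub_eq_zero] at h1
    exact h1.symm
  rw [← hker, ← trace_eq_finrank_quotient_ker hidem]
  simp only [N', map_smul, smul_eq_mul]
  rw [mul_inv_cancel_left₀ hn']
  rfl

/-! ### Compatibility of the Dynkin operators with products -/

section Join

variable {κ : Type*} [Fintype κ] [DecidableEq κ]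

/-- If `W ≤ U`, the projection for `W` acts on products of `S ⊓ Uᗮ` and `U` through the second
factor. -/
theorem symplProj_joinMap (hω : ω.IsAlt) {S : Submodule K V} {n : ℕ} (hS : finrank K S = n)
    {U W : SymplecticSubspace ω} (hUS : U.1 ≤ S) (hWU : W.1 ≤ U.1) {k : ℕ}
    (hU : finrank K U.1 = k) (e : κ ⊕ Fin k ≃ Fin n)
    {a : SubspaceChain K V κ → ℚ} (ha : a ∈ frameSpan κ (S ⊓ ω.orthogonal U.1))
    {h : SubspaceChain K V (Fin k) → ℚ} (hh : h ∈ frameSpan (Fin k) U.1) :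
    symplProj ω S n W (joinMap e a h) = joinMap e a (symplProj ω U.1 k W h) := by
  classical
  refine eqOn_frameSpan (f := symplProj ω S n W ∘ₗ joinMap e a)
    (g := joinMap e a ∘ₗ symplProj ω U.1 k W) (fun C hC hCU => ?_) hh
  refine eqOn_frameSpan (f := symplProj ω S n W ∘ₗ (joinMap e).flip (frameFun C))
    (g := (joinMap e).flip (symplProj ω U.1 k W (frameFun C))) (fun B hB hBS => ?_) ha
  simp only [LinearMap.comp_apply, LinearMap.flip_apply, joinMap_frameFun]
  have hWS : W.1 ≤ S := hWU.trans hUS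
  have hLI := linearIndependent_sumElim e (disjoint_inf_orthogonal U.2.2) hB hC hBS hCU
  have hBW : ∀ i, B i ∈ S ⊓ ω.orthogonal W.1 := fun i =>
    ⟨(hBS i).1, LinearMap.BilinForm.orthogonal_le hWU (hBS i).2⟩
  have hCW : ∀ i, C i ∈ S ⊓ ω.orthogonal W.1 ↔ C i ∈ U.1 ⊓ ω.orthogonal W.1 := fun i =>
    ⟨fun h => ⟨hCU i, h.2⟩, fun h => ⟨hUS h.1, h.2⟩⟩
  have hmem : ∀ j, (Sum.elim B C ∘ e.symm) j ∈ S ⊓ ω.orthogonal W.1 ⊔ W.1 := by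
    rw [inf_orthogonal_sup_eq hω W.2.2 hWS]
    intro j
    rcases h1 : e.symm j with i | i
    · simpa [h1] using (hBS i).1
    · simpa [h1] using hUS (hCU i)
  have hCmem : ∀ j, C j ∈ U.1 ⊓ ω.orthogonal W.1 ⊔ W.1 := by
    rw [inf_orthogonal_sup_eq hω W.2.2 hWU]
    exact hCU
  have hcount : memCount (Sum.elim B C ∘ e.symm) (S ⊓ ω.orthogonal W.1) =
      Fintype.card κ + memCount C (U.1 ⊓ ω.orthogonal W.1) := by
    unfold memCount
    rw [Finset.card_filter, Finset.card_filter, ← Equiv.sum_comp e, Fintype.sum_sum_type]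
    simp [hBW, hCW]
  have hd1 := finrank_inf_orthogonal_add hω W.2.2 hWS
  have hd2 := finrank_inf_orthogonal_add hω W.2.2 hWU
  have hd3 := Fintype.card_congr e
  rw [Fintype.card_sum, Fintype.card_fin, Fintype.card_fin] at hd3
  have hspec := symplProj_spec hω hS hWS _ hLI hmem
  have hspec' := symplProj_spec hω hU hWU _ hC hCmem
  by_cases hc : memCount C (U.1 ⊓ ω.orthogonal W.1) = finrank K ↥(U.1 ⊓ ω.orthogonal W.1)
  · obtain ⟨D, hD⟩ := exists_isProjFrame hCmem
    rw [hspec'.1 hc D hD, joinMap_frameFun,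
      hspec.1 (by rw [hcount]; omega) (Sum.elim B D ∘ e.symm) fun j => ?_]
    rcases h1 : e.symm j with i | i
    · left
      simpa [h1] using hBW i
    · simp only [Function.comp_apply, h1, Sum.elim_inr, hCW]
      exact (hD i).imp_right fun h => ⟨h.1, h.2.1, hUS h.2.2.1, h.2.2.2⟩
  · rw [hspec'.2 hc, map_zero, hspec.2 (by rw [hcount]; omega)]

theorem dynkinOp_joinMap (hω : ω.IsAlt) {S : Submodule K V} {n : ℕ} (hS : finrank K S = n)
    {U W : SymplecticSubspace ω} (hUS : U.1 ≤ S) (hWU : W.1 ≤ U.1) {k : ℕ}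
    (hU : finrank K U.1 = k) (e : κ ⊕ Fin k ≃ Fin n)
    {a : SubspaceChain K V κ → ℚ} (ha : a ∈ frameSpan κ (S ⊓ ω.orthogonal U.1))
    {h : SubspaceChain K V (Fin k) → ℚ} (hh : h ∈ frameSpan (Fin k) U.1) :
    dynkinOp ω S n W (joinMap e a h) = joinMap e a (dynkinOp ω U.1 k W h) := by
  classical
  induction W using WellFoundedLT.induction generalizing h with
  | ind W ih =>
    rw [dynkinOp_apply, dynkinOp_apply, symplProj_joinMap hω hS hUS hWU hU e ha hh, map_sub,
      map_smul, map_sum]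
    congr 1
    refine Finset.sum_congr rfl fun Y hY => ?_
    have hYW : Y < W := (Finset.mem_filter.mp hY).2
    exact ih Y hYW (le_trans (show Y.1 ≤ W.1 from hYW.le) hWU) (symplProj_mem hω hU hWU hh)

end Join

/-- The Dynkin operator of `U` acts on the apartment functions of `S` as the identity on `S ⊓ Uᗮ`
tensored with the Dynkin operator on `U`. -/
theorem dynkinTrace_eq [Finite K] (hω : ω.IsAlt) {S : Submodule K V} {n : ℕ}
    (hS : finrank K S = n) {k : ℕ} (U : SymplecticSubspace ω) (hU : finrank K U.1 = k)
    (hUS : U.1 ≤ S) :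
    dynkinTrace hω hS U hUS =
      (Nat.card K : ℚ) ^ (n - k).choose 2 * dynkinTrace hω hU U le_rfl := by
  subst hU
  set e := splitEquiv hω U.2.2 hUS hS
  have hdisj := disjoint_inf_orthogonal (S := S) U.2.2
  have hsup := inf_orthogonal_sup_eq hω U.2.2 hUS
  have hdim : finrank K ↥(S ⊓ ω.orthogonal U.1) = n - finrank K U.1 := by
    have := finrank_inf_orthogonal_add hω U.2.2 hUS
    omega
  obtain ⟨F, a, ha, haF, hP⟩ := exists_isFrameProj hdisj (Fintype.card_fin _).symm e
  let E := frameSpan (Fin n) S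
  let E' := frameSpan (Fin (finrank K U.1)) U.1
  let N' : Module.End ℚ E' := (dynkinOp ω U.1 (finrank K U.1) U).restrict
    fun _ hx => dynkinOp_mem hω rfl le_rfl hx
  let m : ∀ i, E' →ₗ[ℚ] E := fun i => (joinMap e (a i)).restrict fun x hx => by
    have := joinMap_mem e hdisj (ha i) hx
    rwa [hsup] at this
  let r : ∀ i, E →ₗ[ℚ] E' := fun i => (residue e (S ⊓ ω.orthogonal U.1) U.1 (F i)).restrict
    fun x hx => residue_mem e hdisj (Fintype.card_fin _).symm (F i) (by rwa [hsup])
  have hrm : ∀ i, r i ∘ₗ m i = LinearMap.id := by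
    intro i
    refine LinearMap.ext fun x => Subtype.ext ?_
    change residue e (S ⊓ ω.orthogonal U.1) U.1 (F i) (joinMap e (a i) x.1) = x.1
    rw [residue_joinMap e hdisj (F i) (ha i) x.2, haF, one_smul]
  -- the operator is a sum of copies of the operator `N'` on the functions of `U`, one for each
  -- member of a basis of the factor `S ⊓ Uᗮ`
  have hfact : (dynkinOp ω S n U).restrict (fun _ hx => dynkinOp_mem hω hS hUS hx) =
      ∑ i, m i ∘ₗ (N' ∘ₗ r i) := by
    refine LinearMap.ext fun x => Subtype.ext ?_
    have h1 : dynkinOp ω S n U x.1 = dynkinOp ω S n U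
        ((∑ i, joinMap e (a i) ∘ₗ residue e (S ⊓ ω.orthogonal U.1) U.1 (F i)) x.1) := by
      rw [← dynkinOp_symplProj hω hS hUS x.2]
      congr 1
      exact (symplProj_spec hω hS hUS).eq_of_mem hP (by rw [hsup]; exact x.2)
    rw [LinearMap.sum_apply, AddSubmonoidClass.coe_finsetSum]
    change dynkinOp ω S n U x.1 = _
    rw [h1, LinearMap.sum_apply, map_sum]
    refine Finset.sum_congr rfl fun i _ => ?_
    exact dynkinOp_joinMap hω hS hUS le_rfl rfl e (ha i) (r i x).2
  have htr : ∀ i, LinearMap.trace ℚ E (m i ∘ₗ (N' ∘ₗ r i)) = LinearMap.trace ℚ E' N' := by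
    intro i
    rw [LinearMap.trace_comp_comm', LinearMap.comp_assoc, hrm, LinearMap.comp_id]
  rw [dynkinTrace, hfact, map_sum, Finset.sum_congr rfl fun i _ => htr i, Finset.sum_const,
    Finset.card_univ, Fintype.card_fin, finrank_frameSpan rfl, hdim, nsmul_eq_mul]
  push_cast
  rfl

open Classical in
/-- The convolution of the identity with the Dynkin operator is multiplication by the dimension; on
traces this determines the trace of the Dynkin operator recursively. -/
theorem sum_dynkinTrace [Finite K] (hω : ω.IsAlt) (X : SymplecticSubspace ω) {n : ℕ}
    (hX : finrank K X.1 = n) :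
    ∑ U ∈ Finset.univ.filter (· ≤ X), (Nat.card K : ℚ) ^ (n - finrank K U.1).choose 2 *
      dynkinTrace hω (rfl : finrank K U.1 = _) U le_rfl =
      n * (Nat.card K : ℚ) ^ n.choose 2 := by
  have hproj : ∀ x ∈ frameSpan (Fin n) X.1, symplProj ω X.1 n X x = x := fun x hx =>
    eqOn_frameSpan (g := LinearMap.id) (fun B hB hBX => by
      have hbot : X.1 ⊓ ω.orthogonal X.1 = ⊥ := X.2.2.eq_bot
      refine (symplProj_spec hω hX le_rfl B hB fun j => Submodule.mem_sup_right (hBX j)).1 ?_ B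
        (isProjFrame_self fun j => Or.inr (hBX j))
      have := memCount_le_finrank hB (X.1 ⊓ ω.orthogonal X.1)
      rw [hbot, finrank_bot] at this ⊢
      omega) hx
  have hsum : ∑ U : {U // U ≤ X}, (dynkinOp ω X.1 n U.1).restrict
      (fun _ hx => dynkinOp_mem hω hX U.2 hx) =
      (n : ℚ) • (LinearMap.id : Module.End ℚ (frameSpan (Fin n) X.1)) := by
    refine LinearMap.ext fun x => Subtype.ext ?_
    have h1 := sum_dynkinOp (hproj x.1 x.2)
    rw [hX] at h1
    rw [LinearMap.sum_apply, AddSubmonoidClass.coe_finsetSum]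
    rw [← Finset.sum_subtype_eq_sum_filter, Finset.subtype_univ] at h1
    exact h1
  have htr := congrArg (LinearMap.trace ℚ _) hsum
  rw [map_sum, map_smul, LinearMap.trace_id, finrank_frameSpan hX] at htr
  rw [← Finset.sum_subtype_eq_sum_filter, Finset.subtype_univ]
  refine Eq.trans (Finset.sum_congr rfl fun U _ => ?_) (htr.trans (by simp))
  exact (dynkinTrace_eq hω hX U.1 rfl U.2).symm

end DynkinTraces

/-! ### Counting hyperbolic families and symplectic subspaces -/

noncomputable section SymplecticCounting

open Module

variable {K V : Type*} [Field K] [AddCommGroup V] [Module K V]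

/-- The hyperbolic families `e_1, …, e_j, f_1, …, f_j` in `S`: all pairings vanish except
`ω (e_i, f_i) = 1`. -/
def HyperbolicFamily (ω : LinearMap.BilinForm K V) (S : Submodule K V) (j : ℕ) : Type _ :=
  {p : (Fin j → V) × (Fin j → V) // (∀ i, p.1 i ∈ S) ∧ (∀ i, p.2 i ∈ S) ∧
    (∀ i k, ω (p.1 i) (p.1 k) = 0) ∧ (∀ i k, ω (p.2 i) (p.2 k) = 0) ∧
    ∀ i k, ω (p.1 i) (p.2 k) = if i = k then 1 else 0}

/-- The number of hyperbolic bases of a symplectic space of dimension `2 * k` over a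
field with `q` elements. -/
def symplecticOrder (q k : ℕ) : ℕ :=
  ∏ i ∈ Finset.range k, (q ^ (2 * k - 2 * i) - 1) * q ^ (2 * k - 2 * i - 1)

variable {ω : LinearMap.BilinForm K V}

theorem mem_orthogonal_span_pair_iff {e f x : V} :
    x ∈ ω.orthogonal (Submodule.span K {e, f}) ↔ ω e x = 0 ∧ ω f x = 0 := by
  constructor
  · exact fun h => ⟨h e (Submodule.subset_span (by simp)), h f (Submodule.subset_span (by simp))⟩
  · rintro ⟨h1, h2⟩ y hy
    obtain ⟨a, b, rfl⟩ := Submodule.mem_span_pair.mp hy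
    change ω (a • e + b • f) x = 0
    simp [h1, h2]

theorem disjoint_span_pair (hω : ω.IsAlt) {e f : V} (h : ω e f = 1) :
    Disjoint (Submodule.span K {e, f}) (ω.orthogonal (Submodule.span K {e, f})) := by
  rw [Submodule.disjoint_def]
  intro x hx hx'
  obtain ⟨h1, h2⟩ := mem_orthogonal_span_pair_iff.mp hx'
  obtain ⟨a, b, rfl⟩ := Submodule.mem_span_pair.mp hx
  have h3 : ω f e = -1 := by rw [← hω.neg_eq e f, h]
  simp only [map_add, map_smul, hω.self_eq_zero, h, h3, smul_eq_mul, mul_zero, mul_one, zero_add,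
    add_zero, mul_neg, neg_eq_zero] at h1 h2
  simp [h1, h2]

theorem finrank_span_pair (hω : ω.IsAlt) {e f : V} (h : ω e f = 1) :
    finrank K (Submodule.span K {e, f}) = 2 := by
  have h3 : ω f e = -1 := by rw [← hω.neg_eq e f, h]
  have hLI : LinearIndependent K ![e, f] := by
    rw [LinearIndependent.pair_iff]
    intro a b hab
    have h1 : ω e (a • e + b • f) = 0 := by rw [hab, map_zero]
    have h2 : ω f (a • e + b • f) = 0 := by rw [hab, map_zero]
    simp only [map_add, map_smul, hω.self_eq_zero, h, h3, smul_eq_mul, mul_zero, mul_one, zero_add,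
      add_zero, mul_neg, neg_eq_zero] at h1 h2
    exact ⟨h2, h1⟩
  have := finrank_span_eq_card hLI
  rwa [Matrix.range_cons_cons_empty, Fintype.card_fin] at this

/-- The span of a hyperbolic family. -/
def HyperbolicFamily.span {S : Submodule K V} {j : ℕ} (B : HyperbolicFamily ω S j) :
    Submodule K V :=
  Submodule.span K (Set.range (Sum.elim B.1.1 B.1.2))

theorem HyperbolicFamily.span_le {S : Submodule K V} {j : ℕ} (B : HyperbolicFamily ω S j) :
    B.span ≤ S := by
  refine Submodule.span_le.mpr ?_
  rintro _ ⟨i | i, rfl⟩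
  · exact B.2.1 i
  · exact B.2.2.1 i

theorem HyperbolicFamily.coeff_eq_zero (hω : ω.IsAlt) {S : Submodule K V} {j : ℕ}
    (B : HyperbolicFamily ω S j) {c : Fin j ⊕ Fin j → K}
    (h : ∀ a, ω (Sum.elim B.1.1 B.1.2 a) (∑ b, c b • Sum.elim B.1.1 B.1.2 b) = 0) : c = 0 := by
  obtain ⟨-, -, hee, hff, hef⟩ := B.2
  have hfe : ∀ i k, ω (B.1.2 i) (B.1.1 k) = if k = i then -1 else 0 := by
    intro i k
    rw [← hω.neg_eq, hef]
    split_ifs <;> simp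
  funext a
  rcases a with i | i
  · simpa [Fintype.sum_sum_type, hff, hfe] using h (Sum.inr i)
  · simpa [Fintype.sum_sum_type, hee, hef] using h (Sum.inl i)

theorem HyperbolicFamily.finrank_span (hω : ω.IsAlt) {S : Submodule K V} {j : ℕ}
    (B : HyperbolicFamily ω S j) : finrank K B.span = 2 * j := by
  have : LinearIndependent K (Sum.elim B.1.1 B.1.2) := by
    rw [Fintype.linearIndependent_iff]
    intro c hc a
    rw [B.coeff_eq_zero hω (c := c) fun a => by rw [hc, map_zero]]
    rfl
  rw [HyperbolicFamily.span, finrank_span_eq_card this]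
  simp [two_mul]

theorem HyperbolicFamily.disjoint_span (hω : ω.IsAlt) {S : Submodule K V} {j : ℕ}
    (B : HyperbolicFamily ω S j) : Disjoint B.span (ω.orthogonal B.span) := by
  rw [Submodule.disjoint_def]
  intro x hx hx'
  obtain ⟨c, rfl⟩ := (Submodule.mem_span_range_iff_exists_fun K).mp hx
  rw [B.coeff_eq_zero hω (c := c) fun a => hx' _ (Submodule.subset_span ⟨a, rfl⟩)]
  simp

variable [Finite V]

instance (S : Submodule K V) (j : ℕ) : Finite (HyperbolicFamily ω S j) := Subtype.finite

/-- The pairs in `S` that can start a hyperbolic family. -/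
abbrev HyperbolicPair (ω : LinearMap.BilinForm K V) (S : Submodule K V) : Type _ :=
  {p : S × S // ω p.1 p.2 = 1}

theorem natCard_hyperbolicPair {S : Submodule K V} {m : ℕ}
    (hS : finrank K S = m) (hdisj : Disjoint S (ω.orthogonal S)) (hω : ω.IsAlt) :
    Nat.card (HyperbolicPair ω S) = (Nat.card K ^ m - 1) * Nat.card K ^ (m - 1) := by
  classical
  have : Fintype S := Fintype.ofFinite S
  have e : HyperbolicPair ω S ≃ Σ x : S, {y : S // (ω x ∘ₗ S.subtype) y = 1} :=
    { toFun := fun p => ⟨p.1.1, p.1.2, p.2⟩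
      invFun := fun p => ⟨(p.1, p.2.1), p.2.2⟩
      left_inv := fun _ => rfl
      right_inv := fun _ => rfl }
  have hx : ∀ x : S, x ≠ 0 → Nat.card {y : S // (ω x ∘ₗ S.subtype) y = 1} =
      Nat.card K ^ (m - 1) := by
    intro x hx
    have hne : ω x ∘ₗ S.subtype ≠ 0 := by
      intro h
      refine hx (Subtype.ext (Submodule.disjoint_def.mp hdisj x.1 x.2 fun y hy => ?_))
      exact hω.isRefl _ _ (LinearMap.congr_fun h ⟨y, hy⟩)
    have hm : m ≠ 0 := by
      rintro rfl
      exact hx (Subtype.ext (by simpa [Submodule.finrank_eq_zero.mp hS] using x.2))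
    exact natCard_setOf_dual_eq_one (by omega) hne
  have h0 : Nat.card {y : S // (ω (0 : S) ∘ₗ S.subtype) y = 1} = 0 := by
    rw [Nat.card_eq_zero]
    left
    exact ⟨fun y => by simpa using y.2⟩
  rw [Nat.card_congr e, Nat.card_sigma, ← Finset.add_sum_erase _ _ (Finset.mem_univ (0 : S)), h0,
    zero_add, Finset.sum_congr rfl fun x hx' => hx x (Finset.ne_of_mem_erase hx'), Finset.sum_const,
    Finset.card_erase_of_mem (Finset.mem_univ _), Finset.card_univ, ← Nat.card_eq_fintype_card,
    natCard_eq_pow_finrank (K := K), hS, smul_eq_mul]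

/-- A hyperbolic family consists of a hyperbolic pair and a hyperbolic family orthogonal to it. -/
def hyperbolicFamilyEquiv (hω : ω.IsAlt) (S : Submodule K V) (j : ℕ) :
    HyperbolicFamily ω S (j + 1) ≃ Σ p : HyperbolicPair ω S,
      HyperbolicFamily ω (S ⊓ ω.orthogonal (Submodule.span K {p.1.1.1, p.1.2.1})) j where
  toFun B := ⟨⟨(⟨B.1.1 0, B.2.1 0⟩, ⟨B.1.2 0, B.2.2.1 0⟩), by simpa using B.2.2.2.2.2 0 0⟩,
    ⟨(fun i => B.1.1 i.succ, fun i => B.1.2 i.succ),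
      fun i => ⟨B.2.1 _, mem_orthogonal_span_pair_iff.mpr
        ⟨B.2.2.2.1 0 i.succ, hω.isRefl _ _ (by simpa using B.2.2.2.2.2 i.succ 0)⟩⟩,
      fun i => ⟨B.2.2.1 _, mem_orthogonal_span_pair_iff.mpr
        ⟨by simpa [(Fin.succ_ne_zero i).symm] using B.2.2.2.2.2 0 i.succ, B.2.2.2.2.1 0 i.succ⟩⟩,
      fun i k => B.2.2.2.1 _ _, fun i k => B.2.2.2.2.1 _ _,
      fun i k => by simpa using B.2.2.2.2.2 i.succ k.succ⟩⟩
  invFun p := ⟨(Fin.cons p.1.1.1.1 p.2.1.1, Fin.cons p.1.1.2.1 p.2.1.2), by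
    obtain ⟨⟨⟨⟨e, he⟩, ⟨f, hf⟩⟩, hef⟩, ⟨⟨a, b⟩, ha, hb, haa, hbb, hab⟩⟩ := p
    have ha' := fun i => mem_orthogonal_span_pair_iff.mp (ha i).2
    have hb' := fun i => mem_orthogonal_span_pair_iff.mp (hb i).2
    simp only at hef ha hb haa hbb hab ha' hb' ⊢
    refine ⟨fun i => ?_, fun i => ?_, fun i k => ?_, fun i k => ?_, fun i k => ?_⟩
    · induction i using Fin.cases with
      | zero => exact he
      | succ i => exact (ha i).1
    · induction i using Fin.cases with
      | zero => exact hf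
      | succ i => exact (hb i).1
    · induction i using Fin.cases with
      | zero =>
        induction k using Fin.cases with
        | zero => exact hω.self_eq_zero _
        | succ k => exact (ha' k).1
      | succ i =>
        induction k using Fin.cases with
        | zero => exact hω.isRefl _ _ (ha' i).1
        | succ k => exact haa i k
    · induction i using Fin.cases with
      | zero =>
        induction k using Fin.cases with
        | zero => exact hω.self_eq_zero _
        | succ k => exact (hb' k).2
      | succ i =>
        induction k using Fin.cases with
        | zero => exact hω.isRefl _ _ (hb' i).2
        | succ k => exact hbb i k
    · induction i using Fin.cases with
      | zero =>
        induction k using Fin.cases with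
        | zero => simpa using hef
        | succ k => simpa [(Fin.succ_ne_zero k).symm] using (hb' k).1
      | succ i =>
        induction k using Fin.cases with
        | zero => simpa using hω.isRefl _ _ (ha' i).2
        | succ k => simpa using hab i k⟩
  left_inv B := Subtype.ext (Prod.ext (Fin.cons_self_tail B.1.1) (Fin.cons_self_tail B.1.2))
  right_inv _ := rfl

/-- Splitting off hyperbolic pairs shows that symplectic spaces have even dimension, and counts the
hyperbolic families in them. -/
theorem even_finrank_and_natCard_hyperbolicFamily (hω : ω.IsAlt) (m : ℕ) :
    ∀ S : Submodule K V, finrank K S = m → Disjoint S (ω.orthogonal S) → Even m ∧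
      ∀ j, 2 * j ≤ m → Nat.card (HyperbolicFamily ω S j) =
        ∏ i ∈ Finset.range j, (Nat.card K ^ (m - 2 * i) - 1) * Nat.card K ^ (m - 2 * i - 1) := by
  induction m using Nat.strong_induction_on with
  | _ m ih =>
    intro S hS hdisj
    have hpair : ∀ p : HyperbolicPair ω S, ∃ m', m' + 2 = m ∧ finrank K
        ↥(S ⊓ ω.orthogonal (Submodule.span K {p.1.1.1, p.1.2.1})) = m' ∧
        Disjoint (S ⊓ ω.orthogonal (Submodule.span K {p.1.1.1, p.1.2.1}))
          (ω.orthogonal (S ⊓ ω.orthogonal (Submodule.span K {p.1.1.1, p.1.2.1}))) := by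
      intro p
      have hle : Submodule.span K {p.1.1.1, p.1.2.1} ≤ S := by
        rw [Submodule.span_le]
        rintro x (rfl | rfl)
        · exact p.1.1.2
        · exact p.1.2.2
      have h1 := finrank_inf_orthogonal_add hω (disjoint_span_pair hω p.2) hle
      rw [finrank_span_pair hω p.2, hS] at h1
      refine ⟨_, h1, rfl, disjoint_orthogonal_of_sup hdisj
        (inf_orthogonal_sup_eq hω (disjoint_span_pair hω p.2) hle) fun x hx y hy => hy.2 x hx⟩
    have hcard := natCard_hyperbolicPair hS hdisj hω
    constructor
    · rcases Nat.eq_zero_or_pos m with rfl | hm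
      · exact Even.zero
      · have hne : S ≠ ⊥ := by
          rintro rfl
          rw [finrank_bot] at hS
          omega
        obtain ⟨x, hxS, hx⟩ := Submodule.exists_mem_ne_zero_of_ne_bot hne
        obtain ⟨y, hyS, hxy⟩ : ∃ y ∈ S, ω x y ≠ 0 := by
          by_contra! h
          exact hx (Submodule.disjoint_def.mp hdisj x hxS fun y hy => hω.isRefl _ _ (h y hy))
        obtain ⟨m', hm', h1, h2⟩ := hpair ⟨(⟨x, hxS⟩, ⟨(ω x y)⁻¹ • y, S.smul_mem _ hyS⟩), by
          simp [hxy]⟩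
        rw [← hm', Nat.even_add]
        simp [(ih m' (by omega) _ h1 h2).1]
    · intro j hj
      cases j with
      | zero =>
        rw [Finset.range_zero, Finset.prod_empty, Nat.card_eq_one_iff_unique]
        refine ⟨⟨fun a b => Subtype.ext (Subsingleton.elim _ _)⟩, ⟨⟨(Fin.elim0, Fin.elim0), ?_⟩⟩⟩
        exact ⟨fun i => i.elim0, fun i => i.elim0, fun i => i.elim0, fun i => i.elim0,
          fun i => i.elim0⟩
      | succ j =>
        classical
        have : Fintype (HyperbolicPair ω S) := Fintype.ofFinite _
        have hfib : ∀ p : HyperbolicPair ω S, Nat.card (HyperbolicFamily ω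
            (S ⊓ ω.orthogonal (Submodule.span K {p.1.1.1, p.1.2.1})) j) =
            ∏ i ∈ Finset.range j, (Nat.card K ^ (m - 2 * (i + 1)) - 1) *
              Nat.card K ^ (m - 2 * (i + 1) - 1) := by
          intro p
          obtain ⟨m', hm', h1, h2⟩ := hpair p
          rw [(ih m' (by omega) _ h1 h2).2 j (by omega)]
          refine Finset.prod_congr rfl fun i _ => ?_
          rw [show m' - 2 * i = m - 2 * (i + 1) by omega]
        rw [Nat.card_congr (hyperbolicFamilyEquiv hω S j), Nat.card_sigma,
          Finset.sum_congr rfl fun p _ => hfib p, Finset.sum_const, Finset.card_univ,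
          ← Nat.card_eq_fintype_card, hcard, Finset.prod_range_succ', smul_eq_mul, mul_comm]
        simp

theorem natCard_hyperbolicFamily (hω : ω.IsAlt) {S : Submodule K V} {k : ℕ}
    (hS : finrank K S = 2 * k) (hdisj : Disjoint S (ω.orthogonal S)) :
    Nat.card (HyperbolicFamily ω S k) = symplecticOrder (Nat.card K) k :=
  (even_finrank_and_natCard_hyperbolicFamily hω _ S hS hdisj).2 k le_rfl

/-- The symplectic subspaces of `S` of dimension `2 * j`. -/
abbrev SymplecticIn (ω : LinearMap.BilinForm K V) (S : Submodule K V) (j : ℕ) : Type _ :=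
  {U : Submodule K V // U ≤ S ∧ finrank K U = 2 * j ∧ Disjoint U (ω.orthogonal U)}

/-- A hyperbolic family is the same as a symplectic subspace and a hyperbolic basis of it. -/
def hyperbolicFamilyEquivSigma (hω : ω.IsAlt) (S : Submodule K V) (j : ℕ) :
    HyperbolicFamily ω S j ≃ Σ U : SymplecticIn ω S j, HyperbolicFamily ω U.1 j where
  toFun B := ⟨⟨B.span, B.span_le, B.finrank_span hω, B.disjoint_span hω⟩, ⟨B.1,
    fun i => Submodule.subset_span ⟨Sum.inl i, rfl⟩,
    fun i => Submodule.subset_span ⟨Sum.inr i, rfl⟩, B.2.2.2⟩⟩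
  invFun p := ⟨p.2.1, fun i => p.1.2.1 (p.2.2.1 i), fun i => p.1.2.1 (p.2.2.2.1 i), p.2.2.2.2⟩
  left_inv _ := rfl
  right_inv := by
    rintro ⟨⟨U, hUS, hU, hU'⟩, B⟩
    have h : B.span = U := Submodule.eq_of_le_of_finrank_eq B.span_le (by
      rw [B.finrank_span hω, hU])
    have key : ∀ {U U' : Submodule K V}, U' = U → ∀ (C : HyperbolicFamily ω U j)
        (C' : HyperbolicFamily ω U' j), C'.1 = C.1 → C' ≍ C := by
      rintro U _ rfl C C' hC
      exact heq_of_eq (Subtype.ext hC)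
    exact Sigma.ext (Subtype.ext h) (key h _ _ rfl)

theorem symplecticOrder_pos {q : ℕ} (hq : 1 < q) (k : ℕ) : 0 < symplecticOrder q k := by
  refine Finset.prod_pos fun i hi => Nat.mul_pos ?_ (pow_pos (by omega) _)
  have := Finset.mem_range.mp hi
  have := Nat.one_lt_pow (show 2 * k - 2 * i ≠ 0 by omega) hq
  omega

theorem symplecticOrder_add (q j k : ℕ) : symplecticOrder q (j + k) =
    (∏ i ∈ Finset.range j, (q ^ (2 * (j + k) - 2 * i) - 1) * q ^ (2 * (j + k) - 2 * i - 1)) *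
      symplecticOrder q k := by
  rw [symplecticOrder, Finset.prod_range_add, symplecticOrder]
  congr 1
  refine Finset.prod_congr rfl fun i _ => ?_
  rw [show 2 * (j + k) - 2 * (j + i) = 2 * k - 2 * i by omega]

/-- The number of symplectic subspaces of dimension `2 * j` in a symplectic space of dimension
`2 * (j + k)`. -/
theorem natCard_symplecticIn_mul (hω : ω.IsAlt) {S : Submodule K V} {j k : ℕ}
    (hS : finrank K S = 2 * (j + k)) (hdisj : Disjoint S (ω.orthogonal S)) :
    Nat.card (SymplecticIn ω S j) * symplecticOrder (Nat.card K) j *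
      symplecticOrder (Nat.card K) k = symplecticOrder (Nat.card K) (j + k) := by
  have : Fintype (SymplecticIn ω S j) := Fintype.ofFinite _
  have h := Nat.card_congr (hyperbolicFamilyEquivSigma hω S j)
  rw [Nat.card_sigma, Finset.sum_congr rfl fun U _ => natCard_hyperbolicFamily hω U.2.2.1 U.2.2.2,
    Finset.sum_const, Finset.card_univ, ← Nat.card_eq_fintype_card, smul_eq_mul,
    (even_finrank_and_natCard_hyperbolicFamily hω _ S hS hdisj).2 j (by omega)] at h
  rw [symplecticOrder_add, h]

theorem standardSymplecticForm_isAlt (p g : ℕ) [Fact p.Prime] :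
    (standardSymplecticForm p g).IsAlt := by
  intro x
  rw [standardSymplecticForm, Matrix.toBilin'_apply', Matrix.J, Matrix.fromBlocks_mulVec]
  simp [dotProduct, Fintype.sum_sum_type, Matrix.neg_mulVec, mul_comm]

theorem standardSymplecticForm_nondegenerate (p g : ℕ) [Fact p.Prime] :
    (standardSymplecticForm p g).Nondegenerate :=
  LinearMap.BilinForm.nondegenerate_toBilin'_of_det_ne_zero' _ (Matrix.isUnit_det_J _ _).ne_zero

/-- The rows of a symplectic matrix form a hyperbolic basis of the standard symplectic space. -/
theorem natCard_symplecticGroup (p g : ℕ) [Fact p.Prime] :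
    Nat.card (Matrix.symplecticGroup (Fin g) (ZMod p)) =
      Nat.card (HyperbolicFamily (standardSymplecticForm p g) ⊤ g) := by
  have hform : ∀ (A : Matrix (Fin g ⊕ Fin g) (Fin g ⊕ Fin g) (ZMod p)) a b,
      standardSymplecticForm p g (A a) (A b) =
        (A * Matrix.J (Fin g) (ZMod p) * A.transpose) a b := by
    intro A a b
    rw [standardSymplecticForm, Matrix.toBilin'_apply', Matrix.mul_assoc]
    simp [Matrix.mul_apply, Matrix.mulVec, dotProduct]
  refine Nat.card_congr
    { toFun := fun A => ⟨(fun i => A.1 (Sum.inr i), fun i => A.1 (Sum.inl i)),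
        fun _ => trivial, fun _ => trivial, fun i k => ?_, fun i k => ?_, fun i k => ?_⟩
      invFun := fun B => ⟨Matrix.of (Sum.elim B.1.2 B.1.1), ?_⟩
      left_inv := fun A => Subtype.ext (funext fun a => by rcases a with i | i <;> rfl)
      right_inv := fun _ => rfl }
  · rw [hform, SymplecticGroup.mem_iff.mp A.2]
    simp [Matrix.J]
  · rw [hform, SymplecticGroup.mem_iff.mp A.2]
    simp [Matrix.J]
  · rw [hform, SymplecticGroup.mem_iff.mp A.2]
    simp [Matrix.J, Matrix.one_apply]
  · obtain ⟨⟨e, f⟩, -, -, hee, hff, hef⟩ := B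
    rw [SymplecticGroup.mem_iff]
    ext a b
    rw [← hform]
    rcases a with i | i <;> rcases b with k | k
    · change standardSymplecticForm p g (f i) (f k) = _
      rw [hff]
      simp [Matrix.J]
    · change standardSymplecticForm p g (f i) (e k) = _
      rw [← (standardSymplecticForm_isAlt p g).neg_eq, hef]
      simp [Matrix.J, Matrix.one_apply, eq_comm]
    · change standardSymplecticForm p g (e i) (f k) = _
      rw [hef]
      simp [Matrix.J, Matrix.one_apply]
    · change standardSymplecticForm p g (e i) (e k) = _
      rw [hee]
      simp [Matrix.J]

end SymplecticCounting

/-! ### The trace of the Dynkin operator -/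

noncomputable section DynkinTraceFormula

open Module

/-- In terms of generating functions: if `A (x) = (1 - x) A (Q x)` and
`C (x) = ∑ x ^ j / (Q ^ j - 1)`, then `A C = x A'`. -/
theorem sum_div_pow_sub_one {Q : ℚ} (hQ : 1 < Q) {a : ℕ → ℚ}
    (ha : ∀ k, (Q ^ (k + 1) - 1) * a (k + 1) = Q ^ k * a k) (n : ℕ) :
    ∑ i ∈ Finset.range n, a i / (Q ^ (n - i) - 1) = n * a n := by
  have hpos : ∀ j, j ≠ 0 → Q ^ j - 1 ≠ 0 := fun j hj =>
    (sub_pos.mpr (one_lt_pow₀ hQ hj)).ne'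
  induction n with
  | zero => simp
  | succ n ih =>
    refine mul_left_cancel₀ (hpos (n + 1) n.succ_ne_zero) ?_
    -- `Q ^ (n + 1) - 1 = Q ^ i * (Q ^ (n + 1 - i) - 1) + (Q ^ i - 1)`
    have h1 : ∀ i ∈ Finset.range (n + 1), (Q ^ (n + 1) - 1) * (a i / (Q ^ (n + 1 - i) - 1)) =
        Q ^ i * a i + (Q ^ i - 1) * a i / (Q ^ (n + 1 - i) - 1) := by
      intro i hi
      have hi' := Finset.mem_range.mp hi
      have hne := hpos (n + 1 - i) (by omega)
      have h2 : Q ^ (n + 1) = Q ^ i * Q ^ (n + 1 - i) := by rw [← pow_add]; congr 1; omega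
      rw [h2]
      field_simp
      ring
    have h2 : ∀ i ∈ Finset.range n, (Q ^ (i + 1) - 1) * a (i + 1) / (Q ^ (n + 1 - (i + 1)) - 1) =
        Q ^ n * (a i / (Q ^ (n - i) - 1)) - Q ^ i * a i := by
      intro i hi
      have hi' := Finset.mem_range.mp hi
      have hne := hpos (n - i) (by omega)
      have h3 : Q ^ n = Q ^ i * Q ^ (n - i) := by rw [← pow_add]; congr 1; omega
      rw [ha, Nat.add_sub_add_right, h3]
      field_simp
      ring
    rw [Finset.mul_sum, Finset.sum_congr rfl h1, Finset.sum_add_distrib,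
      Finset.sum_range_succ' (fun i => (Q ^ i - 1) * a i / (Q ^ (n + 1 - i) - 1)),
      Finset.sum_congr rfl h2, Finset.sum_sub_distrib, ← Finset.mul_sum, ih,
      Finset.sum_range_succ]
    push_cast
    linear_combination (-((n : ℚ) + 1)) * ha n

theorem cast_symplecticOrder_succ {q : ℕ} (hq : 1 < q) (k : ℕ) :
    (symplecticOrder q (k + 1) : ℚ) =
      (((q : ℚ) ^ 2) ^ (k + 1) - 1) * (q : ℚ) ^ (2 * k + 1) * symplecticOrder q k := by
  rw [add_comm k 1, symplecticOrder_add, Finset.prod_range_one, Nat.cast_mul, Nat.cast_mul,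
    Nat.cast_pred (pow_pos (by omega) _), show 2 * (1 + k) - 2 * 0 = 2 * (k + 1) by omega,
    show 2 * (k + 1) - 1 = 2 * k + 1 by omega, pow_mul _ 2 (k + 1)]
  push_cast
  rw [add_comm 1 k]

theorem sum_pow_choose_div {q : ℕ} (hq : 1 < q) (k : ℕ) :
    ∑ i ∈ Finset.range k, (q : ℚ) ^ (2 * i).choose 2 / symplecticOrder q i /
      (((q : ℚ) ^ 2) ^ (k - i) - 1) = k * ((q : ℚ) ^ (2 * k).choose 2 / symplecticOrder q k) := by
  have hq' : (1 : ℚ) < q := by exact_mod_cast hq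
  refine sum_div_pow_sub_one (a := fun i => (q : ℚ) ^ (2 * i).choose 2 / symplecticOrder q i)
    (one_lt_pow₀ hq' two_ne_zero) (fun k => ?_) k
  have h1 : (2 * (k + 1)).choose 2 = (2 * k).choose 2 + (2 * k) + (2 * k + 1) := by
    rw [show 2 * (k + 1) = 2 * k + 1 + 1 by ring, Nat.choose_succ_succ' (2 * k + 1) 1,
      Nat.choose_succ_succ' (2 * k) 1, Nat.choose_one_right, Nat.choose_one_right]
    ring
  have h2 : ((q : ℚ) ^ 2) ^ (k + 1) - 1 ≠ 0 :=
    (sub_pos.mpr (one_lt_pow₀ (one_lt_pow₀ hq' two_ne_zero) k.succ_ne_zero)).ne'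
  have h3 : (symplecticOrder q k : ℚ) ≠ 0 := by exact_mod_cast (symplecticOrder_pos hq k).ne'
  have h4 : (q : ℚ) ^ (2 * k + 1) ≠ 0 := pow_ne_zero _ (by linarith)
  rw [cast_symplecticOrder_succ hq, h1, pow_add _ _ (2 * k + 1), pow_add _ _ (2 * k),
    pow_mul _ 2 k]
  field_simp

variable {K V : Type*} [Field K] [AddCommGroup V] [Module K V] [Finite V]
variable {ω : LinearMap.BilinForm K V}

open Classical in
theorem card_symplecticSubspace_le (X : SymplecticSubspace ω) {j : ℕ} (hj : j ≠ 0) :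
    ((Finset.univ.filter (· ≤ X)).filter fun U => finrank K U.1 = 2 * j).card =
      Nat.card (SymplecticIn ω X.1 j) := by
  rw [← Fintype.card_coe, ← Nat.card_eq_fintype_card]
  refine Nat.card_congr
    { toFun := fun U => ⟨U.1.1, (Finset.mem_filter.mp (Finset.mem_filter.mp U.2).1).2,
        (Finset.mem_filter.mp U.2).2, U.1.2.2⟩
      invFun := fun W => ⟨⟨W.1, fun h => ?_, W.2.2.2⟩, Finset.mem_filter.mpr
        ⟨Finset.mem_filter.mpr ⟨Finset.mem_univ _, W.2.1⟩, W.2.2.1⟩⟩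
      left_inv := fun _ => rfl
      right_inv := fun _ => rfl }
  have := W.2.2.1
  rw [h, finrank_bot] at this
  omega

/-- The trace of the Dynkin operator of a symplectic space of dimension `2 * k`. -/
theorem dynkinTrace_eq_symplecticOrder_div [Finite K] (hω : ω.IsAlt) (k : ℕ) :
    ∀ X : SymplecticSubspace ω, finrank K X.1 = 2 * k →
      dynkinTrace hω (rfl : finrank K X.1 = _) X le_rfl =
        2 * symplecticOrder (Nat.card K) k / (((Nat.card K : ℚ) ^ 2) ^ k - 1) := by
  classical
  induction k using Nat.strong_induction_on with
  | _ k ih =>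
  intro X hX
  set q := Nat.card K
  have hq : 1 < q := Finite.one_lt_card
  have hs : ∀ j, (symplecticOrder q j : ℚ) ≠ 0 := fun j => by
    exact_mod_cast (symplecticOrder_pos hq j).ne'
  have heven : ∀ U : SymplecticSubspace ω, ∃ j, j ≠ 0 ∧ finrank K U.1 = 2 * j := by
    intro U
    obtain ⟨j, hj⟩ :=
      (even_finrank_and_natCard_hyperbolicFamily hω _ U.1 rfl U.2.2).1
    refine ⟨j, ?_, by omega⟩
    rintro rfl
    exact U.2.1 (Submodule.finrank_eq_zero.mp hj)
  have hle : ∀ U ≤ X, finrank K U.1 ≤ 2 * k := fun U hU => hX ▸ Submodule.finrank_mono hU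
  -- the value claimed for the trace, weighted as in the recursion
  let v : ℕ → ℚ := fun j => 2 * symplecticOrder q j / (((q : ℚ) ^ 2) ^ j - 1)
  let f : SymplecticSubspace ω → ℚ := fun U =>
    (q : ℚ) ^ (2 * k - finrank K U.1).choose 2 * v (finrank K U.1 / 2)
  have hf : ∑ U ∈ Finset.univ.filter (· ≤ X), f U = (2 * k : ℕ) * (q : ℚ) ^ (2 * k).choose 2 := by
    rw [← Finset.sum_fiberwise_of_maps_to (t := Finset.range k)
      (g := fun U : SymplecticSubspace ω => k - finrank K U.1 / 2)]
    · have hterm : ∀ i ∈ Finset.range k, ∑ U ∈ (Finset.univ.filter (· ≤ X)).filter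
          (fun U : SymplecticSubspace ω => k - finrank K U.1 / 2 = i), f U =
          2 * symplecticOrder q k * ((q : ℚ) ^ (2 * i).choose 2 / symplecticOrder q i /
            (((q : ℚ) ^ 2) ^ (k - i) - 1)) := by
        intro i hi
        have hi' := Finset.mem_range.mp hi
        have hfilter : (Finset.univ.filter (· ≤ X)).filter
            (fun U : SymplecticSubspace ω => k - finrank K U.1 / 2 = i) =
            (Finset.univ.filter (· ≤ X)).filter fun U => finrank K U.1 = 2 * (k - i) := by
          refine Finset.filter_congr fun U hU => ?_
          obtain ⟨j, hj, hUj⟩ := heven U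
          have := hle U (Finset.mem_filter.mp hU).2
          omega
        have hconst : ∀ U ∈ (Finset.univ.filter (· ≤ X)).filter
            (fun U : SymplecticSubspace ω => finrank K U.1 = 2 * (k - i)),
            f U = (q : ℚ) ^ (2 * i).choose 2 * v (k - i) := by
          intro U hU
          simp only [f, (Finset.mem_filter.mp hU).2]
          rw [show 2 * k - 2 * (k - i) = 2 * i by omega,
            Nat.mul_div_cancel_left _ two_pos]
        rw [hfilter, Finset.sum_congr rfl hconst, Finset.sum_const,
          card_symplecticSubspace_le X (by omega), nsmul_eq_mul]
        have hN := natCard_symplecticIn_mul hω (j := k - i) (k := i) (by rw [hX]; omega) X.2.2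
        rw [Nat.sub_add_cancel hi'.le] at hN
        change _ * symplecticOrder q _ * symplecticOrder q _ = symplecticOrder q _ at hN
        rw [← hN]
        have := hs i
        push_cast
        simp only [v]
        field_simp
      rw [Finset.sum_congr rfl hterm, ← Finset.mul_sum, sum_pow_choose_div hq]
      have := hs k
      push_cast
      field_simp
    · intro U hU
      obtain ⟨j, hj, hUj⟩ := heven U
      have := hle U (Finset.mem_filter.mp hU).2
      rw [Finset.mem_range]
      omega
  have hrec := sum_dynkinTrace hω X hX
  have hXmem : X ∈ Finset.univ.filter (· ≤ X) := by simp
  rw [← hf, ← Finset.add_sum_erase _ _ hXmem, ← Finset.add_sum_erase _ f hXmem] at hrec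
  have hlt : ∀ U ∈ (Finset.univ.filter (· ≤ X)).erase X, (q : ℚ) ^ (2 * k - finrank K U.1).choose 2 *
      dynkinTrace hω (rfl : finrank K U.1 = _) U le_rfl = f U := by
    intro U hU
    obtain ⟨hne, hU⟩ := Finset.mem_erase.mp hU
    have hUX := (Finset.mem_filter.mp hU).2
    obtain ⟨j, hj, hUj⟩ := heven U
    have hjk : finrank K U.1 < finrank K X.1 :=
      Submodule.finrank_lt_finrank_of_lt (lt_of_le_of_ne hUX fun h => hne (Subtype.ext h))
    rw [ih j (by omega) U hUj]
    simp only [f, hUj, v]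
    rw [Nat.mul_div_cancel_left _ two_pos]
  rw [Finset.sum_congr rfl hlt] at hrec
  have h := add_right_cancel hrec
  have h1 : (Nat.card K : ℚ) ^ (2 * k - finrank K X.1).choose 2 = 1 := by simp [hX]
  have h2 : f X = v k := by
    simp [f, hX]
  rw [h1, one_mul, h2] at h
  exact h

end DynkinTraceFormula

/-! ### The Steinberg module as a space of functions on flags -/

noncomputable section SteinbergComparison

open Module

section OrderComplexLemmas

variable {P Q : Type*} [PartialOrder P] [PartialOrder Q]

theorem orderSimplex_apply {m : ℕ} (x : Fin m → P) (y : {y : Fin m → P // StrictMono y})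
    [Decidable (x = y.1)] : orderSimplex x y = if x = y.1 then 1 else 0 := by
  classical
  by_cases hx : StrictMono x
  · rw [orderSimplex_of_strictMono hx, Finsupp.single_apply]
    exact if_congr Subtype.ext_iff rfl rfl
  · rw [orderSimplex_of_not hx, if_neg (fun h : x = y.1 => hx (h ▸ y.2))]
    rfl

theorem orderChainMap_orderSimplex (f : P →o Q) {m : ℕ} {x : Fin m → P} (hx : Monotone x) :
    orderChainMap f m (orderSimplex x) = orderSimplex (f ∘ x) := by
  by_cases h : StrictMono x
  · rw [orderSimplex_of_strictMono h, orderChainMap, Finsupp.linearCombination_single, one_smul]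
  · rw [orderSimplex_of_not h, map_zero, orderSimplex_of_not]
    intro h'
    refine h fun a b hab => lt_of_le_of_ne (hx hab.le) fun heq => (h' hab).ne ?_
    simp [heq]

theorem orderBoundary_apply [Finite P] {m : ℕ} (c : OrderChains P (m + 1))
    (y : {y : Fin m → P // StrictMono y}) [Fintype {x : Fin (m + 1) → P // StrictMono x}]
    [DecidableEq P] :
    orderBoundary P m c y = ∑ x, c x * ∑ i : Fin (m + 1),
      (-1 : ℚ) ^ (i : ℕ) * if x.1 ∘ i.succAbove = y.1 then 1 else 0 := by
  classical
  rw [orderBoundary, Finsupp.linearCombination_apply, Finsupp.sum_fintype _ _ (by simp),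
    Finsupp.finsetSum_apply]
  refine Finset.sum_congr rfl fun x _ => ?_
  rw [Finsupp.smul_apply, Finsupp.finsetSum_apply, smul_eq_mul]
  congr 1
  refine Finset.sum_congr rfl fun i _ => ?_
  rw [Finsupp.smul_apply, Finsupp.single_apply, smul_eq_mul]
  congr 1
  exact if_congr Subtype.ext_iff rfl rfl

end OrderComplexLemmas

theorem succ_le_of_strictMono {m : ℕ} {d : Fin m → ℕ} (hd : StrictMono d) (hpos : ∀ i, 1 ≤ d i)
    (i : Fin m) : (i : ℕ) + 1 ≤ d i := by
  obtain ⟨i, hi⟩ := i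
  induction i with
  | zero => exact hpos _
  | succ i ih => exact (ih (by omega)).trans_lt (hd (Fin.mk_lt_mk.mpr (Nat.lt_succ_self i)))

theorem eq_succ_of_strictMono {m : ℕ} {d : Fin m → ℕ} (hd : StrictMono d) (hpos : ∀ i, 1 ≤ d i)
    (hle : ∀ i, d i ≤ m) (i : Fin m) : d i = i + 1 := by
  refine le_antisymm ?_ (succ_le_of_strictMono hd hpos i)
  have h := succ_le_of_strictMono (d := fun i => m + 1 - d i.rev)
    (fun a b hab => by
      have := hd (Fin.rev_lt_rev.mpr hab)
      have := hle a.rev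
      simp only
      omega) (fun i => by have := hle i.rev; omega) i.rev
  simp only [Fin.rev_rev, Fin.val_rev] at h
  have := hle i
  omega

variable {K V : Type*} [Field K] [AddCommGroup V] [Module K V]

/-- The complete flag of a chamber of the Tits building, completed by the whole space. -/
def flagOfChamber {r : ℕ} (x : Fin (r + 1) → TitsVertex K V) : Fin (r + 2) → Submodule K V :=
  Fin.snoc (α := fun _ => Submodule K V) (fun i => (x i).1) ⊤

theorem flagOfChamber_castSucc {r : ℕ} (x : Fin (r + 1) → TitsVertex K V) (i : Fin (r + 1)) :
    flagOfChamber x i.castSucc = (x i).1 :=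
  Fin.snoc_castSucc (α := fun _ => Submodule K V) _ _ _

theorem flagOfChamber_last {r : ℕ} (x : Fin (r + 1) → TitsVertex K V) :
    flagOfChamber x (Fin.last (r + 1)) = ⊤ :=
  Fin.snoc_last (α := fun _ => Submodule K V) _ _

/-- The chamber of the Tits building consisting of the proper members of a complete flag. -/
def chamberOfFlag {r : ℕ} (hV : finrank K V = r + 2) {F : Fin (r + 2) → Submodule K V}
    (hF : IsFullFlag ⊤ F) : {x : Fin (r + 1) → TitsVertex K V // StrictMono x} :=
  ⟨fun i => ⟨F i.castSucc, by
    have h := hF.2.1 i.castSucc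
    have hi := i.2
    rw [Fin.val_castSucc] at h
    constructor <;> intro h'
    · rw [h', finrank_bot] at h
      omega
    · rw [h', finrank_top] at h
      omega⟩, fun a b hab => by
    refine lt_of_le_of_ne (hF.1 (Fin.castSucc_le_castSucc_iff.mpr hab.le)) fun h => ?_
    have h1 := hF.2.1 a.castSucc
    rw [show F a.castSucc = F b.castSucc from congrArg Subtype.val h, hF.2.1] at h1
    exact hab.ne (Fin.ext (by simpa using h1.symm))⟩

open Classical in
/-- Chains of chambers as functions on complete flags. -/
def chamberFun {r : ℕ} (hV : finrank K V = r + 2) :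
    OrderChains (TitsVertex K V) (r + 1) →ₗ[ℚ] ((Fin (r + 2) → Submodule K V) → ℚ) where
  toFun c F := if hF : IsFullFlag ⊤ F then c (chamberOfFlag hV hF) else 0
  map_add' c d := by
    funext F
    by_cases hF : IsFullFlag ⊤ F <;> simp [hF]
  map_smul' a c := by
    funext F
    by_cases hF : IsFullFlag ⊤ F <;> simp [hF]

theorem chamberFun_of_isFullFlag {r : ℕ} (hV : finrank K V = r + 2)
    (c : OrderChains (TitsVertex K V) (r + 1)) {F : Fin (r + 2) → Submodule K V}
    (hF : IsFullFlag ⊤ F) : chamberFun hV c F = c (chamberOfFlag hV hF) := dif_pos hF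

theorem chamberFun_of_not {r : ℕ} (hV : finrank K V = r + 2)
    (c : OrderChains (TitsVertex K V) (r + 1)) {F : Fin (r + 2) → Submodule K V}
    (hF : ¬ IsFullFlag ⊤ F) : chamberFun hV c F = 0 := dif_neg hF

variable [Finite V]

theorem strictMono_finrank {m : ℕ} {x : Fin m → TitsVertex K V} (hx : StrictMono x) :
    StrictMono fun i => finrank K (x i).1 :=
  fun _ _ hab => Submodule.finrank_lt_finrank_of_lt (hx hab)

theorem one_le_finrank_titsVertex (x : TitsVertex K V) : 1 ≤ finrank K x.1 :=
  Submodule.one_le_finrank_iff.mpr x.2.1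

theorem finrank_titsVertex_lt (x : TitsVertex K V) : finrank K x.1 < finrank K V :=
  Submodule.finrank_lt x.2.2

theorem finrank_of_strictMono {r : ℕ} (hV : finrank K V = r + 2) {x : Fin (r + 1) → TitsVertex K V}
    (hx : StrictMono x) (i : Fin (r + 1)) : finrank K (x i).1 = i + 1 :=
  eq_succ_of_strictMono (strictMono_finrank hx) (fun i => one_le_finrank_titsVertex _)
    (fun i => by have := finrank_titsVertex_lt (x i); omega) i

theorem isEmpty_strictMono_titsVertex {r : ℕ} (hV : finrank K V = r + 2) :
    IsEmpty {x : Fin (r + 2) → TitsVertex K V // StrictMono x} := by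
  refine ⟨fun x => ?_⟩
  have h := succ_le_of_strictMono (strictMono_finrank x.2) (fun i => one_le_finrank_titsVertex _)
    (Fin.last (r + 1))
  have := finrank_titsVertex_lt (x.1 (Fin.last (r + 1)))
  simp only [Fin.val_last] at h
  omega

theorem isFullFlag_flagOfChamber {r : ℕ} (hV : finrank K V = r + 2)
    {x : Fin (r + 1) → TitsVertex K V} (hx : StrictMono x) : IsFullFlag ⊤ (flagOfChamber x) := by
  refine ⟨fun a b hab => ?_, fun i => ?_, fun _ => le_top⟩
  · induction b using Fin.lastCases with
    | last => exact le_top.trans (flagOfChamber_last x).ge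
    | cast b =>
      induction a using Fin.lastCases with
      | last => exact absurd hab (Fin.castSucc_lt_last b).not_ge
      | cast a =>
        rw [flagOfChamber_castSucc, flagOfChamber_castSucc]
        exact hx.monotone (Fin.castSucc_le_castSucc_iff.mp hab)
  · induction i using Fin.lastCases with
    | last => rw [flagOfChamber_last, finrank_top, hV, Fin.val_last]
    | cast i =>
      rw [flagOfChamber_castSucc, Fin.val_castSucc]
      exact finrank_of_strictMono hV hx i

theorem chamberOfFlag_flagOfChamber {r : ℕ} (hV : finrank K V = r + 2)
    (x : {x : Fin (r + 1) → TitsVertex K V // StrictMono x}) :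
    chamberOfFlag hV (isFullFlag_flagOfChamber hV x.2) = x :=
  Subtype.ext (funext fun i => Subtype.ext (flagOfChamber_castSucc x.1 i))

theorem chamberFun_flagOfChamber {r : ℕ} (hV : finrank K V = r + 2)
    (c : OrderChains (TitsVertex K V) (r + 1))
    (x : {x : Fin (r + 1) → TitsVertex K V // StrictMono x}) :
    chamberFun hV c (flagOfChamber x.1) = c x := by
  rw [chamberFun_of_isFullFlag hV c (isFullFlag_flagOfChamber hV x.2),
    chamberOfFlag_flagOfChamber]

theorem chamberFun_injective {r : ℕ} (hV : finrank K V = r + 2) :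
    Function.Injective (chamberFun (K := K) (V := V) hV) := by
  rw [injective_iff_map_eq_zero]
  intro c hc
  ext x
  rw [← chamberFun_flagOfChamber hV c x, hc]
  rfl

theorem flagOfChamber_chamberOfFlag {r : ℕ} (hV : finrank K V = r + 2)
    {F : Fin (r + 2) → Submodule K V} (hF : IsFullFlag ⊤ F) :
    flagOfChamber (chamberOfFlag hV hF).1 = F := by
  funext i
  induction i using Fin.lastCases with
  | last =>
    rw [flagOfChamber_last]
    exact (hF.eq_of_finrank (by rw [finrank_top, hV]) (by simp)).symm
  | cast i => exact flagOfChamber_castSucc _ i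

/-- At a chain of subspaces that lacks one dimension, only the insertions of a subspace of the
missing dimension contribute to the boundary. -/
theorem chamberFun_mem_flagCycles {r : ℕ} (hV : finrank K V = r + 2)
    {c : OrderChains (TitsVertex K V) (r + 1)} (hc : orderBoundary (TitsVertex K V) r c = 0) :
    chamberFun hV c ∈ flagCycles (⊤ : Submodule K V) (r + 2) := by
  classical
  refine ⟨fun F hF => chamberFun_of_not hV c hF, fun F hF i hi => ?_⟩
  obtain ⟨i, rfl⟩ : ∃ k : Fin (r + 1), i = k.castSucc := ⟨⟨i, by omega⟩, rfl⟩
  have : Fintype {x : Fin (r + 1) → TitsVertex K V // StrictMono x} := Fintype.ofFinite _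
  let z := chamberOfFlag hV hF
  let y : {y : Fin r → TitsVertex K V // StrictMono y} :=
    ⟨z.1 ∘ i.succAbove, z.2.comp (Fin.strictMono_succAbove i)⟩
  have h := DFunLike.congr_fun hc y
  rw [orderBoundary_apply] at h
  have hsum : ∀ x : {x : Fin (r + 1) → TitsVertex K V // StrictMono x},
      (∑ j : Fin (r + 1), (-1 : ℚ) ^ (j : ℕ) * if x.1 ∘ j.succAbove = y.1 then 1 else 0) =
        (-1 : ℚ) ^ (i : ℕ) * if x.1 ∘ i.succAbove = y.1 then 1 else 0 := by
    intro x
    refine Finset.sum_eq_single i (fun j _ hj => ?_) (by simp)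
    rw [if_neg, mul_zero]
    refine fun h => hj (Fin.succAbove_left_injective (funext fun k => ?_))
    have h1 := congrArg (fun w : TitsVertex K V => finrank K w.1) (congrFun h k)
    simp only [y, Function.comp_apply] at h1
    rw [finrank_of_strictMono hV x.2, finrank_of_strictMono hV z.2] at h1
    exact Fin.ext (by omega)
  have hx : ∀ x : {x : Fin (r + 1) → TitsVertex K V // StrictMono x},
      x.1 ∘ i.succAbove = y.1 ↔ flagOfChamber x.1 = Function.update F i.castSucc (x.1 i).1 := by
    intro x
    constructor
    · intro h
      funext a
      induction a using Fin.lastCases with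
      | last =>
        rw [flagOfChamber_last, Function.update_of_ne (Fin.castSucc_lt_last i).ne']
        exact (hF.eq_of_finrank (by rw [finrank_top, hV]) (by simp)).symm
      | cast a =>
        rw [flagOfChamber_castSucc]
        rcases eq_or_ne a i with rfl | ha
        · rw [Function.update_self]
        · rw [Function.update_of_ne fun h => ha (Fin.castSucc_injective _ h)]
          obtain ⟨k, rfl⟩ := Fin.exists_succAbove_eq ha
          exact congrArg Subtype.val (congrFun h k)
    · intro h
      funext k
      have h1 := congrFun h (i.succAbove k).castSucc
      rw [flagOfChamber_castSucc, Function.update_of_ne fun h =>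
        Fin.succAbove_ne i k (Fin.castSucc_injective _ h)] at h1
      exact Subtype.ext h1
  have h' : (-1 : ℚ) ^ (i : ℕ) * ∑ x ∈ Finset.univ.filter
      (fun x : {x : Fin (r + 1) → TitsVertex K V // StrictMono x} => x.1 ∘ i.succAbove = y.1),
      c x = 0 := by
    refine Eq.trans ?_ h
    rw [Finset.mul_sum, Finset.sum_filter]
    refine Finset.sum_congr rfl fun x _ => ?_
    rw [hsum]
    split_ifs <;> ring
  rw [← (mul_eq_zero.mp h').resolve_left (pow_ne_zero _ (by norm_num))]
  symm
  refine Finset.sum_of_injOn (fun x => (x.1 i).1) (fun x hx' w hw hxw => ?_)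
    (fun _ _ => Finset.mem_coe.mpr (Finset.mem_univ _)) (fun W _ hW => ?_) (fun x hx' => ?_)
  · have h1 := (hx x).mp (Finset.mem_filter.mp hx').2
    have h2 := (hx w).mp (Finset.mem_filter.mp hw).2
    simp only at hxw
    rw [hxw, ← h2] at h1
    rw [← chamberOfFlag_flagOfChamber hV x, ← chamberOfFlag_flagOfChamber hV w]
    simp only [h1]
  · refine chamberFun_of_not hV c fun hF' => hW ⟨chamberOfFlag hV hF', ?_, ?_⟩
    · rw [Finset.mem_coe, Finset.mem_filter]
      refine ⟨Finset.mem_univ _, (hx _).mpr ?_⟩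
      rw [flagOfChamber_chamberOfFlag]
      simp [chamberOfFlag]
    · simp [chamberOfFlag]
  · rw [← (hx x).mp (Finset.mem_filter.mp hx').2, chamberFun_flagOfChamber]

end SteinbergComparison

/-! ### Apartments of the Steinberg module as determinants -/

noncomputable section ApartmentComparison

open Module

variable {K V : Type*} [Field K] [AddCommGroup V] [Module K V]

open Classical in
/-- The matrix of the steps of a flag: the entry at `(k, j)` tells whether `B j` lies in the `k`-th
member but not in the preceding one. The last row is constant `1`, since the last vector of a
permutation of `B` is not subject to a condition. -/
def stepMatrix {m : ℕ} (F : Fin (m + 1) → Submodule K V) (B : Fin (m + 1) → V) :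
    Matrix (Fin (m + 1)) (Fin (m + 1)) ℚ :=
  Matrix.of fun k j => if k = Fin.last m then 1 else if B j ∈ F k ∧ B j ∉ flagPred F k then 1 else 0

theorem det_stepMatrix {m : ℕ} {F : Fin (m + 1) → Submodule K V} (hF : IsFullFlag ⊤ F)
    (hlast : F (Fin.last m) = ⊤) {B : Fin (m + 1) → V} (hB : ∀ j, B j ≠ 0) :
    (stepMatrix F B).det = (incidence F B).det := by
  classical
  symm
  -- an incidence row is the corresponding step row plus the preceding incidence row, except for the
  -- last row, which agrees with that of the step matrix
  refine Matrix.det_eq_of_forall_row_eq_smul_add_pred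
    (fun i => if i.succ = Fin.last m then 0 else 1) (fun j => ?_) (fun i j => ?_)
  · simp only [incidence, stepMatrix, Matrix.of_apply]
    by_cases h : (0 : Fin (m + 1)) = Fin.last m
    · rw [if_pos h, if_pos (by rw [h, hlast]; trivial)]
    · rw [if_neg h]
      refine if_congr (Iff.symm (and_iff_left ?_)) rfl rfl
      rw [flagPred_of_eq_zero F rfl, Submodule.mem_bot]
      exact hB j
  · simp only [incidence, stepMatrix, Matrix.of_apply]
    by_cases h : i.succ = Fin.last m
    · rw [if_pos h, if_pos h, if_pos (by rw [h, hlast]; trivial)]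
      simp
    · have hpred : flagPred F i.succ = F i.castSucc := flagPred_of_ne_zero F (by simp)
      have hle : F i.castSucc ≤ F i.succ := hF.1 (Fin.castSucc_lt_succ (i := i)).le
      rw [if_neg h, if_neg h, hpred]
      by_cases h1 : B j ∈ F i.castSucc
      · simp [h1, hle h1]
      · simp [h1]

/-- The cycle of an apartment. -/
def apartmentCycle {r : ℕ} (hV : finrank K V = r + 2) (B : Fin (r + 2) → V) (hB : ∀ i, B i ≠ 0) :
    OrderChains (TitsVertex K V) (r + 1) :=
  orderChainMap (apartmentMap hV B hB) (r + 1) (sphereCycle (n := r + 2) (by omega))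

theorem orderBoundary_apartmentCycle {r : ℕ} (hV : finrank K V = r + 2) (B : Fin (r + 2) → V)
    (hB : ∀ i, B i ≠ 0) : orderBoundary (TitsVertex K V) r (apartmentCycle hV B hB) = 0 := by
  rw [apartmentCycle, orderChainMap_boundary]
  exact (congrArg _ (sphereCycle_boundary (n := r + 2) (by omega))).trans (map_zero _)

variable [Finite V]

/-- The vectors `B (σ 0), B (σ 1), …` generate the members of a flag exactly if each of them
accounts for one step of the flag. -/
theorem forall_span_image_eq_iff {r : ℕ} {F : Fin (r + 2) → Submodule K V} (hF : IsFullFlag ⊤ F)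
    {B : Fin (r + 2) → V} (hB : ∀ j, B j ≠ 0) (σ : Equiv.Perm (Fin (r + 2))) :
    (∀ k : Fin (r + 1), Submodule.span K (B '' (σ '' {i | (i : ℕ) ≤ k})) = F k.castSucc) ↔
      ∀ k : Fin (r + 1), B (σ k.castSucc) ∈ F k.castSucc ∧
        B (σ k.castSucc) ∉ flagPred F k.castSucc := by
  have hstep : ∀ k : ℕ, ∀ hk : k + 1 < r + 2, ({i : Fin (r + 2) | (i : ℕ) ≤ k + 1}) =
      insert ⟨k + 1, hk⟩ {i : Fin (r + 2) | (i : ℕ) ≤ k} := by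
    intro k hk
    ext i
    simp only [Set.mem_ofPred_eq, Set.mem_insert_iff, Fin.ext_iff]
    omega
  constructor
  · rintro h ⟨k, hk⟩
    refine ⟨?_, ?_⟩
    · rw [← h]
      exact Submodule.subset_span ⟨_, ⟨_, le_refl k, rfl⟩, rfl⟩
    · cases k with
      | zero =>
        rw [flagPred_of_eq_zero F rfl, Submodule.mem_bot]
        exact hB _
      | succ k =>
        intro hmem
        have hpred : flagPred F (Fin.castSucc ⟨k + 1, hk⟩) = F (Fin.castSucc ⟨k, by omega⟩) :=
          flagPred_of_ne_zero F (by simp)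
        have hle : F (Fin.castSucc ⟨k + 1, hk⟩) ≤ F (Fin.castSucc ⟨k, by omega⟩) := by
          rw [← h ⟨k + 1, hk⟩, Submodule.span_le]
          rintro _ ⟨_, ⟨i, hi, rfl⟩, rfl⟩
          rw [hstep k (by omega)] at hi
          rcases hi with rfl | hi
          · rw [hpred] at hmem
            exact hmem
          · rw [← h ⟨k, by omega⟩]
            exact Submodule.subset_span ⟨_, ⟨i, hi, rfl⟩, rfl⟩
        have := Submodule.finrank_mono hle
        rw [hF.2.1, hF.2.1] at this
        simp only [Fin.val_castSucc] at this
        omega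
  · rintro h ⟨k, hk⟩
    have hnext : ∀ k : Fin (r + 1),
        flagPred F k.castSucc ⊔ Submodule.span K {B (σ k.castSucc)} = F k.castSucc := fun k =>
      eq_sup_span_singleton_of_finrank (hF.flagPred_le le_rfl)
        (by rw [hF.2.1, hF.finrank_flagPred]) (h k).1 (h k).2
    induction k with
    | zero =>
      rw [← hnext, flagPred_of_eq_zero F rfl, bot_sup_eq]
      congr 1
      have : ({i : Fin (r + 2) | (i : ℕ) ≤ 0}) = {0} := by
        ext i
        rw [Set.mem_ofPred_eq, Set.mem_singleton_iff, Fin.ext_iff, Fin.val_zero]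
        exact Nat.le_zero
      rw [this, Set.image_singleton, Set.image_singleton]
      rfl
    | succ k ih =>
      have hpred : flagPred F (Fin.castSucc ⟨k + 1, hk⟩) = F (Fin.castSucc ⟨k, by omega⟩) :=
        flagPred_of_ne_zero F (by simp)
      rw [← hnext, hpred, ← ih (by omega)]
      change Submodule.span K (B '' (σ '' {i : Fin (r + 2) | (i : ℕ) ≤ k + 1})) = _
      rw [hstep k (by omega), Set.image_insert_eq, Set.image_insert_eq, Submodule.span_insert,
        sup_comm]
      rfl

/-- The coefficient of a flag in an apartment cycle is the determinant of the incidence matrix,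
also if the vectors are linearly dependent. -/
theorem chamberFun_apartmentCycle {r : ℕ} (hV : finrank K V = r + 2) (B : Fin (r + 2) → V)
    (hB : ∀ i, B i ≠ 0) : chamberFun hV (apartmentCycle hV B hB) = flagFun ⊤ B := by
  classical
  funext F
  by_cases hF : IsFullFlag ⊤ F
  swap
  · rw [chamberFun_of_not hV _ hF, flagFun_of_not B hF]
  rw [chamberFun_of_isFullFlag hV _ hF, flagFun_of_isFullFlag B hF, ← det_stepMatrix hF
    (hF.eq_of_finrank (by rw [finrank_top, hV]) (by simp)) hB, ← Matrix.det_transpose,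
    Matrix.det_apply', apartmentCycle, sphereCycle, map_sum, Finsupp.finsetSum_apply]
  refine Finset.sum_congr rfl fun σ _ => ?_
  have hmap := orderChainMap_orderSimplex (apartmentMap hV B hB)
    (permVertex_monotone (n := r + 2) (by omega) σ)
  rw [map_smul]
  refine (congrArg (fun c : OrderChains (TitsVertex K V) (r + 1) =>
    (((Equiv.Perm.sign σ : ℤ) : ℚ) • c) (chamberOfFlag hV hF)) hmap).trans ?_
  rw [Finsupp.smul_apply, smul_eq_mul]
  congr 1
  refine (orderSimplex_apply _ _).trans ?_
  have hiff : apartmentMap hV B hB ∘ permVertex (n := r + 2) (by omega) σ =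
      (chamberOfFlag hV hF).1 ↔ ∀ k : Fin (r + 1), B (σ k.castSucc) ∈ F k.castSucc ∧
        B (σ k.castSucc) ∉ flagPred F k.castSucc := by
    rw [← forall_span_image_eq_iff hF hB σ, funext_iff]
    exact forall_congr' fun k => Subtype.ext_iff
  rw [Fin.prod_univ_castSucc]
  simp only [Matrix.transpose_apply, stepMatrix, Matrix.of_apply, if_true, mul_one,
    (Fin.castSucc_lt_last _).ne, if_false]
  rw [Finset.prod_ite_zero]
  simp only [Finset.prod_const_one, Finset.mem_univ, true_imp_iff]
  exact if_congr hiff rfl rfl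

theorem frameFun_eq_zero_of_not_linearIndependent {n : ℕ} {B : Fin n → V} (hB : ∀ j, B j ≠ 0)
    (hLI : ¬ LinearIndependent K B) : (frameFun B : SubspaceChain K V (Fin n) → ℚ) = 0 := by
  refine frameFun_eq_zero_of_finrank_lt (S := Submodule.span K (Set.range B))
    (fun j => Submodule.subset_span ⟨j, rfl⟩) hB (lt_of_not_ge fun h => hLI ?_)
  rw [linearIndependent_iff_card_le_finrank_span]
  exact h

/-- The Steinberg module is the span of the apartment functions. There are no simplices above the
top dimension, so the homology is the space of cycles, and by the Solomon–Tits theorem all cycles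
are combinations of apartments. -/
theorem exists_steinbergEquiv [Finite K] {n : ℕ} (hn : 2 ≤ n) (hV : finrank K V = n) :
    ∃ E : Steinberg K V n ≃ₗ[ℚ] frameSpan (Fin n) (⊤ : Submodule K V),
      ∀ (B : Fin n → V) (hB : ∀ i, B i ≠ 0), (E (apartment hn hV B hB)).1 = frameFun B := by
  obtain ⟨r, rfl⟩ := Nat.exists_eq_add_of_le' hn
  have hV' : finrank K (⊤ : Submodule K V) = r + 2 := by rw [finrank_top, hV]
  have hrange : LinearMap.range (orderBoundary (TitsVertex K V) (r + 1)) = ⊥ := by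
    rw [LinearMap.range_eq_bot]
    have := isEmpty_strictMono_titsVertex hV
    ext x
    exact isEmptyElim x
  let E1 : Steinberg K V (r + 2) ≃ₗ[ℚ] LinearMap.ker (orderBoundary (TitsVertex K V) r) :=
    Submodule.quotEquivOfEqBot _ (by
      refine (congrArg (fun W => Submodule.submoduleOf W
        (LinearMap.ker (orderBoundary (TitsVertex K V) r))) hrange).trans ?_
      simp [Submodule.submoduleOf])
  let G : LinearMap.ker (orderBoundary (TitsVertex K V) r) →ₗ[ℚ]
      flagCycles (⊤ : Submodule K V) (r + 2) :=
    (chamberFun hV).restrict fun c hc => chamberFun_mem_flagCycles hV hc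
  have hG : Function.Bijective G := by
    refine ⟨fun c d h => Subtype.ext (chamberFun_injective hV (congrArg Subtype.val h)), ?_⟩
    rintro ⟨f, hf⟩
    have h1 : flagCycles (⊤ : Submodule K V) (r + 2) ≤
        (LinearMap.ker (orderBoundary (TitsVertex K V) r)).map (chamberFun hV) := by
      rw [(flagCycles_eq_span_and_finrank _ _ hV').1, Submodule.span_le]
      rintro _ ⟨B, hB, -, rfl⟩
      exact ⟨_, orderBoundary_apartmentCycle hV B hB.ne_zero,
        chamberFun_apartmentCycle hV B hB.ne_zero⟩
    obtain ⟨c, hc, rfl⟩ := h1 hf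
    exact ⟨⟨c, hc⟩, rfl⟩
  refine ⟨E1 ≪≫ₗ LinearEquiv.ofBijective G hG ≪≫ₗ (frameSpanEquiv hV').symm, fun B hB => ?_⟩
  have hmem : frameFun B ∈ frameSpan (Fin (r + 2)) (⊤ : Submodule K V) := by
    by_cases hLI : LinearIndependent K B
    · exact frameFun_mem_frameSpan hLI fun _ => trivial
    · rw [frameFun_eq_zero_of_not_linearIndependent hB hLI]
      exact Submodule.zero_mem _
  suffices h : (E1 ≪≫ₗ LinearEquiv.ofBijective G hG ≪≫ₗ (frameSpanEquiv hV').symm)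
      (apartment hn hV B hB) = ⟨frameFun B, hmem⟩ from congrArg Subtype.val h
  rw [LinearEquiv.trans_apply, LinearEquiv.trans_apply, LinearEquiv.symm_apply_eq]
  refine Subtype.ext ?_
  exact (chamberFun_apartmentCycle hV B hB).trans (flagRes_frameFun ⊤ B).symm

end ApartmentComparison

/-! ### The dimension of the quotient -/

noncomputable section NonseparatedDimension

open Module

variable {K V : Type*} [Field K] [AddCommGroup V] [Module K V] [Finite V]

/-- Separated apartments of linearly dependent vectors vanish, so that those of bases suffice. -/
theorem finrank_nonseparatedSteinberg [Finite K] (ω : LinearMap.BilinForm K V) {n : ℕ} (hn : 2 ≤ n)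
    (hV : finrank K V = n) :
    finrank ℚ (NonseparatedSteinberg ω hn hV) =
      finrank ℚ (frameSpan (Fin n) (⊤ : Submodule K V) ⧸
        (separatedSpan ω n).submoduleOf (frameSpan (Fin n) (⊤ : Submodule K V))) := by
  obtain ⟨E, hE⟩ := exists_steinbergEquiv (K := K) (V := V) hn hV
  refine (Submodule.Quotient.equiv _ _ E (le_antisymm ?_ ?_)).finrank_eq
  · rw [separatedSubspace, Submodule.map_span_le]
    rintro _ ⟨B, hB, hsep, rfl⟩
    change (E (apartment hn hV B hB)).1 ∈ separatedSpan ω n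
    rw [hE]
    by_cases hLI : LinearIndependent K B
    · exact Submodule.subset_span ⟨B, hLI, hsep, rfl⟩
    · rw [frameFun_eq_zero_of_not_linearIndependent hB hLI]
      exact Submodule.zero_mem _
  · have hle : separatedSpan ω n ≤ ((separatedSubspace ω hn hV).map E.toLinearMap).map
        (frameSpan (Fin n) (⊤ : Submodule K V)).subtype := by
      refine Submodule.span_le.mpr ?_
      rintro _ ⟨B, hB, hsep, rfl⟩
      exact ⟨_, ⟨_, Submodule.subset_span ⟨B, hB.ne_zero, hsep, rfl⟩, rfl⟩, hE B hB.ne_zero⟩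
    intro x hx
    obtain ⟨y, hy, hyx⟩ := hle hx
    rwa [← Subtype.ext hyx]

theorem finrank_nonseparatedSteinberg_eq [Finite K] {ω : LinearMap.BilinForm K V} (hω : ω.IsAlt)
    (hnd : ω.Nondegenerate) {g : ℕ} (hg : 1 ≤ g) (hn : 2 ≤ 2 * g) (hV : finrank K V = 2 * g) :
    (finrank ℚ (NonseparatedSteinberg ω hn hV) : ℚ) =
      symplecticOrder (Nat.card K) g / (g * ((Nat.card K : ℚ) ^ (2 * g) - 1)) := by
  have hV' : finrank K (⊤ : Submodule K V) = 2 * g := by rw [finrank_top, hV]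
  let X : SymplecticSubspace ω := ⟨⊤, by
    intro h
    rw [h, finrank_bot] at hV'
    omega, by
    rw [LinearMap.BilinForm.orthogonal_top_eq_bot hnd]
    exact disjoint_bot_right⟩
  have h1 := finrank_mul_finrank_quotient hω hnd hV' (by omega) X rfl
  have h2 := dynkinTrace_eq_symplecticOrder_div hω g X hV'
  have h3 : dynkinTrace hω hV' X le_top =
      dynkinTrace hω (rfl : finrank K X.1 = _) X le_rfl := by
    have : ∀ {n : ℕ} (h : finrank K X.1 = n), dynkinTrace hω h X le_rfl =
        dynkinTrace hω (rfl : finrank K X.1 = _) X le_rfl := by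
      rintro _ rfl
      rfl
    exact this hV'
  rw [finrank_nonseparatedSteinberg]
  rw [h3, h2, ← pow_mul] at h1
  have hg' : (g : ℚ) ≠ 0 := by exact_mod_cast (show g ≠ 0 by omega)
  have hq : (Nat.card K : ℚ) ^ (2 * g) - 1 ≠ 0 :=
    (sub_pos.mpr (one_lt_pow₀ (by exact_mod_cast (Finite.one_lt_card : 1 < Nat.card K))
      (by omega))).ne'
  rw [eq_div_iff (mul_ne_zero hg' hq)]
  rw [eq_div_iff hq] at h1
  push_cast at h1
  linear_combination h1 / 2

end NonseparatedDimension

theorem proposition3p7 (p g : ℕ) [Fact p.Prime] (hg : 1 ≤ g) :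
    (Module.finrank ℚ (StNS p g hg) : ℚ) =
      (Nat.card (Matrix.symplecticGroup (Fin g) (ZMod p)) : ℚ) /
        ((g : ℚ) * ((p : ℚ) ^ (2 * g) - 1)) := by
  have hω := standardSymplecticForm_isAlt p g
  have hnd := standardSymplecticForm_nondegenerate p g
  have hcard := natCard_hyperbolicFamily hω (S := ⊤) (k := g)
    (by rw [finrank_top, finrank_standard])
    (by
      rw [LinearMap.BilinForm.orthogonal_top_eq_bot hnd]
      exact disjoint_bot_right)
  have h := finrank_nonseparatedSteinberg_eq hω hnd hg (by omega) (finrank_standard p g)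
  rw [natCard_symplecticGroup, hcard]
  rw [Nat.card_zmod] at h ⊢
  exact h
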